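/- **Setting.** A network is a connected undirected graph on $n$ nodes with positive integer edge lengths, distinct node identities, and an arbitrary numbering $1,\dots,\deg(v)$ of the edges at each node $v$ (ports). Let $\delta$ be the weighted distance, and $\delta(v,\emptyset)=\infty$. For $a\in\mathbb N$ let $\mathcal F_a$ be the family of networks whose identities and edge lengths are bounded by $(n+1)^a$. $\widetilde O(\cdot)$ hides factors polylogarithmic in $n$. **The Thorup–Zwick scheme with parameter $k\ge 2$.** Choose landmarks $V=L_0\supseteq L_1\supseteq\dots\supseteq L_{k-1}\supseteq L_k=\emptyset$, $L_{k-1}\ne\emptyset$, and let $$\mathrm{bunch}(v)=\bigcup_{0\le i<k}\{u\in L_i\setminus L_{i+1}:\delta(v,u)<\delta(v,L_{i+1})\},\qquad \mathrm{cluster}(v)=\{u:\delta(v,u)<\delta(u,L_1)\}.$$ It is required that $|L_i|=\widetilde O(n^{1-i/k})$, $|\mathrm{bunch}(v)|=\widetilde O(n^{1/k})$ and $|\mathrm{cluster}(v)|=O(n^{1/k})$ for all $i<k$ and all $v$. Let $l_i(v)$ be a node of $L_i$ nearest to $v$, with $l_i(v)=l_{i+1}(v)$ if $\delta(v,L_i)=\delta(v,L_{i+1})$.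 For each node $w$, let $T(w)$ be the shortest-path tree rooted at $w$ on $\{v: w\in\mathrm{bunch}(v)\}$ in which the parent of $v$ is reached by the smallest port of $v$ that lies on a shortest path to $w$. In a rooted tree the nodes are numbered in the depth-first preorder that visits children in the order of their ports; with $b=\lfloor\sqrt{\lfloor\log_2 n\rfloor}\rfloor+2$, a child is heavy if its subtree has at least a $1/b$ fraction of the nodes in the subtree of its parent, and light otherwise. The tree name $\mathrm{name}_T(v)$ consists of the number of $v$ and of the ports to light children on the way from the root to $v$; the tree table $\mathrm{table}_T(v)$ consists of the first and the last number in the subtree of $v$, the number of light nodes on the way from the root to $v$, the port to the parent, and, for each heavy child, the port to it and the first and the last number in its subtree. (A tree name and a tree table determine the next port on the tree path.) The table of $v$ stores, for each $u\in\mathrm{bunch}(v)$, the identity of $u$, $\mathrm{table}_{T(u)}(v)$ and $\mathrm{name}_{T(u)}(v)$; for each $u\in\mathrm{cluster}(v)$, the identity of $u$ and $\mathrm{name}_{T(v)}(u)$; and, for $0\le i<k$, the identity of $l_i(v)$ and $\mathrm{table}_{T(l_i(v))}(v)$. The name of $v$ is the list of the pairs $(l_i(v),\mathrm{name}_{T(l_i(v))}(v))$,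 $0\le i<k$. A message from $s$ to $t$ is routed in $T(t)$ if $t\in\mathrm{bunch}(s)$; else in $T(s)$ if $t\in\mathrm{cluster}(s)$; else in $T(l_i(t))$ for the least $i$ with $l_i(t)\in\mathrm{bunch}(s)$. In the handshaking variant, $t$ is first queried with the name of $s$ and replies with the least $j$ such that $l_j(s)\in\mathrm{bunch}(t)$, with $l_j(s)$ and with $\mathrm{name}_{T(l_j(s))}(t)$; with $i$ the least index such that $l_i(t)\in\mathrm{bunch}(s)$, the message is routed in $T(l_i(t))$ if $i\le j$, and in $T(l_j(s))$ otherwise. **Verifiability.** Tables of a network are *correct* if they are those of the scheme for some admissible choice of the landmarks and of the $l_i(v)$. A scheme is verifiable on $\mathcal F$ with certificates of $f(n)$ bits if there is a map that, from the identity, the table and the certificate of a node and, for each of its ports, the length of the edge, and the table and the certificate of the neighbour, outputs accept or reject, such that in every network of $\mathcal F$: if the tables are correct, then for some certificates of at most $f(n)$ bits all nodes accept; if the tables (arbitrary bit strings) are not correct, then for all certificates at least one node rejects. **Theorem.** For every $k\ge2$ and all sufficiently large constants in the bounds on $|L_i|$, $|\mathrm{bunch}(v)|$ and $|\mathrm{cluster}(v)|$,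 the scheme and its handshaking variant (i) provide tables for every network; (ii) deliver every message with stretch at most $4k-5$, respectively $2k-1$; and, for every $a$, (iii) on $\mathcal F_a$ they have tables of $\widetilde O(n^{1/k})$ bits and names of polylogarithmically many bits, and they are verifiable on $\mathcal F_a$ with certificates of $\widetilde O(n^{1/k})$ bits. (The hidden constants depend only on $k$, $a$ and the constants in the bounds.) -/

import Mathlib

namespace CompactRouting

noncomputable section

/-! ## Networks -/

/-- A connected network on `n` nodes, with positive integer edge lengths, distinct node identities,
and, at each node `v`, the neighbours of `v` listed in the order of their port numbers
`1, …, deg v` (an arbitrary order). -/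
structure Network (n : ℕ) where
  graph : SimpleGraph (Fin n)
  connected : graph.Connected
  len : Sym2 (Fin n) → ℕ
  len_pos : ∀ e ∈ graph.edgeSet, 0 < len e
  ident : Fin n → ℕ
  ident_injective : Function.Injective ident
  nbrs : Fin n → List (Fin n)
  nbrs_nodup : ∀ v, (nbrs v).Nodup
  mem_nbrs : ∀ v x, x ∈ nbrs v ↔ graph.Adj v x

namespace Network

variable {n : ℕ} (G : Network n)

/-- The port number at `v` of the edge from `v` to its neighbour `x` (between `1` and `deg v`). -/
def port (v x : Fin n) : ℕ := (G.nbrs v).idxOf x + 1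

/-- The weighted distance: the least total length of a walk. -/
def dist (u v : Fin n) : ℕ :=
  sInf (Set.range fun p : G.graph.Walk u v => (p.edges.map G.len).sum)

/-- The weighted distance from `v` to a set of nodes; it is `⊤` for the empty set. -/
def distSet (v : Fin n) (S : Finset (Fin n)) : ℕ∞ := ⨅ u ∈ S, (G.dist v u : ℕ∞)

/-- Identities and edge lengths are bounded by a polynomial in `n`, that is, they are stored on
`O(log n)` bits. -/
def PolyBounded (a : ℕ) : Prop :=
  (∀ v, G.ident v < (n + 1) ^ a) ∧ ∀ e ∈ G.graph.edgeSet, G.len e ≤ (n + 1) ^ a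

end Network

/-! ## Routing schemes -/

/-- A routing scheme with modifiable headers and an optional handshake. The scheme may leave some
choices open, so `spec` is the set of all assignments of tables and names that comply with it.
To send a message from `s` to `t`, the source `s` knows its identity, its table, its name, the name
of `t`, and what `t` replies when it is queried with the name of `s` (a scheme without handshaking
has `Reply = Unit`); from this it computes the header. A node that holds a message looks only at its
own table and at the header; it forwards the message on port `p` (`some p`), or declares the message
to be delivered (`none`). -/
structure RoutingScheme where
  Table : Type
  Name : Type
  Header : Type
  Reply : Type
  encodeTable : Table → List Bool
  encodeName : Name → List Bool
  spec : ∀ {n : ℕ}, Network n → (Fin n → Table) → (Fin n → Name) → Prop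
  reply : Table → Name → Reply
  header : ℕ → Table → Name → Name → Reply → Option Header
  forward : Table → Header → Option ℕ

namespace RoutingScheme

variable (S : RoutingScheme)

/-- With tables `T`, a message with header `h` which is at the first node is forwarded until it is
delivered at the second node, along a route of the given length. -/
inductive Delivers {n : ℕ} (G : Network n) (T : Fin n → S.Table) (h : S.Header) :
    Fin n → Fin n → ℕ → Prop
  | arrive (t : Fin n) : S.forward (T t) h = none → Delivers G T h t t 0
  | step (u x t : Fin n) (r : ℕ) : G.graph.Adj u x → S.forward (T u) h = some (G.port u x) →
      Delivers G T h x t r → Delivers G T h u t (G.len s(u, x) + r)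

/-- The scheme provides tables and names for every network. -/
def Total : Prop :=
  ∀ (n : ℕ) (G : Network n), ∃ (T : Fin n → S.Table) (N : Fin n → S.Name), S.spec G T N

/-- Every message is delivered along a route whose length is at most `σ` times the distance. -/
def HasStretch (σ : ℕ) : Prop :=
  ∀ (n : ℕ) (G : Network n) (T : Fin n → S.Table) (N : Fin n → S.Name), S.spec G T N →
    ∀ s t : Fin n, ∃ h : S.Header,
      S.header (G.ident s) (T s) (N s) (N t) (S.reply (T t) (N s)) = some h ∧
      ∃ r : ℕ, S.Delivers G T h s t r ∧ r ≤ σ * G.dist s t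

/-- On the networks of the family `F`, tables have at most `f n` bits and names at most `g n`. -/
def HasSize (F : ∀ n : ℕ, Network n → Prop) (f g : ℕ → ℝ) : Prop :=
  ∀ (n : ℕ) (G : Network n), F n G →
    ∀ (T : Fin n → S.Table) (N : Fin n → S.Name), S.spec G T N →
      ∀ v, ((S.encodeTable (T v)).length : ℝ) ≤ f n ∧ ((S.encodeName (N v)).length : ℝ) ≤ g n

/-- The memory contents `τ` of the nodes are tables specified by the scheme. -/
def Correct {n : ℕ} (G : Network n) (τ : Fin n → List Bool) : Prop :=
  ∃ (T : Fin n → S.Table) (N : Fin n → S.Name), S.spec G T N ∧ ∀ v, τ v = S.encodeTable (T v)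

end RoutingScheme

/-! ## Local verification -/

/-- What the verification algorithm sees at a node: the identity, the table and the certificate of
the node, and, in the order of the ports, the length of each incident edge together with the table
and the certificate of the neighbour behind it. -/
structure LocalView where
  ident : ℕ
  table : List Bool
  cert : List Bool
  nbrs : List (ℕ × List Bool × List Bool)

/-- The view of `v` for the tables `τ` and the certificates `κ`. -/
def Network.view {n : ℕ} (G : Network n) (τ κ : Fin n → List Bool) (v : Fin n) : LocalView where
  ident := G.ident v
  table := τ v
  cert := κ v
  nbrs := (G.nbrs v).map fun x => (G.len s(v, x), τ x, κ x)

/-- On the networks of the family `F`, the scheme is verifiable with certificates of at most `f n`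
bits: correct tables are accepted by all nodes for suitable certificates of that size, and for
incorrect tables at least one node rejects, whatever the certificates are. -/
def RoutingScheme.Verifiable (S : RoutingScheme) (F : ∀ n : ℕ, Network n → Prop) (f : ℕ → ℝ) :
    Prop :=
  ∃ verif : LocalView → Bool, ∀ (n : ℕ) (G : Network n), F n G → ∀ τ : Fin n → List Bool,
    (S.Correct G τ → ∃ κ : Fin n → List Bool,
      (∀ v, ((κ v).length : ℝ) ≤ f n) ∧ ∀ v, verif (G.view τ κ v) = true) ∧
    (¬ S.Correct G τ → ∀ κ : Fin n → List Bool, ∃ v, verif (G.view τ κ v) = false)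

/-- The bound `C · log ^ C n`, with `1 + log n` for `log n`. -/
def polylog (C n : ℕ) : ℝ := C * (1 + Real.log n) ^ C

/-- The bound `C · n ^ e · log ^ C n`, with `1 + log n` for `log n`. -/
def softO (e : ℝ) (C n : ℕ) : ℝ := (n : ℝ) ^ e * polylog C n

/-! ## Shortest-path trees -/

namespace Network

variable {n : ℕ} (G : Network n)

/-- The neighbour `x` of `v` is on a shortest path from `v` to `w`. -/
def OnShortest (w v x : Fin n) : Prop :=
  G.graph.Adj v x ∧ G.len s(v, x) + G.dist x w = G.dist v w

/-- `p` is the next node after `v` towards `w`: among the neighbours of `v` on shortest paths to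
`w`, the one with the smallest port number at `v`. There is no such `p` for `v = w`. -/
def IsParent (w v p : Fin n) : Prop :=
  G.OnShortest w v p ∧ ∀ y, G.OnShortest w v y → G.port v p ≤ G.port v y

theorem IsParent.dist_lt {G : Network n} {w v p : Fin n} (h : G.IsParent w v p) :
    G.dist p w < G.dist v w := by
  have h1 := G.len_pos s(v, p) ((SimpleGraph.mem_edgeSet _).2 h.1.1)
  have h2 := h.1.2
  omega

/-! In what follows, `U` is the node set of a tree which is rooted at `w` and in which the parent
`p` of `v ≠ w` is given by `IsParent w v p`. -/

open Classical in
/-- The children of `p`. -/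
def children (U : Finset (Fin n)) (w p : Fin n) : Finset (Fin n) :=
  U.filter fun x => G.IsParent w x p

open Classical in
/-- The number of nodes in the subtree rooted at `x`. -/
def subtreeSize (U : Finset (Fin n)) (w x : Fin n) : ℕ :=
  (U.filter fun v => Relation.ReflTransGen (G.IsParent w) v x).card

open Classical in
/-- The number of `v` (starting from `0`) in the depth-first preorder that visits the children of
each node in the order of their ports. -/
def preorder (U : Finset (Fin n)) (w v : Fin n) : ℕ :=
  if h : ∃ p, G.IsParent w v p then
    preorder U w h.choose + 1 +
      ∑ y ∈ (G.children U w h.choose).filter (fun y => G.port h.choose y < G.port h.choose v),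
        G.subtreeSize U w y
  else 0
termination_by G.dist v w
decreasing_by exact h.choose_spec.dist_lt

/-- The largest preorder number in the subtree rooted at `v`. -/
def preorderMax (U : Finset (Fin n)) (w v : Fin n) : ℕ :=
  G.preorder U w v + G.subtreeSize U w v - 1

/-- The parameter `b ≥ 2` that separates heavy from light children; with this order of magnitude,
tree tables and tree names have `O(log² n / log log n)` bits. -/
def branching (n : ℕ) : ℕ := Nat.sqrt (Nat.log 2 n) + 2

/-- The child `x` of `p` is heavy: its subtree has at least a `1 / b` fraction of the nodes in the
subtree of `p`. The other children are light. -/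
def IsHeavy (U : Finset (Fin n)) (w p x : Fin n) : Prop :=
  G.subtreeSize U w p ≤ branching n * G.subtreeSize U w x

open Classical in
/-- The ports leading to light children on the way from the root down to `v`. -/
def lightPorts (U : Finset (Fin n)) (w v : Fin n) : List ℕ :=
  if h : ∃ p, G.IsParent w v p then
    lightPorts U w h.choose ++
      (if G.IsHeavy U w h.choose v then [] else [G.port h.choose v])
  else []
termination_by G.dist v w
decreasing_by exact h.choose_spec.dist_lt

open Classical in
/-- The port of `v` leading to its parent, and `0` at the root. -/
def parentPort (w v : Fin n) : ℕ :=
  if h : ∃ p, G.IsParent w v p then G.port v h.choose else 0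

end Network

/-! ## Compact routing in trees -/

/-- The routing table of a node in a tree: its preorder number, the largest preorder number in its
subtree, its number of light ancestors (itself included), the port to its parent, and, for each of
its heavy children, the port to that child with the first and the last preorder number in the
subtree of the child. -/
structure TreeTable where
  num : ℕ
  numMax : ℕ
  lightDepth : ℕ
  parentPort : ℕ
  heavy : List (ℕ × ℕ × ℕ)

/-- The name of a node in a tree: its preorder number and the ports to light children on the way
from the root to the node. -/
structure TreeName where
  num : ℕ
  light : List ℕ

/-- Routing in a tree: deliver, or forward to the parent, to a heavy child, or to a light child. -/
def TreeTable.forward (T : TreeTable) (N : TreeName) : Option ℕ :=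
  if N.num = T.num then none
  else if N.num < T.num ∨ T.numMax < N.num then some T.parentPort
  else
    match T.heavy.find? (fun e => decide (e.2.1 ≤ N.num ∧ N.num ≤ e.2.2)) with
    | some e => some e.1
    | none => some (N.light.getD T.lightDepth 0)

namespace Network

variable {n : ℕ} (G : Network n)

open Classical in
/-- The routing table of `v` in the tree on `U` rooted at `w`. -/
def treeTable (U : Finset (Fin n)) (w v : Fin n) : TreeTable where
  num := G.preorder U w v
  numMax := G.preorderMax U w v
  lightDepth := (G.lightPorts U w v).length
  parentPort := G.parentPort w v
  heavy :=
    ((G.nbrs v).filter fun x => decide (x ∈ G.children U w v ∧ G.IsHeavy U w v x)).map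
      fun x => (G.port v x, G.preorder U w x, G.preorderMax U w x)

/-- The name of `v` in the tree on `U` rooted at `w`. -/
def treeName (U : Finset (Fin n)) (w v : Fin n) : TreeName where
  num := G.preorder U w v
  light := G.lightPorts U w v

/-! ## Landmarks, bunches and clusters -/

open Classical in
/-- `u` is in the bunch of `v` if, for the level `i` with `u ∈ L i \ L (i + 1)`, the node `v` is
strictly closer to `u` than to `L (i + 1)`. -/
def bunch (k : ℕ) (L : ℕ → Finset (Fin n)) (v : Fin n) : Finset (Fin n) :=
  Finset.univ.filter fun u =>
    ∃ i < k, u ∈ L i ∧ u ∉ L (i + 1) ∧ (G.dist v u : ℕ∞) < G.distSet v (L (i + 1))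

open Classical in
/-- `u` is in the cluster of `v` if `u` is strictly closer to `v` than to `L 1`. The cluster of a
node of `L 1` is empty, and `u ∈ cluster v` implies `v ∈ bunch u`. -/
def cluster (L : ℕ → Finset (Fin n)) (v : Fin n) : Finset (Fin n) :=
  Finset.univ.filter fun u => (G.dist v u : ℕ∞) < G.distSet u (L 1)

open Classical in
/-- The nodes of the tree rooted at `w`: all nodes that have `w` in their bunch. -/
def treeNodes (k : ℕ) (L : ℕ → Finset (Fin n)) (w : Fin n) : Finset (Fin n) :=
  Finset.univ.filter fun v => w ∈ G.bunch k L v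

/-- `V = L 0 ⊇ L 1 ⊇ … ⊇ L (k - 1) ⊇ L k = ∅` is a hierarchy of landmarks of the required sizes;
`c` stands for the constants in `O` and `Õ`. -/
structure IsHierarchy (k c : ℕ) (L : ℕ → Finset (Fin n)) : Prop where
  zero : L 0 = Finset.univ
  anti : ∀ i, L (i + 1) ⊆ L i
  nonempty : (L (k - 1)).Nonempty
  top : L k = ∅
  card_le : ∀ i < k, ((L i).card : ℝ) ≤ softO (1 - (i : ℝ) / k) c n
  bunch_le : ∀ v, ((G.bunch k L v).card : ℝ) ≤ softO (1 / (k : ℝ)) c n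
  cluster_le : ∀ v, ((G.cluster L v).card : ℝ) ≤ c * (n : ℝ) ^ (1 / (k : ℝ))

/-- `l i v` is a landmark of `L i` nearest to `v`; if `L (i + 1)` is as close to `v` as `L i`, then
it is the landmark chosen for `L (i + 1)`. -/
def IsNearest (k : ℕ) (L : ℕ → Finset (Fin n)) (l : ℕ → Fin n → Fin n) : Prop :=
  ∀ v, ∀ i < k, l i v ∈ L i ∧ (G.dist v (l i v) : ℕ∞) = G.distSet v (L i) ∧
    (G.distSet v (L i) = G.distSet v (L (i + 1)) → l i v = l (i + 1) v)

end Network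

/-! ## Tables and names -/

/-- A routing table: for the nodes of the bunch, their identities with the table and the name of the
node in their trees; for the nodes of the cluster, their identities with their names in the tree of
the node; for `i = 0, …, k - 1`, the identity of the nearest landmark of level `i`, with the table
of the node in the tree of that landmark. -/
structure Table where
  bunch : List (ℕ × TreeTable × TreeName)
  cluster : List (ℕ × TreeName)
  landmarks : List (ℕ × TreeTable)

/-- A name: for `i = 0, …, k - 1`, the identity of the nearest landmark of level `i`, with the name
of the node in the tree of that landmark. -/
abbrev Name := List (ℕ × TreeName)

/-- A header: the identity of the root of the tree to be used, with the name of the target in that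
tree. -/
structure Header where
  root : ℕ
  target : TreeName

/-- The list `l` enumerates, in any order and without repetition, the values `f u` for `u ∈ A`. -/
def Enumerates {n : ℕ} {α : Type} (l : List α) (A : Finset (Fin n)) (f : Fin n → α) : Prop :=
  l.Nodup ∧ ∀ e, e ∈ l ↔ ∃ u ∈ A, f u = e

/-- `T` is a table of `v` for the landmarks `L` and the nearest landmarks `l`. -/
def Network.IsTable {n : ℕ} (G : Network n) (k : ℕ) (L : ℕ → Finset (Fin n))
    (l : ℕ → Fin n → Fin n) (v : Fin n) (T : Table) : Prop :=
  Enumerates T.bunch (G.bunch k L v) (fun u =>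
    (G.ident u, G.treeTable (G.treeNodes k L u) u v, G.treeName (G.treeNodes k L u) u v)) ∧
  Enumerates T.cluster (G.cluster L v) (fun u =>
    (G.ident u, G.treeName (G.treeNodes k L v) v u)) ∧
  T.landmarks = (List.range k).map fun i =>
    (G.ident (l i v), G.treeTable (G.treeNodes k L (l i v)) (l i v) v)

/-- The name of `v`. -/
def Network.nameOf {n : ℕ} (G : Network n) (k : ℕ) (L : ℕ → Finset (Fin n))
    (l : ℕ → Fin n → Fin n) (v : Fin n) : Name :=
  (List.range k).map fun i =>
    (G.ident (l i v), G.treeName (G.treeNodes k L (l i v)) (l i v) v)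

/-- The tables `T` and the names `N` are those given by some hierarchy of landmarks. -/
def Network.IsThorupZwick {n : ℕ} (G : Network n) (k c : ℕ) (T : Fin n → Table)
    (N : Fin n → Name) : Prop :=
  ∃ (L : ℕ → Finset (Fin n)) (l : ℕ → Fin n → Fin n),
    G.IsHierarchy k c L ∧ G.IsNearest k L l ∧
    ∀ v, G.IsTable k L l v (T v) ∧ N v = G.nameOf k L l v

/-! Self-delimiting binary encodings. -/

/-- Each binary digit is preceded by `true`, and `false` marks the end. -/
def natCode (m : ℕ) : List Bool := (m.bits.flatMap fun d => [true, d]) ++ [false]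

/-- The number of entries, followed by the entries. -/
def listCode {α : Type} (f : α → List Bool) (l : List α) : List Bool :=
  natCode l.length ++ l.flatMap f

def TreeTable.code (T : TreeTable) : List Bool :=
  natCode T.num ++ natCode T.numMax ++ natCode T.lightDepth ++ natCode T.parentPort ++
    listCode (fun e => natCode e.1 ++ natCode e.2.1 ++ natCode e.2.2) T.heavy

def TreeName.code (N : TreeName) : List Bool := natCode N.num ++ listCode natCode N.light

def Table.code (T : Table) : List Bool :=
  listCode (fun e => natCode e.1 ++ e.2.1.code ++ e.2.2.code) T.bunch ++
    listCode (fun e => natCode e.1 ++ e.2.code) T.cluster ++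
    listCode (fun e => natCode e.1 ++ e.2.code) T.landmarks

def Name.code (N : Name) : List Bool := listCode (fun e => natCode e.1 ++ e.2.code) N

/-! ## Routing -/

/-- The node with identity `i` is in the bunch stored in the table. -/
def Table.inBunch (T : Table) (i : ℕ) : Bool := T.bunch.any fun e => e.1 == i

/-- Forwarding in the tree that is named in the header. (Port `0` does not exist.) -/
def Table.forward (T : Table) (h : Header) : Option ℕ :=
  match T.bunch.find? (fun e => e.1 == h.root) with
  | some e => e.2.1.forward h.target
  | none => some 0

/-- The header computed by the source, with identity `s` and table `S`, from the name of the target: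
the tree of the target if the target is in the bunch of the source; else the tree of the source if
the target is in the cluster of the source; else the tree of the first landmark in the name of the
target that is in the bunch of the source. -/
def plainHeader (s : ℕ) (S : Table) : Name → Option Header
  | [] => none
  | (t, x) :: N =>
    if S.inBunch t then some ⟨t, x⟩
    else
      match S.cluster.find? (fun e => e.1 == t) with
      | some e => some ⟨s, e.2⟩
      | none => (N.find? fun e => S.inBunch e.1).map fun e => ⟨e.1, e.2⟩

/-- The reply of a target with table `T` that is queried with the name `NS` of the source: the least
index `j` such that the `j`-th landmark of the source is in the bunch of the target, with this
landmark and the name of the target in its tree. -/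
def handshakeReply (T : Table) (NS : Name) : ℕ × Option Header :=
  (NS.findIdx (fun e => T.inBunch e.1),
    (NS.find? fun e => T.inBunch e.1).bind fun e =>
      (T.bunch.find? fun e' => e'.1 == e.1).map fun e' => ⟨e.1, e'.2.2⟩)

/-- The header with handshaking. Let `i` be the least index such that the `i`-th landmark of the
target is in the bunch of the source, and `j` the index replied by the target: the header is the one
for the `i`-th landmark of the target if `i ≤ j`, and the replied one otherwise. -/
def handshakeHeader (S : Table) (NT : Name) (R : ℕ × Option Header) : Option Header :=
  if NT.findIdx (fun e => S.inBunch e.1) ≤ R.1 then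
    (NT.find? fun e => S.inBunch e.1).map fun e => ⟨e.1, e.2⟩
  else R.2

/-- The routing scheme of Thorup and Zwick with parameter `k`, without handshaking; `c` stands for
the constants in the bounds on the sizes of landmark sets, bunches and clusters. -/
def thorupZwick (k c : ℕ) : RoutingScheme where
  Table := Table
  Name := Name
  Header := Header
  Reply := Unit
  encodeTable := Table.code
  encodeName := Name.code
  spec := fun G T N => G.IsThorupZwick k c T N
  reply := fun _ _ => ()
  header := fun s S _ NT _ => plainHeader s S NT
  forward := Table.forward

/-- The routing scheme of Thorup and Zwick with parameter `k`, with handshaking. -/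
def thorupZwickHandshake (k c : ℕ) : RoutingScheme where
  Table := Table
  Name := Name
  Header := Header
  Reply := ℕ × Option Header
  encodeTable := Table.code
  encodeName := Name.code
  spec := fun G T N => G.IsThorupZwick k c T N
  reply := handshakeReply
  header := fun _ S _ NT R => handshakeHeader S NT R
  forward := Table.forward

end

end CompactRouting

/-!
The scheme exists for `c ≥ 3 * k + 8` because landmarks can be chosen greedily. Fix `q` about
`n ^ (1 / k)`. About `#W / q * log n` nodes of a set `W` hit, for every node `v`, the set of the `q`
nodes of `W` nearest to `v` (`Network.exists_sparse_subset`); iterating this gives levels for which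
each level but the last contributes at most `q` nodes to a bunch. Such landmarks also bound the
average size of the clusters of the nodes of `W`, so at most half of `W` keeps clusters that are too
large, and `O(log n)` repetitions make all clusters small (`Network.exists_small_clusters`).

The tables are right for routing because the subtree of a node is an interval of preorder numbers
(`Network.IsTree.desc_iff_preorder`); hence a message travels along the tree path, of length at most
the sum of the distances of both ends from the root (`Network.IsTree.exists_delivers`). The stretch
follows by bounding the distance from `t` to its `i`-th landmark while landmarks are outside the
bunches: it grows by `2 * δ(s, t)` per level in the plain scheme, starting with `δ(s, t)` at level
`1` because `t` is outside the cluster of `s`, and by `δ(s, t)` per level with a handshake, where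
the two ends are treated alike.

For the sizes, each light edge halves the subtree, and a node has at most `branching n` heavy
children, so that a bunch or a cluster needs polylogarithmically many bits for each of its nodes.

For the verification, the certificate of a node repeats its table, with distances, identities of
parents and subtree sizes (`Cert`). The distances to the levels and to the nodes of the bunch and of
the cluster are pinned down by the local equations for shortest paths
(`Network.mem_iff_of_sourceRules`), and the tree data by recursions along the edges to the parents
(`Network.IsTree.eq_nodeRec_of_treeRule`). In the tree of a node `v` these edges can be checked for
the bunches, as the ends of an edge see each other. The cluster of `v` is less direct: `v` stores
the names of remote nodes. But the parent of such a node `y` in the tree of `v` is the one with the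
smallest port among the parents of `y` in the trees of the neighbours of `v` that are on shortest
paths to `y`, so that `v` can check it with the clusters of its neighbours
(`Network.LocallyCorrect.cluster_link`). Finally, the tree of a landmark of the last level spans the
network, and counting along it yields `n` and the sizes of the levels. All codes are prefix codes,
so nodes agree on what a certificate says.
-/

namespace CompactRouting

noncomputable section

/-! ### Distances, ports and parents -/

namespace Network

variable {n : ℕ} {G : Network n}

theorem dist_le_walk {u v : Fin n} (p : G.graph.Walk u v) :
    G.dist u v ≤ (p.edges.map G.len).sum :=
  Nat.sInf_le ⟨p, rfl⟩

theorem exists_walk_sum_eq_dist (u v : Fin n) :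
    ∃ p : G.graph.Walk u v, (p.edges.map G.len).sum = G.dist u v := by
  have : Nonempty (G.graph.Walk u v) := G.connected.preconnected u v
  exact Nat.sInf_mem (Set.range_nonempty fun p : G.graph.Walk u v => (p.edges.map G.len).sum)

@[simp] theorem dist_self (v : Fin n) : G.dist v v = 0 :=
  Nat.le_zero.1 (dist_le_walk (SimpleGraph.Walk.nil : G.graph.Walk v v))

theorem dist_triangle (u v w : Fin n) : G.dist u w ≤ G.dist u v + G.dist v w := by
  obtain ⟨p, hp⟩ := exists_walk_sum_eq_dist (G := G) u v
  obtain ⟨q, hq⟩ := exists_walk_sum_eq_dist (G := G) v w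
  have := dist_le_walk (p.append q)
  rw [SimpleGraph.Walk.edges_append, List.map_append, List.sum_append] at this
  omega

theorem dist_comm (u v : Fin n) : G.dist u v = G.dist v u := by
  have key : ∀ u v : Fin n, G.dist u v ≤ G.dist v u := fun u v => by
    obtain ⟨p, hp⟩ := exists_walk_sum_eq_dist (G := G) v u
    have := dist_le_walk p.reverse
    rwa [SimpleGraph.Walk.edges_reverse, List.map_reverse, List.sum_reverse, hp] at this
  exact le_antisymm (key u v) (key v u)

theorem dist_le_len {u v : Fin n} (h : G.graph.Adj u v) : G.dist u v ≤ G.len s(u, v) := by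
  simpa using dist_le_walk (SimpleGraph.Walk.cons h SimpleGraph.Walk.nil)

theorem dist_le_len_add {u x : Fin n} (h : G.graph.Adj u x) (w : Fin n) :
    G.dist u w ≤ G.len s(u, x) + G.dist x w :=
  (dist_triangle u x w).trans (Nat.add_le_add_right (dist_le_len h) _)

theorem len_pos' {u v : Fin n} (h : G.graph.Adj u v) : 0 < G.len s(u, v) :=
  G.len_pos _ ((SimpleGraph.mem_edgeSet _).2 h)

theorem exists_onShortest {w v : Fin n} (h : v ≠ w) : ∃ x, G.OnShortest w v x := by
  obtain ⟨p, hp⟩ := exists_walk_sum_eq_dist (G := G) v w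
  cases p with
  | nil => exact absurd rfl h
  | @cons _ x _ hx q =>
    refine ⟨x, hx, ?_⟩
    rw [SimpleGraph.Walk.edges_cons, List.map_cons, List.sum_cons] at hp
    have h1 := dist_le_walk q
    have h2 := dist_le_len_add hx w
    omega

theorem OnShortest.dist_lt {w v x : Fin n} (h : G.OnShortest w v x) :
    G.dist x w < G.dist v w := by
  have := len_pos' h.1
  have := h.2
  omega

theorem dist_eq_zero {u v : Fin n} : G.dist u v = 0 ↔ u = v := by
  refine ⟨fun h => ?_, fun h => h ▸ dist_self u⟩
  by_contra hne
  obtain ⟨x, hx⟩ := exists_onShortest (G := G) hne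
  have := hx.dist_lt
  omega

theorem OnShortest.ne {w v x : Fin n} (h : G.OnShortest w v x) : v ≠ w := by
  rintro rfl
  have := h.dist_lt
  rw [dist_self] at this
  omega

/-- Induction along shortest paths to `w`. -/
theorem shortest_induction {w : Fin n} {P : Fin n → Prop} (hw : P w)
    (step : ∀ v x, G.OnShortest w v x → P x → P v) (v : Fin n) : P v := by
  induction h : G.dist v w using Nat.strong_induction_on generalizing v with
  | _ d ih =>
    by_cases hv : v = w
    · exact hv ▸ hw
    · obtain ⟨x, hx⟩ := exists_onShortest (G := G) hv
      exact step v x hx (ih _ (h ▸ hx.dist_lt) x rfl)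

theorem port_pos (v x : Fin n) : 0 < G.port v x := Nat.succ_pos _

theorem port_inj {v x y : Fin n} (hx : G.graph.Adj v x) (h : G.port v x = G.port v y) :
    x = y :=
  (List.idxOf_inj ((G.mem_nbrs v x).2 hx)).1 (Nat.succ.inj h)

theorem port_le {v x : Fin n} (hx : G.graph.Adj v x) : G.port v x ≤ n := by
  have h1 : (G.nbrs v).idxOf x < (G.nbrs v).length :=
    List.idxOf_lt_length_iff.2 ((G.mem_nbrs v x).2 hx)
  have h2 : (G.nbrs v).length ≤ n := by
    simpa using (G.nbrs_nodup v).length_le_card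
  exact Nat.succ_le_of_lt (h1.trans_le h2)

theorem exists_isParent {w v : Fin n} (h : v ≠ w) : ∃ p, G.IsParent w v p := by
  classical
  obtain ⟨x, hx⟩ := exists_onShortest (G := G) h
  obtain ⟨p, hp, hmin⟩ := Finset.exists_min_image
    (Finset.univ.filter fun x => G.OnShortest w v x) (G.port v) ⟨x, by simpa using hx⟩
  exact ⟨p, by simpa using hp, fun y hy => hmin y (by simpa using hy)⟩

theorem IsParent.adj {w v p : Fin n} (h : G.IsParent w v p) : G.graph.Adj v p := h.1.1

theorem IsParent.ne {w v p : Fin n} (h : G.IsParent w v p) : v ≠ w := h.1.ne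

theorem IsParent.unique {w v p q : Fin n} (hp : G.IsParent w v p) (hq : G.IsParent w v q) :
    p = q :=
  port_inj hp.adj (le_antisymm (hp.2 q hq.1) (hq.2 p hp.1))

theorem IsParent.choose_eq {w v p : Fin n} (hp : G.IsParent w v p)
    (h : ∃ p, G.IsParent w v p) : h.choose = p :=
  h.choose_spec.unique hp

theorem not_exists_isParent_self (w : Fin n) : ¬ ∃ p, G.IsParent w w p :=
  fun ⟨_, h⟩ => h.ne rfl

/-! ### Distances to sets -/

theorem distSet_le {v u : Fin n} {S : Finset (Fin n)} (hu : u ∈ S) :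
    G.distSet v S ≤ (G.dist v u : ℕ∞) :=
  iInf₂_le u hu

theorem le_distSet {v : Fin n} {S : Finset (Fin n)} {d : ℕ∞}
    (h : ∀ u ∈ S, d ≤ (G.dist v u : ℕ∞)) : d ≤ G.distSet v S :=
  le_iInf₂ h

@[simp] theorem distSet_empty (v : Fin n) : G.distSet v ∅ = ⊤ := by
  simp [distSet]

theorem distSet_anti {v : Fin n} {S T : Finset (Fin n)} (h : S ⊆ T) :
    G.distSet v T ≤ G.distSet v S :=
  le_distSet fun _ hu => distSet_le (h hu)

theorem exists_distSet_eq {v : Fin n} {S : Finset (Fin n)} (hS : S.Nonempty) :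
    ∃ u ∈ S, (G.dist v u : ℕ∞) = G.distSet v S := by
  obtain ⟨u, hu, hmin⟩ := Finset.exists_min_image S (G.dist v) hS
  exact ⟨u, hu, le_antisymm (le_distSet fun x hx => by exact_mod_cast hmin x hx) (distSet_le hu)⟩

theorem distSet_le_dist_add (v x : Fin n) (S : Finset (Fin n)) :
    G.distSet v S ≤ G.dist v x + G.distSet x S := by
  rcases S.eq_empty_or_nonempty with rfl | hS
  · simp
  · obtain ⟨u, hu, h⟩ := exists_distSet_eq (G := G) (v := x) hS
    rw [← h]
    exact (distSet_le hu).trans (by exact_mod_cast dist_triangle v x u)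

theorem distSet_eq_zero {v : Fin n} {S : Finset (Fin n)} : G.distSet v S = 0 ↔ v ∈ S := by
  constructor
  · intro h
    rcases S.eq_empty_or_nonempty with rfl | hS
    · simp at h
    · obtain ⟨u, hu, h'⟩ := exists_distSet_eq (G := G) (v := v) hS
      rw [h] at h'
      rwa [dist_eq_zero.1 (by exact_mod_cast h' : G.dist v u = 0)]
  · intro h
    simpa using distSet_le (G := G) (v := v) h

end Network

/-! ### Preorder numbers and light ports in a tree -/

namespace Network

variable {n : ℕ} {G : Network n}

/-- `U` contains `w` and is closed under taking parents, so that the edges from the nodes of `U` to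
their parents form a tree on `U` rooted at `w`. -/
structure IsTree (G : Network n) (U : Finset (Fin n)) (w : Fin n) : Prop where
  root_mem : w ∈ U
  parent_mem : ∀ v ∈ U, ∀ p, G.IsParent w v p → p ∈ U

/-- `v` is `x` or a descendant of `x` in the tree rooted at `w`. -/
def Desc (G : Network n) (w v x : Fin n) : Prop := Relation.ReflTransGen (G.IsParent w) v x

theorem Desc.dist_le {w v x : Fin n} (h : G.Desc w v x) : G.dist x w ≤ G.dist v w := by
  induction h with
  | refl => exact le_rfl
  | tail _ h ih => exact h.dist_lt.le.trans ih

theorem desc_iff {w v x : Fin n} :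
    G.Desc w v x ↔ v = x ∨ ∃ p, G.IsParent w v p ∧ G.Desc w p x := by
  unfold Desc
  rw [Relation.ReflTransGen.cases_head_iff]

theorem IsParent.desc_iff {w v x p : Fin n} (h : G.IsParent w v p) :
    G.Desc w v x ↔ v = x ∨ G.Desc w p x := by
  rw [Network.desc_iff]
  exact or_congr_right ⟨fun ⟨q, hq, hd⟩ => h.unique hq ▸ hd, fun hd => ⟨p, h, hd⟩⟩

theorem desc_root (w v : Fin n) : G.Desc w v w := by
  induction h : G.dist v w using Nat.strong_induction_on generalizing v with
  | _ d ih =>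
    by_cases hv : v = w
    · exact hv ▸ Relation.ReflTransGen.refl
    · obtain ⟨p, hp⟩ := exists_isParent (G := G) hv
      exact hp.desc_iff.2 (Or.inr (ih _ (h ▸ hp.dist_lt) p rfl))

/-- Induction along the paths of the tree rooted at `w`. -/
theorem parent_induction {w : Fin n} {P : Fin n → Prop} (hw : P w)
    (step : ∀ v p, G.IsParent w v p → P p → P v) (v : Fin n) : P v := by
  induction desc_root (G := G) w v using Relation.ReflTransGen.head_induction_on with
  | refl => exact hw
  | head h _ ih => exact step _ _ h ih

theorem Desc.eq_of_siblings {w v p x y : Fin n} (hx : G.IsParent w x p) (hy : G.IsParent w y p)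
    (h1 : G.Desc w v x) (h2 : G.Desc w v y) : x = y := by
  have key : ∀ {x y : Fin n}, G.IsParent w x p → G.IsParent w y p → G.Desc w x y → x = y := by
    intro x y hx hy h
    rcases hx.desc_iff.1 h with h | h
    · exact h
    · exact absurd h.dist_le (not_le.2 hy.dist_lt)
  rcases Relation.ReflTransGen.total_of_right_unique
    (fun _ _ _ ha hb => ha.unique hb) h1 h2 with h | h
  · exact key hx hy h
  · exact (key hy hx h).symm

theorem Desc.exists_child {w v p : Fin n} (h : G.Desc w v p) (hne : v ≠ p) :
    ∃ x, G.IsParent w x p ∧ G.Desc w v x := by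
  rcases Relation.ReflTransGen.cases_tail h with h | ⟨x, hvx, hxp⟩
  · exact absurd h.symm hne
  · exact ⟨x, hxp, hvx⟩

theorem IsTree.desc_mem {U : Finset (Fin n)} {w v x : Fin n} (hU : G.IsTree U w) (hv : v ∈ U)
    (h : G.Desc w v x) : x ∈ U := by
  induction h with
  | refl => exact hv
  | tail _ h ih => exact hU.parent_mem _ ih _ h

theorem mem_children {U : Finset (Fin n)} {w p x : Fin n} :
    x ∈ G.children U w p ↔ x ∈ U ∧ G.IsParent w x p := by
  simp [children]

open Classical in
/-- The sum of the weights `f v` over the nodes `v` of the subtree rooted at `x`. -/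
def subtreeSum (G : Network n) (U : Finset (Fin n)) (w : Fin n) (f : Fin n → ℕ) (x : Fin n) : ℕ :=
  ∑ v ∈ U.filter fun v => G.Desc w v x, f v

theorem subtreeSize_eq_subtreeSum (U : Finset (Fin n)) (w x : Fin n) :
    G.subtreeSize U w x = G.subtreeSum U w (fun _ => 1) x := by
  rw [subtreeSize, subtreeSum, Finset.card_eq_sum_ones]
  rfl

theorem subtreeSum_root (U : Finset (Fin n)) (w : Fin n) (f : Fin n → ℕ) :
    G.subtreeSum U w f w = ∑ v ∈ U, f v := by
  classical
  exact Finset.sum_congr (Finset.filter_true_of_mem fun v _ => desc_root w v) fun _ _ => rfl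

theorem IsTree.subtreeSum_eq {U : Finset (Fin n)} {w : Fin n} (hU : G.IsTree U w)
    (f : Fin n → ℕ) {p : Fin n} (hp : p ∈ U) :
    G.subtreeSum U w f p = f p + ∑ x ∈ G.children U w p, G.subtreeSum U w f x := by
  classical
  have hsplit : (U.filter fun v => G.Desc w v p) =
      insert p ((G.children U w p).biUnion fun x => U.filter fun v => G.Desc w v x) := by
    ext v
    simp only [Finset.mem_filter, Finset.mem_insert, Finset.mem_biUnion, mem_children]
    constructor
    · rintro ⟨hv, hd⟩
      by_cases hvp : v = p
      · exact Or.inl hvp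
      · obtain ⟨x, hx, hvx⟩ := hd.exists_child hvp
        exact Or.inr ⟨x, ⟨hU.desc_mem hv hvx, hx⟩, hv, hvx⟩
    · rintro (rfl | ⟨x, ⟨_, hx⟩, hv, hvx⟩)
      · exact ⟨hp, Relation.ReflTransGen.refl⟩
      · exact ⟨hv, hvx.tail hx⟩
  unfold subtreeSum
  rw [hsplit, Finset.sum_insert, Finset.sum_biUnion]
  · intro x hx y hy hxy
    refine Finset.disjoint_left.2 fun v hv hv' => hxy ?_
    exact Desc.eq_of_siblings (mem_children.1 hx).2 (mem_children.1 hy).2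
      (Finset.mem_filter.1 hv).2 (Finset.mem_filter.1 hv').2
  · intro h
    obtain ⟨x, hx, hpx⟩ := Finset.mem_biUnion.1 h
    exact absurd (Desc.dist_le (Finset.mem_filter.1 hpx).2)
      (not_le.2 (mem_children.1 hx).2.dist_lt)

theorem IsTree.subtreeSize_eq {U : Finset (Fin n)} {w : Fin n} (hU : G.IsTree U w) {p : Fin n}
    (hp : p ∈ U) :
    G.subtreeSize U w p = 1 + ∑ x ∈ G.children U w p, G.subtreeSize U w x := by
  simp only [subtreeSize_eq_subtreeSum]
  exact hU.subtreeSum_eq _ hp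

theorem IsTree.subtreeSize_pos {U : Finset (Fin n)} {w : Fin n} (hU : G.IsTree U w) {p : Fin n}
    (hp : p ∈ U) : 0 < G.subtreeSize U w p := by
  rw [hU.subtreeSize_eq hp]
  omega

theorem subtreeSize_le (U : Finset (Fin n)) (w p : Fin n) : G.subtreeSize U w p ≤ n := by
  classical
  exact (Finset.card_le_univ _).trans (by simp)

theorem preorder_root (U : Finset (Fin n)) (w : Fin n) : G.preorder U w w = 0 := by
  rw [preorder, dif_neg (not_exists_isParent_self w)]

open Classical in
theorem preorder_eq (U : Finset (Fin n)) {w v p : Fin n} (h : G.IsParent w v p) :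
    G.preorder U w v = G.preorder U w p + 1 +
      ∑ y ∈ (G.children U w p).filter (fun y => G.port p y < G.port p v),
        G.subtreeSize U w y := by
  have hc : (⟨p, h⟩ : ∃ p, G.IsParent w v p).choose = p := h.choose_eq _
  rw [preorder, dif_pos ⟨p, h⟩, hc]

theorem lightPorts_root (U : Finset (Fin n)) (w : Fin n) : G.lightPorts U w w = [] := by
  rw [lightPorts, dif_neg (not_exists_isParent_self w)]

open Classical in
theorem lightPorts_eq (U : Finset (Fin n)) {w v p : Fin n} (h : G.IsParent w v p) :
    G.lightPorts U w v =
      G.lightPorts U w p ++ if G.IsHeavy U w p v then [] else [G.port p v] := by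
  have hc : (⟨p, h⟩ : ∃ p, G.IsParent w v p).choose = p := h.choose_eq _
  rw [lightPorts, dif_pos ⟨p, h⟩, hc]

theorem parentPort_root (w : Fin n) : G.parentPort w w = 0 := by
  rw [parentPort, dif_neg (not_exists_isParent_self w)]

theorem parentPort_eq {w v p : Fin n} (h : G.IsParent w v p) :
    G.parentPort w v = G.port v p := by
  have hc : (⟨p, h⟩ : ∃ p, G.IsParent w v p).choose = p := h.choose_eq _
  rw [parentPort, dif_pos ⟨p, h⟩, hc]

/-- The numbers of the subtrees of two siblings are separated in the order of their ports. -/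
theorem IsTree.preorder_add_le_of_port_lt {U : Finset (Fin n)} {w p x y : Fin n}
    (hx : x ∈ U) (hxp : G.IsParent w x p) (hyp : G.IsParent w y p)
    (h : G.port p x < G.port p y) :
    G.preorder U w x + G.subtreeSize U w x ≤ G.preorder U w y := by
  classical
  rw [preorder_eq U hxp, preorder_eq U hyp, add_assoc]
  refine Nat.add_le_add_left ?_ _
  rw [add_comm, ← Finset.sum_insert (by simp)]
  refine Finset.sum_le_sum_of_subset fun z hz => ?_
  rcases Finset.mem_insert.1 hz with rfl | hz
  · exact Finset.mem_filter.2 ⟨mem_children.2 ⟨hx, hxp⟩, h⟩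
  · exact Finset.mem_filter.2 ⟨(Finset.mem_filter.1 hz).1, (Finset.mem_filter.1 hz).2.trans h⟩

theorem IsTree.preorder_add_le_parent {U : Finset (Fin n)} {w p x : Fin n} (hU : G.IsTree U w)
    (hx : x ∈ U) (hxp : G.IsParent w x p) :
    G.preorder U w x + G.subtreeSize U w x ≤ G.preorder U w p + G.subtreeSize U w p := by
  classical
  rw [preorder_eq U hxp, hU.subtreeSize_eq (hU.parent_mem x hx p hxp), add_assoc, add_assoc]
  refine Nat.add_le_add_left (Nat.add_le_add_left ?_ _) _
  rw [add_comm, ← Finset.sum_insert (by simp)]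
  refine Finset.sum_le_sum_of_subset fun z hz => ?_
  rcases Finset.mem_insert.1 hz with rfl | hz
  · exact mem_children.2 ⟨hx, hxp⟩
  · exact (Finset.mem_filter.1 hz).1

theorem preorder_parent_lt (U : Finset (Fin n)) {w p x : Fin n} (hxp : G.IsParent w x p) :
    G.preorder U w p < G.preorder U w x := by
  classical
  rw [preorder_eq U hxp]
  omega

theorem IsTree.preorder_of_desc {U : Finset (Fin n)} {w v x : Fin n} (hU : G.IsTree U w)
    (hv : v ∈ U) (h : G.Desc w v x) :
    G.preorder U w x ≤ G.preorder U w v ∧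
      G.preorder U w v + G.subtreeSize U w v ≤ G.preorder U w x + G.subtreeSize U w x := by
  induction h with
  | refl => exact ⟨le_rfl, le_rfl⟩
  | tail hd h ih =>
    have h1 := preorder_parent_lt U h
    have h2 := hU.preorder_add_le_parent (hU.desc_mem hv hd) h
    omega

/-- The subtree of `x` consists of the nodes whose numbers lie in the interval of `x`. -/
theorem IsTree.desc_iff_preorder {U : Finset (Fin n)} {w v x : Fin n} (hU : G.IsTree U w)
    (hv : v ∈ U) (hx : x ∈ U) :
    G.Desc w v x ↔
      G.preorder U w x ≤ G.preorder U w v ∧ G.preorder U w v ≤ G.preorderMax U w x := by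
  have hpos := fun {z} (hz : z ∈ U) => hU.subtreeSize_pos hz
  unfold preorderMax
  constructor
  · intro h
    have h1 := hU.preorder_of_desc hv h
    have h2 := hpos hv
    omega
  · induction hd : G.dist x w using Nat.strong_induction_on generalizing x with
    | _ d ih =>
      intro h
      by_cases hxw : x = w
      · subst hxw; exact desc_root x v
      · obtain ⟨p, hp⟩ := exists_isParent (G := G) hxw
        have hpU := hU.parent_mem x hx p hp
        have h1 := preorder_parent_lt U hp
        have h2 := hU.preorder_add_le_parent hx hp
        have h3 := hpos hx
        have hvp : G.Desc w v p := ih _ (hd ▸ hp.dist_lt) hpU rfl (by omega)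
        obtain ⟨y, hy, hvy⟩ := hvp.exists_child (by rintro rfl; omega)
        have hyU := hU.desc_mem hv hvy
        have h4 := hU.preorder_of_desc hv hvy
        have h5 := hpos hv
        rcases lt_trichotomy (G.port p x) (G.port p y) with hlt | heq | hlt
        · have := IsTree.preorder_add_le_of_port_lt hx hp hy hlt
          omega
        · have hAdj : G.graph.Adj p x := hp.adj.symm
          exact port_inj hAdj heq ▸ hvy
        · have := IsTree.preorder_add_le_of_port_lt hyU hy hp hlt
          omega

theorem lightPorts_prefix_of_desc (U : Finset (Fin n)) {w v x : Fin n} (h : G.Desc w v x) :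
    G.lightPorts U w x <+: G.lightPorts U w v := by
  classical
  induction h using Relation.ReflTransGen.head_induction_on with
  | refl => exact List.prefix_rfl
  | head h _ ih =>
    rw [lightPorts_eq U h]
    exact ih.trans (List.prefix_append _ _)

/-! ### Routing in a tree -/

/-- A node whose subtree does not contain the target `t` forwards to its parent. -/
theorem IsTree.forward_up {U : Finset (Fin n)} {w v t p : Fin n} (hU : G.IsTree U w)
    (hv : v ∈ U) (ht : t ∈ U) (h : ¬ G.Desc w t v) (hp : G.IsParent w v p) :
    (G.treeTable U w v).forward (G.treeName U w t) = some (G.port v p) := by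
  rw [hU.desc_iff_preorder ht hv] at h
  have hs := hU.subtreeSize_pos hv
  have hne : G.preorder U w t ≠ G.preorder U w v := by
    intro he
    apply h
    unfold preorderMax
    omega
  rw [TreeTable.forward, if_neg (show ¬ (G.treeName U w t).num = (G.treeTable U w v).num from hne),
    if_pos, ← parentPort_eq hp]
  · rfl
  · simp only [treeTable, treeName]
    omega

/-- A node `v` forwards to its child `x` on the way to the target `t`. If `x` is heavy, then it is
found in the table; otherwise its port is in the name of `t`, at the position given by the number of
light nodes on the way to `v`. -/
theorem IsTree.forward_down {U : Finset (Fin n)} {w v t x : Fin n} (hU : G.IsTree U w)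
    (ht : t ∈ U) (hx : G.IsParent w x v) (htx : G.Desc w t x) :
    (G.treeTable U w v).forward (G.treeName U w t) = some (G.port v x) := by
  classical
  have hxU := hU.desc_mem ht htx
  have hv := hU.parent_mem x hxU v hx
  have htv : G.Desc w t v := htx.tail hx
  have h1 := (hU.desc_iff_preorder ht hv).1 htv
  have h2 := (hU.desc_iff_preorder ht hxU).1 htx
  have h3 := preorder_parent_lt U hx
  rw [TreeTable.forward, if_neg (by simp only [treeTable, treeName]; omega),
    if_neg (by simp only [treeTable, treeName]; omega)]
  -- An entry for a heavy child whose interval contains the number of `t` is the entry for `x`.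
  have huniq : ∀ e ∈ ((G.nbrs v).filter fun y =>
      decide (y ∈ G.children U w v ∧ G.IsHeavy U w v y)).map
        (fun y => (G.port v y, G.preorder U w y, G.preorderMax U w y)),
      (e.2.1 ≤ G.preorder U w t ∧ G.preorder U w t ≤ e.2.2) →
        G.IsHeavy U w v x ∧ e.1 = G.port v x := by
    intro e he hint
    obtain ⟨y, hy, rfl⟩ := List.mem_map.1 he
    obtain ⟨hyc, hyh⟩ := of_decide_eq_true (List.mem_filter.1 hy).2
    obtain ⟨hyU, hyv⟩ := mem_children.1 hyc
    have hty := (hU.desc_iff_preorder ht hyU).2 hint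
    have := Desc.eq_of_siblings hx hyv htx hty
    subst this
    exact ⟨hyh, rfl⟩
  split
  · next e he =>
    have h4 := List.find?_some he
    rw [decide_eq_true_iff] at h4
    rw [(huniq e (List.mem_of_find?_eq_some he) h4).2]
  · next hnone =>
    have hlight : ¬ G.IsHeavy U w v x := by
      intro hh
      rw [List.find?_eq_none] at hnone
      refine hnone (G.port v x, G.preorder U w x, G.preorderMax U w x)
        (List.mem_map.2 ⟨x, List.mem_filter.2 ⟨(G.mem_nbrs v x).2 hx.adj.symm, ?_⟩, rfl⟩) ?_
      · exact decide_eq_true ⟨mem_children.2 ⟨hxU, hx⟩, hh⟩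
      · exact decide_eq_true h2
    obtain ⟨l, hl⟩ := lightPorts_prefix_of_desc U htx
    simp only [treeTable, treeName]
    rw [← hl, lightPorts_eq U hx, if_neg hlight]
    simp

/-- If all nodes of the tree forward as in the tree, then a message is delivered along the path
down from an ancestor `v` of the target `t`. -/
theorem IsTree.exists_delivers_of_desc {S : RoutingScheme} {T : Fin n → S.Table} {h : S.Header}
    {U : Finset (Fin n)} {w t v : Fin n} (hU : G.IsTree U w) (ht : t ∈ U)
    (hf : ∀ v ∈ U, S.forward (T v) h = (G.treeTable U w v).forward (G.treeName U w t))
    (hd : G.Desc w t v) :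
    ∃ r, S.Delivers G T h v t r ∧ r + G.dist v w = G.dist t w := by
  induction hd with
  | refl =>
    refine ⟨0, .arrive t ?_, Nat.zero_add _⟩
    rw [hf t ht, TreeTable.forward,
      if_pos (show (G.treeName U w t).num = (G.treeTable U w t).num from rfl)]
  | @tail x v hd hx ih =>
    obtain ⟨r, hr, hr'⟩ := ih
    have hxU := hU.desc_mem ht hd
    refine ⟨_, .step v x t r hx.adj.symm ?_ hr, ?_⟩
    · rw [hf v (hU.parent_mem x hxU v hx), hU.forward_down ht hx hd]
    · have := hx.1.2
      rw [Sym2.eq_swap]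
      omega

/-- The message climbs until the target is in the subtree of the current node, and then descends. -/
theorem IsTree.exists_delivers {S : RoutingScheme} {T : Fin n → S.Table} {h : S.Header}
    {U : Finset (Fin n)} {w t v : Fin n} (hU : G.IsTree U w) (ht : t ∈ U) (hv : v ∈ U)
    (hf : ∀ v ∈ U, S.forward (T v) h = (G.treeTable U w v).forward (G.treeName U w t)) :
    ∃ r, S.Delivers G T h v t r ∧ r ≤ G.dist v w + G.dist t w := by
  induction hd : G.dist v w using Nat.strong_induction_on generalizing v with
  | _ d ih =>
    by_cases htv : G.Desc w t v
    · obtain ⟨r, hr, hr'⟩ := hU.exists_delivers_of_desc ht hf htv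
      exact ⟨r, hr, by omega⟩
    · have hvw : v ≠ w := by
        rintro rfl
        exact htv (desc_root v t)
      obtain ⟨p, hp⟩ := exists_isParent (G := G) hvw
      obtain ⟨r, hr, hr'⟩ := ih _ (hd ▸ hp.dist_lt) (hU.parent_mem v hv p hp) rfl
      refine ⟨_, .step v p t r hp.adj ?_ hr, ?_⟩
      · rw [hf v hv, hU.forward_up hv ht htv hp]
      · have := hp.1.2
        omega

end Network

/-! ### Landmarks, bunches and clusters -/

namespace Network

variable {n : ℕ} {G : Network n} {k c : ℕ} {L : ℕ → Finset (Fin n)} {l : ℕ → Fin n → Fin n}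

theorem mem_bunch {v u : Fin n} :
    u ∈ G.bunch k L v ↔
      ∃ i < k, u ∈ L i ∧ u ∉ L (i + 1) ∧ (G.dist v u : ℕ∞) < G.distSet v (L (i + 1)) := by
  simp [bunch]

theorem mem_cluster {v u : Fin n} :
    u ∈ G.cluster L v ↔ (G.dist v u : ℕ∞) < G.distSet u (L 1) := by
  simp [cluster]

theorem mem_treeNodes {v w : Fin n} : v ∈ G.treeNodes k L w ↔ w ∈ G.bunch k L v := by
  simp [treeNodes]

/-- A hierarchy of landmarks `V = L 0 ⊇ L 1 ⊇ … ⊇ L (k - 1) ⊇ L k = ∅` of any sizes. -/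
structure IsLandmarks (k : ℕ) (L : ℕ → Finset (Fin n)) : Prop where
  zero : L 0 = Finset.univ
  anti : ∀ i, L (i + 1) ⊆ L i
  nonempty : (L (k - 1)).Nonempty
  top : L k = ∅

theorem IsHierarchy.isLandmarks (hL : G.IsHierarchy k c L) : IsLandmarks k L :=
  ⟨hL.zero, hL.anti, hL.nonempty, hL.top⟩

namespace IsLandmarks

theorem antitone (hL : IsLandmarks k L) : Antitone L :=
  antitone_nat_of_succ_le hL.anti

theorem lt_of_mem (hL : IsLandmarks k L) {i : ℕ} {u : Fin n} (hu : u ∈ L i) : i < k := by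
  by_contra h
  have := hL.antitone (not_lt.1 h) hu
  rw [hL.top] at this
  simp at this

theorem nonempty_of_lt (hL : IsLandmarks k L) {i : ℕ} (hi : i < k) : (L i).Nonempty :=
  hL.nonempty.mono (hL.antitone (by omega))

theorem exists_level (hL : IsLandmarks k L) {i : ℕ} {u : Fin n} (hu : u ∈ L i) :
    ∃ j, i ≤ j ∧ j < k ∧ u ∈ L j ∧ u ∉ L (j + 1) := by
  by_contra! h
  have key : ∀ m, u ∈ L (i + m) := by
    intro m
    induction m with
    | zero => exact hu
    | succ m ih => exact h (i + m) (by omega) (hL.lt_of_mem ih) ih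
  have := hL.lt_of_mem (key k)
  omega

theorem distSet_le_of_not_mem_bunch (hL : IsLandmarks k L) {i : ℕ} {u v : Fin n}
    (hu : u ∈ L i) (h : u ∉ G.bunch k L v) : G.distSet v (L (i + 1)) ≤ G.dist v u := by
  obtain ⟨j, hij, hj, huj, huj'⟩ := hL.exists_level hu
  by_contra hlt
  refine h (mem_bunch.2 ⟨j, hj, huj, huj', (not_le.1 hlt).trans_le ?_⟩)
  exact distSet_anti (hL.antitone (by omega))

theorem mem_bunch_of_mem_last (hL : IsLandmarks k L) (hk : 0 < k) {u : Fin n}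
    (hu : u ∈ L (k - 1)) (v : Fin n) : u ∈ G.bunch k L v := by
  refine mem_bunch.2 ⟨k - 1, by omega, hu, ?_, ?_⟩ <;> rw [Nat.sub_add_cancel hk, hL.top] <;> simp

theorem self_mem_bunch (hL : IsLandmarks k L) (v : Fin n) : v ∈ G.bunch k L v := by
  obtain ⟨j, -, hj, hvj, hvj'⟩ := hL.exists_level (i := 0) (u := v) (by simp [hL.zero])
  refine mem_bunch.2 ⟨j, hj, hvj, hvj', ?_⟩
  rw [dist_self, Nat.cast_zero, pos_iff_ne_zero, Ne, distSet_eq_zero]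
  exact hvj'

end IsLandmarks

theorem lt_distSet_of_onShortest {u v x : Fin n} {S : Finset (Fin n)} (hx : G.OnShortest u v x)
    (h : (G.dist v u : ℕ∞) < G.distSet v S) : (G.dist x u : ℕ∞) < G.distSet x S := by
  by_contra hle
  refine absurd h (not_lt.2 ?_)
  calc G.distSet v S ≤ G.dist v x + G.distSet x S := distSet_le_dist_add v x S
    _ ≤ G.len s(v, x) + G.dist x u :=
      add_le_add (by exact_mod_cast dist_le_len hx.1) (not_lt.1 hle)
    _ = G.dist v u := by exact_mod_cast hx.2

theorem mem_bunch_of_onShortest {u v x : Fin n} (hx : G.OnShortest u v x)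
    (h : u ∈ G.bunch k L v) : u ∈ G.bunch k L x := by
  obtain ⟨i, hi, h1, h2, h3⟩ := mem_bunch.1 h
  exact mem_bunch.2 ⟨i, hi, h1, h2, lt_distSet_of_onShortest hx h3⟩

/-- Towards `w`, the distance to `w` drops by the full length of each edge, and the distance to the
next level by at most this length; hence the nodes with `w` in their bunch are closed under parents.
-/
theorem IsLandmarks.isTree (hL : IsLandmarks k L) (w : Fin n) :
    G.IsTree (G.treeNodes k L w) w where
  root_mem := mem_treeNodes.2 (hL.self_mem_bunch w)
  parent_mem _ hv _ hp := mem_treeNodes.2 (mem_bunch_of_onShortest hp.1 (mem_treeNodes.1 hv))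

theorem IsLandmarks.mem_bunch_of_mem_cluster (hL : IsLandmarks k L) {u v : Fin n}
    (hk : 0 < k) (h : u ∈ G.cluster L v) : v ∈ G.bunch k L u := by
  rw [mem_cluster, dist_comm] at h
  refine mem_bunch.2 ⟨0, hk, by simp [hL.zero], fun hv => ?_, h⟩
  exact absurd h (not_lt.2 (distSet_le hv))

theorem IsNearest.mem_bunch (hl : G.IsNearest k L l) (hL : IsLandmarks k L) {i : ℕ}
    (hi : i < k) (v : Fin n) : l i v ∈ G.bunch k L v := by
  induction h : k - 1 - i generalizing i with
  | zero =>
    have := (hl v i hi).1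
    rw [show i = k - 1 by omega] at this ⊢
    exact hL.mem_bunch_of_mem_last (by omega) this v
  | succ m ih =>
    obtain ⟨h1, h2, h3⟩ := hl v i hi
    by_cases heq : G.distSet v (L i) = G.distSet v (L (i + 1))
    · rw [h3 heq]
      exact ih (by omega) (by omega)
    · have hlt : (G.dist v (l i v) : ℕ∞) < G.distSet v (L (i + 1)) :=
        h2 ▸ lt_of_le_of_ne (distSet_anti (hL.anti i)) heq
      refine Network.mem_bunch.2 ⟨i, hi, h1, fun hmem => ?_, hlt⟩
      exact absurd hlt (not_lt.2 (distSet_le hmem))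

theorem IsNearest.zero (hl : G.IsNearest k L l) (hL : IsLandmarks k L) (hk : 0 < k)
    (v : Fin n) : l 0 v = v := by
  have h := (hl v 0 hk).2.1
  rw [distSet_eq_zero.2 (by simp [hL.zero])] at h
  exact (dist_eq_zero.1 (by exact_mod_cast h)).symm

/-- Landmarks can always be completed by a choice of nearest landmarks. -/
theorem IsLandmarks.exists_isNearest (hL : IsLandmarks k L) :
    ∃ l, G.IsNearest k L l := by
  have key : ∀ v, ∃ f : ℕ → Fin n, ∀ i < k, f i ∈ L i ∧
      (G.dist v (f i) : ℕ∞) = G.distSet v (L i) ∧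
      (G.distSet v (L i) = G.distSet v (L (i + 1)) → f i = f (i + 1)) := by
    intro v
    have step : ∀ m ≤ k, ∃ f : ℕ → Fin n, ∀ i < k, k - m ≤ i → f i ∈ L i ∧
        (G.dist v (f i) : ℕ∞) = G.distSet v (L i) ∧
        (G.distSet v (L i) = G.distSet v (L (i + 1)) → f i = f (i + 1)) := by
      intro m
      induction m with
      | zero => exact fun _ => ⟨fun _ => v, fun i hi hi' => by omega⟩
      | succ m ih =>
        intro hm
        obtain ⟨f, hf⟩ := ih (by omega)
        have hi : k - (m + 1) < k := by omega
        obtain ⟨u, hu, hdu⟩ := exists_distSet_eq (G := G) (v := v) (hL.nonempty_of_lt hi)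
        by_cases heq : G.distSet v (L (k - (m + 1))) = G.distSet v (L (k - (m + 1) + 1))
        · refine ⟨Function.update f (k - (m + 1)) (f (k - (m + 1) + 1)), fun i hik hi' => ?_⟩
          have hm0 : m ≠ 0 := by
            rintro rfl
            rw [show k - (0 + 1) + 1 = k by omega, hL.top, distSet_empty, ← hdu] at heq
            exact ENat.natCast_ne_top _ heq
          rcases hi'.eq_or_lt with rfl | hlt
          · obtain ⟨h1, h2, -⟩ := hf (k - (m + 1) + 1) (by omega) (by omega)
            rw [Function.update_self, Function.update_of_ne (by omega)]
            exact ⟨hL.anti _ h1, h2.trans heq.symm, fun _ => rfl⟩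
          · rw [Function.update_of_ne (by omega), Function.update_of_ne (by omega)]
            exact hf i hik (by omega)
        · refine ⟨Function.update f (k - (m + 1)) u, fun i hik hi' => ?_⟩
          rcases hi'.eq_or_lt with rfl | hlt
          · rw [Function.update_self]
            exact ⟨hu, hdu, fun h => absurd h heq⟩
          · rw [Function.update_of_ne (by omega), Function.update_of_ne (by omega)]
            exact hf i hik (by omega)
    obtain ⟨f, hf⟩ := step k le_rfl
    exact ⟨f, fun i hi => hf i hi (by omega)⟩
  choose f hf using key
  exact ⟨fun i v => f v i, fun v i hi => hf v i hi⟩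

end Network

/-! ### Routing between two nodes and the stretch -/

theorem Enumerates.find?_eq_some {n : ℕ} {α : Type} {s : List α} {A : Finset (Fin n)}
    {f : Fin n → α} (h : Enumerates s A f) {key : α → ℕ} {g : Fin n → ℕ}
    (hg : Function.Injective g) (hkey : ∀ u, key (f u) = g u) {u : Fin n} (hu : u ∈ A) :
    s.find? (fun e => key e == g u) = some (f u) := by
  cases hfind : s.find? (fun e => key e == g u) with
  | none =>
    rw [List.find?_eq_none] at hfind
    exact absurd (beq_iff_eq.2 (hkey u)) (hfind _ ((h.2 _).2 ⟨u, hu, rfl⟩))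
  | some e =>
    have h1 := List.find?_some hfind
    obtain ⟨x, -, rfl⟩ := (h.2 e).1 (List.mem_of_find?_eq_some hfind)
    rw [beq_iff_eq, hkey] at h1
    rw [hg h1]

theorem Enumerates.exists_key_iff {n : ℕ} {α : Type} {s : List α} {A : Finset (Fin n)}
    {f : Fin n → α} (h : Enumerates s A f) {key : α → ℕ} {g : Fin n → ℕ}
    (hg : Function.Injective g) (hkey : ∀ u, key (f u) = g u) {u : Fin n} :
    (∃ e ∈ s, key e = g u) ↔ u ∈ A := by
  constructor
  · rintro ⟨e, he, hu⟩
    obtain ⟨x, hx, rfl⟩ := (h.2 e).1 he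
    rw [hkey] at hu
    exact hg hu ▸ hx
  · exact fun hu => ⟨f u, (h.2 _).2 ⟨u, hu, rfl⟩, hkey u⟩

theorem find?_map_range_eq_some {α : Type} {k i : ℕ} {f : ℕ → α} {p : α → Bool} (hi : i < k)
    (hp : p (f i) = true) (hmin : ∀ j < i, p (f j) = false) :
    ((List.range k).map f).find? p = some (f i) := by
  rw [List.find?_eq_some_iff_getElem]
  exact ⟨hp, i, by simpa using hi, by simp, fun j hj => by simp [hmin j hj]⟩

theorem findIdx_map_range_eq {α : Type} {k i : ℕ} {f : ℕ → α} {p : α → Bool} (hi : i < k)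
    (hp : p (f i) = true) (hmin : ∀ j < i, p (f j) = false) :
    ((List.range k).map f).findIdx p = i := by
  rw [List.findIdx_eq (by simpa using hi)]
  exact ⟨by simpa using hp, fun j hj => by simp [hmin j hj]⟩

namespace Network

variable {n : ℕ} {G : Network n} {k c : ℕ} {L : ℕ → Finset (Fin n)} {l : ℕ → Fin n → Fin n}

theorem IsTable.inBunch_iff {v : Fin n} {T : Table} (h : G.IsTable k L l v T) (u : Fin n) :
    T.inBunch (G.ident u) = true ↔ u ∈ G.bunch k L v := by
  rw [← h.1.exists_key_iff (key := Prod.fst) G.ident_injective (fun _ => rfl)]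
  simp [Table.inBunch]

theorem IsTable.inBunch_eq_false {v : Fin n} {T : Table} (h : G.IsTable k L l v T) {u : Fin n}
    (hu : u ∉ G.bunch k L v) : T.inBunch (G.ident u) = false := by
  rwa [← Bool.not_eq_true, h.inBunch_iff]

theorem IsTable.forward_eq {v w : Fin n} {T : Table} (h : G.IsTable k L l v T)
    (hw : w ∈ G.bunch k L v) (N : TreeName) :
    T.forward ⟨G.ident w, N⟩ = (G.treeTable (G.treeNodes k L w) w v).forward N := by
  simp only [Table.forward]
  rw [h.1.find?_eq_some (key := Prod.fst) G.ident_injective (fun _ => rfl) hw]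

/-- Routing in the tree of `w` from `s` to `t`, where the tables of all nodes are correct. -/
theorem exists_delivers_treeNodes (hL : IsLandmarks k L) {S : RoutingScheme}
    {T : Fin n → S.Table} {h : S.Header} {w s t : Fin n} {T' : Fin n → Table}
    (hT : ∀ v, G.IsTable k L l v (T' v)) (hs : w ∈ G.bunch k L s) (ht : w ∈ G.bunch k L t)
    (hf : ∀ v, S.forward (T v) h =
      (T' v).forward ⟨G.ident w, G.treeName (G.treeNodes k L w) w t⟩) :
    ∃ r, S.Delivers G T h s t r ∧ r ≤ G.dist s w + G.dist t w :=
  (hL.isTree w).exists_delivers (mem_treeNodes.2 ht) (mem_treeNodes.2 hs) fun v hv => by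
    rw [hf v, (hT v).forward_eq (mem_treeNodes.1 hv)]

theorem IsNearest.dist_le (hl : G.IsNearest k L l) {i : ℕ} (hi : i < k) {v u : Fin n}
    (hu : u ∈ L i) : G.dist v (l i v) ≤ G.dist v u := by
  have := distSet_le (G := G) (v := v) hu
  rw [← (hl v i hi).2.1] at this
  exact_mod_cast this

/-- If the `i`-th landmark of `t` is not in the bunch of `s`, then there is a landmark of the next
level which is at most as far from `s`. -/
theorem IsNearest.dist_succ_le (hl : G.IsNearest k L l) (hL : IsLandmarks k L) {i : ℕ}
    (hi : i < k) {s t : Fin n} (h : l i t ∉ G.bunch k L s) :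
    i + 1 < k ∧ G.dist s (l (i + 1) s) ≤ G.dist s (l i t) := by
  have hmem := (hl t i hi).1
  have hlt : i + 1 < k := by
    by_contra hk
    rw [show i = k - 1 by omega] at hmem h
    exact h (hL.mem_bunch_of_mem_last (by omega) hmem s)
  refine ⟨hlt, ?_⟩
  have := hL.distSet_le_of_not_mem_bunch hmem h
  rw [← (hl s (i + 1) hlt).2.1] at this
  exact_mod_cast this

theorem IsNearest.exists_least_mem_bunch (hl : G.IsNearest k L l) (hL : IsLandmarks k L)
    (hk : 0 < k) (s t : Fin n) :
    ∃ i < k, l i t ∈ G.bunch k L s ∧ ∀ j < i, l j t ∉ G.bunch k L s := by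
  classical
  have hex : ∃ i, i < k ∧ l i t ∈ G.bunch k L s :=
    ⟨k - 1, by omega, hL.mem_bunch_of_mem_last hk (hl t (k - 1) (by omega)).1 s⟩
  refine ⟨Nat.find hex, (Nat.find_spec hex).1, (Nat.find_spec hex).2, fun j hj hmem => ?_⟩
  exact Nat.find_min hex hj ⟨hj.trans (Nat.find_spec hex).1, hmem⟩

/-- While the landmarks of `t` are outside the bunch of `s`, their distance from `t` grows by at
most `2 * G.dist s t` in each level; the first one is at distance at most `G.dist s t` because `t`
is not in the cluster of `s`. -/
theorem IsNearest.dist_le_of_not_mem_cluster (hl : G.IsNearest k L l)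
    (hL : IsLandmarks k L) {s t : Fin n} (hc : t ∉ G.cluster L s) {i : ℕ} (hi : i + 1 < k)
    (h : ∀ j ≤ i, l j t ∉ G.bunch k L s) :
    G.dist t (l (i + 1) t) ≤ (2 * i + 1) * G.dist s t := by
  induction i with
  | zero =>
    rw [mem_cluster, not_lt, ← (hl t 1 hi).2.1] at hc
    have : G.dist t (l 1 t) ≤ G.dist s t := by exact_mod_cast hc
    simpa using this
  | succ i ih =>
    have h1 := ih (by omega) fun j hj => h j (by omega)
    have h2 := (hl.dist_succ_le hL (by omega) (h (i + 1) le_rfl)).2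
    have h3 := hl.dist_le (v := t) hi (hl s (i + 1 + 1) hi).1
    have h4 := dist_triangle (G := G) t s (l (i + 1 + 1) s)
    have h5 := dist_triangle (G := G) s t (l (i + 1) t)
    rw [dist_comm t s] at h4
    have h6 : (2 * (i + 1) + 1) * G.dist s t = (2 * i + 1) * G.dist s t + 2 * G.dist s t := by
      ring
    omega

/-- While the landmarks of `t` are outside the bunch of `s` and those of `s` are outside the bunch
of `t`, their distances grow by at most `G.dist s t` in each level. -/
theorem IsNearest.dist_le_handshake (hl : G.IsNearest k L l) (hL : IsLandmarks k L)
    (hk : 0 < k) {s t : Fin n} {i : ℕ} (hi : i < k) (h : ∀ j < i, l j t ∉ G.bunch k L s)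
    (h' : ∀ j < i, l j s ∉ G.bunch k L t) :
    G.dist t (l i t) ≤ i * G.dist s t ∧ G.dist s (l i s) ≤ i * G.dist s t := by
  induction i with
  | zero => simp [hl.zero hL hk]
  | succ i ih =>
    obtain ⟨h1, h2⟩ := ih (by omega) (fun j hj => h j (by omega)) fun j hj => h' j (by omega)
    have h3 := (hl.dist_succ_le hL (by omega) (h i (by omega))).2
    have h4 := (hl.dist_succ_le hL (by omega) (h' i (by omega))).2
    have h5 := dist_triangle (G := G) s t (l i t)
    have h6 := dist_triangle (G := G) t s (l i s)
    rw [dist_comm t s] at h6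
    have h7 : (i + 1) * G.dist s t = i * G.dist s t + G.dist s t := by ring
    omega

end Network

section Headers

open Network

theorem thorupZwick_hasStretch {k : ℕ} (hk : 2 ≤ k) (c : ℕ) :
    (thorupZwick k c).HasStretch (4 * k - 5) := by
  intro n G (T : Fin n → Table) (N : Fin n → Name) hspec s t
  obtain ⟨L, l, hH, hl, hTN⟩ := hspec
  have hL := hH.isLandmarks
  have hT : ∀ v, G.IsTable k L l v (T v) := fun v => (hTN v).1
  -- It suffices to find a tree in which the sum of the distances to the root is small.
  suffices h : ∃ w, w ∈ G.bunch k L s ∧ w ∈ G.bunch k L t ∧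
      plainHeader (G.ident s) (T s) (N t) =
        some ⟨G.ident w, G.treeName (G.treeNodes k L w) w t⟩ ∧
      G.dist s w + G.dist t w ≤ (4 * k - 5) * G.dist s t by
    obtain ⟨w, hs, ht, hhead, hle⟩ := h
    obtain ⟨r, hr, hr'⟩ := exists_delivers_treeNodes (S := thorupZwick k c)
      (h := (⟨G.ident w, G.treeName (G.treeNodes k L w) w t⟩ : Header)) (T := T) hL hT hs ht
      (fun _ => rfl)
    exact ⟨_, hhead, r, hr, hr'.trans hle⟩
  have hname : N t = (G.ident t, G.treeName (G.treeNodes k L t) t t) ::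
      ((List.range (k - 1)).map Nat.succ).map (fun i =>
        (G.ident (l i t), G.treeName (G.treeNodes k L (l i t)) (l i t) t)) := by
    rw [(hTN t).2, nameOf, show k = k - 1 + 1 by omega, List.range_succ_eq_map]
    simp [hl.zero hL (by omega : 0 < k), show k - 1 + 1 = k by omega]
  have hone : 1 * G.dist s t ≤ (4 * k - 5) * G.dist s t := Nat.mul_le_mul_right _ (by omega)
  rw [one_mul] at hone
  by_cases hb : t ∈ G.bunch k L s
  · refine ⟨t, hb, hL.self_mem_bunch t, ?_, by simpa using hone⟩
    rw [hname, plainHeader, if_pos (((hT s).inBunch_iff t).2 hb)]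
  · have hnb : ¬ (T s).inBunch (G.ident t) = true := fun h => hb (((hT s).inBunch_iff t).1 h)
    by_cases hc : t ∈ G.cluster L s
    · refine ⟨s, hL.self_mem_bunch s, hL.mem_bunch_of_mem_cluster (by omega) hc, ?_, ?_⟩
      · rw [hname, plainHeader, if_neg hnb,
          (hT s).2.1.find?_eq_some (key := Prod.fst) G.ident_injective (fun _ => rfl) hc]
      · simpa [dist_comm t s] using hone
    · obtain ⟨i, hi, hmem, hmin⟩ := hl.exists_least_mem_bunch hL (by omega) s t
      have hi0 : i ≠ 0 := by
        rintro rfl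
        rw [hl.zero hL (by omega)] at hmem
        exact hb hmem
      obtain ⟨m, rfl⟩ := Nat.exists_eq_succ_of_ne_zero hi0
      refine ⟨l (m + 1) t, hmem, hl.mem_bunch hL hi t, ?_, ?_⟩
      · have hnone : (T s).cluster.find? (fun e => e.1 == G.ident t) = none := by
          rw [List.find?_eq_none]
          intro e he heq
          exact hc (((hT s).2.1.exists_key_iff (key := Prod.fst) G.ident_injective
            (fun _ => rfl)).1 ⟨e, he, beq_iff_eq.1 heq⟩)
        rw [hname, plainHeader, if_neg hnb]
        simp only [hnone]
        rw [List.map_map, find?_map_range_eq_some (i := m) (by omega)]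
        · rfl
        · exact ((hT s).inBunch_iff _).2 hmem
        · exact fun j hj => (hT s).inBunch_eq_false (hmin _ (by simpa using hj))
      · have h1 := hl.dist_le_of_not_mem_cluster hL hc hi fun j hj => hmin j (by omega)
        have h2 := dist_triangle (G := G) s t (l (m + 1) t)
        have h3 : (4 * m + 3) * G.dist s t ≤ (4 * k - 5) * G.dist s t :=
          Nat.mul_le_mul_right _ (by omega)
        have h4 : (4 * m + 3) * G.dist s t = 2 * ((2 * m + 1) * G.dist s t) + G.dist s t := by
          ring
        simp only [Nat.succ_eq_add_one] at *
        omega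

theorem thorupZwickHandshake_hasStretch {k : ℕ} (hk : 2 ≤ k) (c : ℕ) :
    (thorupZwickHandshake k c).HasStretch (2 * k - 1) := by
  intro n G (T : Fin n → Table) (N : Fin n → Name) hspec s t
  obtain ⟨L, l, hH, hl, hTN⟩ := hspec
  have hL := hH.isLandmarks
  have hT : ∀ v, G.IsTable k L l v (T v) := fun v => (hTN v).1
  suffices h : ∃ w, w ∈ G.bunch k L s ∧ w ∈ G.bunch k L t ∧
      handshakeHeader (T s) (N t) (handshakeReply (T t) (N s)) =
        some ⟨G.ident w, G.treeName (G.treeNodes k L w) w t⟩ ∧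
      G.dist s w + G.dist t w ≤ (2 * k - 1) * G.dist s t by
    obtain ⟨w, hs, ht, hhead, hle⟩ := h
    obtain ⟨r, hr, hr'⟩ := exists_delivers_treeNodes (S := thorupZwickHandshake k c)
      (h := (⟨G.ident w, G.treeName (G.treeNodes k L w) w t⟩ : Header)) (T := T) hL hT hs ht
      (fun _ => rfl)
    exact ⟨_, hhead, r, hr, hr'.trans hle⟩
  obtain ⟨i, hi, hmem, hmin⟩ := hl.exists_least_mem_bunch hL (by omega) s t
  obtain ⟨j, hj, hmem', hmin'⟩ := hl.exists_least_mem_bunch hL (by omega) t s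
  have hidx : (N t).findIdx (fun e => (T s).inBunch e.1) = i := by
    rw [(hTN t).2]
    exact findIdx_map_range_eq hi (((hT s).inBunch_iff _).2 hmem)
      fun m hm => (hT s).inBunch_eq_false (hmin m hm)
  have hidx' : (N s).findIdx (fun e => (T t).inBunch e.1) = j := by
    rw [(hTN s).2]
    exact findIdx_map_range_eq hj (((hT t).inBunch_iff _).2 hmem')
      fun m hm => (hT t).inBunch_eq_false (hmin' m hm)
  -- With `m` the smaller index, the detour over the landmark costs twice `m * G.dist s t`.
  have hbound : ∀ m < k, 2 * (m * G.dist s t) + G.dist s t ≤ (2 * k - 1) * G.dist s t := by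
    intro m hm
    calc 2 * (m * G.dist s t) + G.dist s t = (2 * m + 1) * G.dist s t := by ring
      _ ≤ _ := Nat.mul_le_mul_right _ (by omega)
  by_cases hij : i ≤ j
  · refine ⟨l i t, hmem, hl.mem_bunch hL hi t, ?_, ?_⟩
    · rw [handshakeHeader, if_pos (by simpa only [handshakeReply, hidx, hidx'] using hij),
        (hTN t).2, nameOf, find?_map_range_eq_some hi]
      · rfl
      · exact ((hT s).inBunch_iff _).2 hmem
      · exact fun m hm => (hT s).inBunch_eq_false (hmin m hm)
    · have h1 := (hl.dist_le_handshake hL (by omega) hi hmin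
        fun m hm => hmin' m (by omega)).1
      have h2 := dist_triangle (G := G) s t (l i t)
      have h3 := hbound i hi
      omega
  · refine ⟨l j s, hl.mem_bunch hL hj s, hmem', ?_, ?_⟩
    · rw [handshakeHeader, if_neg (by simpa only [handshakeReply, hidx, hidx'] using hij)]
      simp only [handshakeReply]
      rw [(hTN s).2, nameOf, find?_map_range_eq_some hj]
      · simp only [Option.bind_some]
        rw [(hT t).1.find?_eq_some (key := Prod.fst) G.ident_injective (fun _ => rfl) hmem']
        rfl
      · exact ((hT t).inBunch_iff _).2 hmem'
      · exact fun m hm => (hT t).inBunch_eq_false (hmin' m hm)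
    · have h1 := (hl.dist_le_handshake hL (by omega) hj (fun m hm => hmin m (by omega)) hmin').2
      have h2 := dist_triangle (G := G) t s (l j s)
      rw [dist_comm t s] at h2
      have h3 := hbound j hj
      omega

end Headers

/-! ### Greedy choice of landmarks -/

/-- A greedy choice hits every set of a family of large subsets of `W`: each new element hits a
`q / #W` fraction of the remaining sets. -/
theorem exists_hitting_set {α ι : Type*} [DecidableEq α] {W : Finset α} {q : ℕ}
    (S : ι → Finset α) (hS : ∀ v, S v ⊆ W) (hq : ∀ v, q ≤ (S v).card) (t : ℕ) (F : Finset ι)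
    (h : F.card * (W.card - q) ^ t < W.card ^ t) :
    ∃ A ⊆ W, A.card ≤ t ∧ ∀ v ∈ F, ∃ a ∈ A, a ∈ S v := by
  classical
  induction t generalizing F with
  | zero =>
    have hF : F = ∅ := by simpa using h
    exact ⟨∅, by simp, by simp, by simp [hF]⟩
  | succ t ih =>
    rcases F.eq_empty_or_nonempty with rfl | ⟨v₀, hv₀⟩
    · exact ⟨∅, by simp, by simp, by simp⟩
    have hqW : q ≤ W.card := (hq v₀).trans (Finset.card_le_card (hS v₀))
    have hWpos : 0 < W.card := by
      by_contra h0
      rw [Nat.eq_zero_of_not_pos h0] at h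
      simp at h
    have hcount : ∑ w ∈ W, (F.filter fun v => w ∈ S v).card = ∑ v ∈ F, (S v).card := by
      refine (Finset.sum_card_bipartiteAbove_eq_sum_card_bipartiteBelow
        (s := F) (t := W) (fun v w => w ∈ S v)).symm.trans ?_
      refine Finset.sum_congr rfl fun v _ => congrArg _ ?_
      ext w
      simp only [Finset.mem_bipartiteAbove, and_iff_right_iff_imp]
      exact fun hw => hS v hw
    obtain ⟨w, hw, hmax⟩ := Finset.exists_max_image W
      (fun w => (F.filter fun v => w ∈ S v).card) (Finset.card_pos.1 hWpos)
    have h1 : F.card * q ≤ W.card * (F.filter fun v => w ∈ S v).card := by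
      calc F.card * q ≤ ∑ v ∈ F, (S v).card := by
            simpa using Finset.card_nsmul_le_sum F (fun v => (S v).card) q fun v _ => hq v
        _ = ∑ w ∈ W, (F.filter fun v => w ∈ S v).card := hcount.symm
        _ ≤ _ := by simpa using Finset.sum_le_card_nsmul W _ _ hmax
    have h2 := Finset.card_filter_add_card_filter_not (s := F) (fun v => w ∈ S v)
    have h3 : (F.filter fun v => w ∉ S v).card * W.card ≤ F.card * (W.card - q) := by
      rw [Nat.mul_sub, ← h2, Nat.add_mul, h2]
      have : W.card * (F.filter fun v => w ∈ S v).card =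
        (F.filter fun v => w ∈ S v).card * W.card := Nat.mul_comm _ _
      omega
    obtain ⟨A, hAW, hAt, hA⟩ := ih (F.filter fun v => w ∉ S v) <| by
      refine lt_of_mul_lt_mul_right (a := W.card) ?_ (Nat.zero_le _)
      calc (F.filter fun v => w ∉ S v).card * (W.card - q) ^ t * W.card
          = (F.filter fun v => w ∉ S v).card * W.card * (W.card - q) ^ t := by ring
        _ ≤ F.card * (W.card - q) * (W.card - q) ^ t := Nat.mul_le_mul_right _ h3
        _ = F.card * (W.card - q) ^ (t + 1) := by ring
        _ < W.card ^ (t + 1) := h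
        _ = W.card ^ t * W.card := pow_succ _ _
    refine ⟨insert w A, Finset.insert_subset hw hAW,
      (Finset.card_insert_le _ _).trans (by omega), fun v hv => ?_⟩
    by_cases hwv : w ∈ S v
    · exact ⟨w, by simp, hwv⟩
    · obtain ⟨a, ha, hav⟩ := hA v (by simp [hv, hwv])
      exact ⟨a, by simp [ha], hav⟩

namespace Network

variable {n : ℕ} {G : Network n}

theorem exists_nearest_subset (G : Network n) (v : Fin n) (W : Finset (Fin n)) {q : ℕ}
    (hq : q ≤ W.card) :
    ∃ S ⊆ W, S.card = q ∧ ∀ x ∈ S, ∀ y ∈ W, y ∉ S → G.dist v x ≤ G.dist v y := by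
  classical
  induction q with
  | zero => exact ⟨∅, by simp, by simp, by simp⟩
  | succ q ih =>
    obtain ⟨S, hSW, hSq, hS⟩ := ih (by omega)
    have hne : (W \ S).Nonempty := by
      rw [← Finset.card_pos, Finset.card_sdiff_of_subset hSW]
      omega
    obtain ⟨z, hz, hmin⟩ := Finset.exists_min_image (W \ S) (G.dist v) hne
    rw [Finset.mem_sdiff] at hz
    refine ⟨insert z S, Finset.insert_subset hz.1 hSW, by simp [hz.2, hSq], ?_⟩
    intro x hx y hy hyS
    rw [Finset.mem_insert, not_or] at hyS
    rcases Finset.mem_insert.1 hx with rfl | hx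
    · exact hmin y (Finset.mem_sdiff.2 ⟨hy, hyS.2⟩)
    · exact hS x hx y hy hyS.2

/-- There are about `#W / q` nodes of `W` such that each node has at most `q` nodes of `W` that are
closer than all of these. -/
theorem exists_sparse_subset (G : Network n) {W : Finset (Fin n)} (hW : W.Nonempty) {q : ℕ}
    (hq : 0 < q) :
    ∃ A ⊆ W, A.Nonempty ∧ (A.card : ℝ) ≤ W.card / q * Real.log n + 1 ∧
      ∀ v, (W.filter fun w => (G.dist v w : ℕ∞) < G.distSet v A).card ≤ q := by
  classical
  obtain ⟨w₀, hw₀⟩ := hW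
  have hn : (1 : ℝ) ≤ n := by
    have : 0 < n := w₀.pos
    exact_mod_cast this
  have hlog : 0 ≤ Real.log n := Real.log_nonneg hn
  by_cases hqW : q ≤ W.card
  · choose S hSW hSq hS using fun v => exists_nearest_subset G v W hqW
    have hWpos : (0 : ℝ) < W.card := by exact_mod_cast hq.trans_le hqW
    have hq' : (0 : ℝ) < q := by exact_mod_cast hq
    set t := ⌊(W.card : ℝ) / q * Real.log n⌋₊ + 1 with ht
    have hlt : (W.card : ℝ) / q * Real.log n < t := by
      rw [ht]
      exact_mod_cast Nat.lt_floor_add_one _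
    have hkey : Finset.univ.card (α := Fin n) * (W.card - q) ^ t < W.card ^ t := by
      rw [← @Nat.cast_lt ℝ]
      push_cast [hqW]
      have h1 : ((W.card : ℝ) - q) = W.card * (1 - q / W.card) := by field_simp
      have h2 : (1 - (q : ℝ) / W.card) ^ t ≤ Real.exp (-(q / W.card * t)) := by
        rw [show -((q : ℝ) / W.card * t) = t * (-(q / W.card)) by ring, Real.exp_nat_mul]
        refine pow_le_pow_left₀ ?_ ?_ t
        · rw [sub_nonneg, div_le_one hWpos]
          exact_mod_cast hqW
        · have := Real.add_one_le_exp (-((q : ℝ) / W.card))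
          linarith
      have h3 : Real.log n < q / W.card * t := by
        rw [div_mul_eq_mul_div, lt_div_iff₀ hWpos]
        rw [div_mul_eq_mul_div, div_lt_iff₀ hq'] at hlt
        linarith
      have h4 : (n : ℝ) * Real.exp (-(q / W.card * t)) < 1 := by
        calc (n : ℝ) * Real.exp (-(q / W.card * t))
            = Real.exp (Real.log n) * Real.exp (-(q / W.card * t)) := by
              rw [Real.exp_log (by linarith)]
          _ = Real.exp (Real.log n - q / W.card * t) := by rw [← Real.exp_add, sub_eq_add_neg]
          _ < 1 := Real.exp_lt_one_iff.2 (by linarith)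
      rw [h1, mul_pow, Finset.card_univ, Fintype.card_fin]
      calc (n : ℝ) * ((W.card : ℝ) ^ t * (1 - q / W.card) ^ t)
          = W.card ^ t * (n * (1 - q / W.card) ^ t) := by ring
        _ ≤ W.card ^ t * (n * Real.exp (-(q / W.card * t))) := by gcongr
        _ < W.card ^ t * 1 := by gcongr
        _ = _ := mul_one _
    obtain ⟨A, hAW, hAt, hA⟩ := exists_hitting_set S hSW (fun v => (hSq v).ge) t _ hkey
    obtain ⟨a, ha, -⟩ := hA w₀ (Finset.mem_univ _)
    refine ⟨A, hAW, ⟨a, ha⟩, ?_, fun v => ?_⟩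
    · calc (A.card : ℝ) ≤ t := by exact_mod_cast hAt
        _ ≤ _ := by
          rw [ht]
          push_cast
          gcongr
          exact Nat.floor_le (by positivity)
    · rw [← hSq v]
      refine Finset.card_le_card fun w hw => ?_
      obtain ⟨hwW, hlt⟩ := Finset.mem_filter.1 hw
      by_contra hwS
      obtain ⟨b, hbA, hbS⟩ := hA v (Finset.mem_univ _)
      refine absurd hlt (not_lt.2 ((distSet_le hbA).trans ?_))
      exact_mod_cast hS v b hbS w hwW hwS
  · refine ⟨{w₀}, by simpa using hw₀, by simp, ?_, fun v => ?_⟩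
    · simp only [Finset.card_singleton, Nat.cast_one]
      have : 0 ≤ (W.card : ℝ) / q * Real.log n := by positivity
      linarith
    · exact (Finset.card_filter_le _ _).trans (by omega)

/-- Landmarks for which the nodes of `W` have clusters of size at most `4 * q`. Landmarks sampled
from `W` reduce the total size of the clusters of `W` to `2 * q * #W`, so that at most half of `W`
keeps too large clusters; this is repeated with that half. -/
theorem exists_small_clusters (G : Network n) {q : ℕ} (hq : 0 < q) (t : ℕ)
    (W : Finset (Fin n)) (hW : W.card < 2 ^ t) :
    ∃ A : Finset (Fin n), (A.card : ℝ) ≤ t * ((n : ℝ) / q * (1 + Real.log n) + 1) ∧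
      ∀ w ∈ W, (Finset.univ.filter fun u => (G.dist w u : ℕ∞) < G.distSet u A).card ≤ 4 * q := by
  classical
  have hmono : ∀ (A B : Finset (Fin n)) (w : Fin n),
      (Finset.univ.filter fun u => (G.dist w u : ℕ∞) < G.distSet u (A ∪ B)).card ≤
        (Finset.univ.filter fun u => (G.dist w u : ℕ∞) < G.distSet u A).card := fun A B w =>
    Finset.card_le_card fun u hu => by
      simp only [Finset.mem_filter, Finset.mem_univ, true_and] at hu ⊢
      exact hu.trans_le (distSet_anti Finset.subset_union_left)
  have hlog : 0 ≤ Real.log n := Real.log_natCast_nonneg n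
  have hq' : (0 : ℝ) < q := by exact_mod_cast hq
  induction t generalizing W with
  | zero =>
    have : W = ∅ := by simpa using hW
    exact ⟨∅, by simp, by simp [this]⟩
  | succ t ih =>
    set X : ℝ := (n : ℝ) / q * (1 + Real.log n) + 1 with hX
    have hX0 : 0 ≤ X := by positivity
    by_cases hsmall : W.card * q < n
    · refine ⟨W, ?_, fun w hw => ?_⟩
      · have h1 : (W.card : ℝ) ≤ n / q := by
          rw [le_div_iff₀ hq']
          exact_mod_cast hsmall.le
        have h2 : (n : ℝ) / q * 1 ≤ n / q * (1 + Real.log n) := by gcongr; linarith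
        have h3 : 0 ≤ (t : ℝ) * X := by positivity
        push_cast
        linarith
      · rw [Finset.filter_false_of_mem]
        · simp
        · intro u _
          rw [not_lt, dist_comm]
          exact distSet_le hw
    · rcases W.eq_empty_or_nonempty with rfl | hne
      · refine ⟨∅, ?_, by simp⟩
        rw [Finset.card_empty, Nat.cast_zero]
        positivity
      have hn : 0 < n := hne.choose.pos
      have hn' : (0 : ℝ) < n := by exact_mod_cast hn
      have hWpos : (0 : ℝ) < W.card := by exact_mod_cast hne.card_pos
      set r := ⌈(W.card : ℝ) * q / n⌉₊ with hr
      have hr0 : 0 < r := Nat.ceil_pos.2 (by positivity)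
      obtain ⟨A, -, -, hAcard, hA⟩ := exists_sparse_subset G hne hr0
      set W' := W.filter fun w =>
        4 * q < (Finset.univ.filter fun u => (G.dist w u : ℕ∞) < G.distSet u A).card with hW'
      have hsum : ∑ w ∈ W, (Finset.univ.filter fun u =>
          (G.dist w u : ℕ∞) < G.distSet u A).card ≤ n * r := by
        have h1 := Finset.sum_card_bipartiteAbove_eq_sum_card_bipartiteBelow
          (s := W) (t := Finset.univ) (fun w u => (G.dist w u : ℕ∞) < G.distSet u A)
        simp only [Finset.bipartiteAbove, Finset.bipartiteBelow] at h1
        rw [h1]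
        refine (Finset.sum_le_card_nsmul _ _ r fun u _ => ?_).trans (by simp)
        simpa only [dist_comm] using hA u
      have hsub : W' ⊆ W := Finset.filter_subset _ _
      have hhalf : W'.card * (4 * q) ≤ n * r := by
        refine le_trans ?_ ((Finset.sum_le_sum_of_subset hsub).trans hsum)
        simpa using Finset.card_nsmul_le_sum W' _ (4 * q) fun w hw =>
          (Finset.mem_filter.1 hw).2.le
      have hnr : n * r ≤ 2 * (W.card * q) := by
        have h1 : (r : ℝ) < W.card * q / n + 1 := Nat.ceil_lt_add_one (by positivity)
        have h2 : (n : ℝ) * r < W.card * q + n := by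
          calc (n : ℝ) * r < n * (W.card * q / n + 1) := by gcongr
            _ = _ := by field_simp
        have h3 : n * r < W.card * q + n := by exact_mod_cast h2
        omega
      have hW'2 : 2 * W'.card ≤ W.card := by
        refine le_of_mul_le_mul_right (a := 2 * q) ?_ (by omega)
        linarith
      obtain ⟨B, hBcard, hB⟩ := ih W' (by rw [pow_succ] at hW; omega)
      refine ⟨A ∪ B, ?_, fun w hw => ?_⟩
      · have h1 : (A.card : ℝ) ≤ X := by
          refine hAcard.trans ?_
          have h2 : (W.card : ℝ) / r ≤ n / q := by
            rw [div_le_div_iff₀ (by exact_mod_cast hr0) hq']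
            have : (W.card : ℝ) * q / n ≤ r := Nat.le_ceil _
            rw [div_le_iff₀ hn'] at this
            linarith
          rw [hX]
          gcongr
          linarith
        have h2 : ((A ∪ B).card : ℝ) ≤ A.card + B.card := by
          exact_mod_cast Finset.card_union_le A B
        push_cast
        linarith
      · by_cases hlarge : w ∈ W'
        · rw [Finset.union_comm]
          exact (hmono B A w).trans (hB w hlarge)
        · refine (hmono A B w).trans ?_
          by_contra hlt
          exact hlarge (Finset.mem_filter.2 ⟨hw, not_le.1 hlt⟩)

end Network

/-! ### Existence of hierarchies and tables -/

theorem one_le_one_add_log (n : ℕ) : 1 ≤ 1 + Real.log n := by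
  have := Real.log_natCast_nonneg n
  linarith

theorem natLog_two_le (n : ℕ) : (Nat.log 2 n : ℝ) ≤ 2 * Real.log n := by
  refine (Real.natLog_le_logb n 2).trans ?_
  rw [Real.logb, div_le_iff₀ (Real.log_pos (by norm_num))]
  have h1 := Real.log_two_gt_d9
  have h2 := Real.log_natCast_nonneg n
  push_cast
  nlinarith

/-- The levels of a hierarchy: the first set `L₁` below all nodes is prescribed, and each further
one is obtained from `exists_sparse_subset`. -/
theorem Network.exists_levels {n : ℕ} (G : Network n) {q : ℕ} (hq : 0 < q)
    {L₁ : Finset (Fin n)} (hL₁ : L₁.Nonempty) :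
    ∃ M : ℕ → Finset (Fin n), M 0 = Finset.univ ∧ M 1 = L₁ ∧ (∀ i, M (i + 1) ⊆ M i) ∧
      (∀ i, (M (i + 1)).Nonempty) ∧
      (∀ i, ((M (i + 2)).card : ℝ) ≤ (M (i + 1)).card / q * Real.log n + 1) ∧
      ∀ i v, ((M (i + 1)).filter fun w =>
        (G.dist v w : ℕ∞) < G.distSet v (M (i + 2))).card ≤ q := by
  have hex : ∀ W : Finset (Fin n), ∃ A : Finset (Fin n), W.Nonempty → A ⊆ W ∧ A.Nonempty ∧
      (A.card : ℝ) ≤ W.card / q * Real.log n + 1 ∧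
      ∀ v, (W.filter fun w => (G.dist v w : ℕ∞) < G.distSet v A).card ≤ q := fun W => by
    by_cases hW : W.Nonempty
    · obtain ⟨A, h1, h2, h3, h4⟩ := exists_sparse_subset G hW hq
      exact ⟨A, fun _ => ⟨h1, h2, h3, h4⟩⟩
    · exact ⟨∅, fun h => absurd h hW⟩
  choose f hf using hex
  have hne : ∀ i, (f^[i] L₁).Nonempty := by
    intro i
    induction i with
    | zero => exact hL₁
    | succ i ih =>
      rw [Function.iterate_succ_apply']
      exact (hf _ ih).2.1
  refine ⟨fun i => Nat.casesOn i Finset.univ fun i => f^[i] L₁, rfl, rfl, fun i => ?_, hne,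
    fun i => ?_, fun i v => ?_⟩
  · cases i with
    | zero => exact Finset.subset_univ _
    | succ i =>
      simp only [Function.iterate_succ_apply']
      exact (hf _ (hne i)).1
  · simp only [Function.iterate_succ_apply']
    exact (hf _ (hne i)).2.2.1
  · simp only [Function.iterate_succ_apply']
    exact (hf _ (hne i)).2.2.2 v

/-- With `q` about `n ^ (1 / k)`, the first level consists of landmarks that make the clusters small
and of landmarks that leave at most `q` nodes of level `0` in each bunch; each further level is
smaller by a factor `q`, up to a logarithm. -/
theorem Network.exists_isHierarchy {n : ℕ} (G : Network n) {k c : ℕ} (hk : 2 ≤ k)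
    (hc : 3 * k + 8 ≤ c) : ∃ L, G.IsHierarchy k c L := by
  classical
  have hn : 0 < n := by
    have := G.connected.nonempty
    exact this.some.pos
  have hn1 : (1 : ℝ) ≤ n := by exact_mod_cast hn
  have hn0 : (0 : ℝ) < n := by linarith
  set Λ : ℝ := 1 + Real.log n with hΛ
  have hΛ1 : 1 ≤ Λ := one_le_one_add_log n
  have hlog : Real.log n ≤ Λ := by linarith
  have hlog0 : 0 ≤ Real.log n := Real.log_natCast_nonneg n
  have hk0 : (0 : ℝ) < k := by
    have : 0 < k := by omega
    exact_mod_cast this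
  set z : ℝ := (n : ℝ) ^ (1 / (k : ℝ)) with hz
  have hz1 : 1 ≤ z := Real.one_le_rpow hn1 (by positivity)
  set q := ⌈z⌉₊ with hq
  have hq0 : 0 < q := Nat.ceil_pos.2 (by linarith)
  have hqz : z ≤ q := Nat.le_ceil z
  have hqz2 : (q : ℝ) ≤ 2 * z := by
    have := Nat.ceil_lt_add_one (a := z) (by linarith)
    linarith
  -- The exponents of the level sizes, and division by `z`.
  have hpow1 : ∀ i : ℕ, i ≤ k → 1 ≤ (n : ℝ) ^ (1 - (i : ℝ) / k) := fun i hi =>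
    Real.one_le_rpow hn1 <| by
      rw [sub_nonneg, div_le_one hk0]
      exact_mod_cast hi
  have hpow : ∀ i : ℕ, (n : ℝ) ^ (1 - (i : ℝ) / k) / q ≤ (n : ℝ) ^ (1 - ((i + 1 : ℕ) : ℝ) / k) := by
    intro i
    have h1 : (n : ℝ) ^ (1 - ((i + 1 : ℕ) : ℝ) / k) = (n : ℝ) ^ (1 - (i : ℝ) / k) / z := by
      rw [hz, ← Real.rpow_sub hn0]
      congr 1
      push_cast
      ring
    rw [h1]
    gcongr
  set X : ℝ := (n : ℝ) / q * Λ + 1 with hX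
  have hXle : X ≤ 2 * ((n : ℝ) ^ (1 - ((1 : ℕ) : ℝ) / k) * Λ) := by
    have h1 : (n : ℝ) / q ≤ (n : ℝ) ^ (1 - ((1 : ℕ) : ℝ) / k) := by
      simpa using hpow 0
    have h2 : 1 * 1 ≤ (n : ℝ) ^ (1 - ((1 : ℕ) : ℝ) / k) * Λ :=
      mul_le_mul (hpow1 1 (by omega)) hΛ1 zero_le_one (zero_le_one.trans (hpow1 1 (by omega)))
    have h3 : (n : ℝ) / q * Λ ≤ (n : ℝ) ^ (1 - ((1 : ℕ) : ℝ) / k) * Λ := by gcongr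
    rw [hX]
    linarith
  have hX0 : 0 ≤ X := by positivity
  obtain ⟨A, -, hAne, hAcard, hA⟩ := exists_sparse_subset G (W := Finset.univ)
    ⟨⟨0, hn⟩, Finset.mem_univ _⟩ hq0
  obtain ⟨B, hBcard, hB⟩ := exists_small_clusters G hq0 (Nat.log 2 n + 1) Finset.univ
    (by simpa using Nat.lt_pow_succ_log_self one_lt_two n)
  have ht : ((Nat.log 2 n + 1 : ℕ) : ℝ) ≤ 2 * Λ := by
    have h1 := natLog_two_le n
    push_cast
    rw [hΛ]
    linarith
  have hL₁card : ((A ∪ B).card : ℝ) ≤ 6 * (n : ℝ) ^ (1 - ((1 : ℕ) : ℝ) / k) * Λ ^ 2 := by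
    have h1 : ((A ∪ B).card : ℝ) ≤ A.card + B.card := by
      exact_mod_cast Finset.card_union_le A B
    have h2 : (A.card : ℝ) ≤ Λ * X := by
      have h3 : (A.card : ℝ) ≤ X := by
        refine hAcard.trans ?_
        rw [Finset.card_univ, Fintype.card_fin, hX]
        gcongr
      nlinarith
    have h3 : (B.card : ℝ) ≤ 2 * Λ * X :=
      hBcard.trans (mul_le_mul_of_nonneg_right ht hX0)
    have h4 : 3 * Λ * X ≤ 3 * Λ * (2 * ((n : ℝ) ^ (1 - ((1 : ℕ) : ℝ) / k) * Λ)) := by gcongr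
    calc ((A ∪ B).card : ℝ) ≤ 3 * Λ * X := by linarith
      _ ≤ _ := h4
      _ = _ := by ring
  obtain ⟨M, hM0, hM1, hManti, hMne, hMcard, hMsparse⟩ :=
    G.exists_levels hq0 (L₁ := A ∪ B) (hAne.mono Finset.subset_union_left)
  have hMsize : ∀ i, i + 1 < k → ((M (i + 1)).card : ℝ) ≤
      (6 + i : ℕ) * (n : ℝ) ^ (1 - ((i + 1 : ℕ) : ℝ) / k) * Λ ^ (i + 2) := by
    intro i
    induction i with
    | zero =>
      intro _
      rw [hM1]
      simpa using hL₁card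
    | succ i ih =>
      intro hi
      have h1 := ih (by omega)
      set a : ℝ := (n : ℝ) ^ (1 - ((i + 1 : ℕ) : ℝ) / k) with ha
      set b : ℝ := (n : ℝ) ^ (1 - ((i + 1 + 1 : ℕ) : ℝ) / k) with hb
      have hab : a / q ≤ b := hpow (i + 1)
      have hb1 : 1 ≤ b := hpow1 _ (by omega)
      have hq0' : (0 : ℝ) < q := by exact_mod_cast hq0
      have h2 : 1 ≤ b * Λ ^ (i + 1 + 2) := one_le_mul_of_one_le_of_one_le hb1 (one_le_pow₀ hΛ1)
      calc ((M (i + 1 + 1)).card : ℝ) ≤ (M (i + 1)).card / q * Real.log n + 1 := hMcard i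
        _ ≤ (6 + i : ℕ) * a * Λ ^ (i + 2) / q * Λ + 1 := by gcongr
        _ = (6 + i : ℕ) * (a / q) * Λ ^ (i + 1 + 2) + 1 := by ring
        _ ≤ (6 + i : ℕ) * b * Λ ^ (i + 1 + 2) + b * Λ ^ (i + 1 + 2) := by gcongr
        _ = _ := by push_cast; ring
  have hMlast : ((M (k - 1)).card : ℝ) ≤ (4 + k : ℕ) * z * Λ ^ k := by
    have h1 := hMsize (k - 2) (by omega)
    rw [show k - 2 + 1 = k - 1 by omega, show k - 2 + 2 = k by omega,
      show 6 + (k - 2) = 4 + k by omega] at h1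
    have h2 : 1 - ((k - 1 : ℕ) : ℝ) / k = 1 / (k : ℝ) := by
      rw [Nat.cast_sub (by omega)]
      field_simp
      push_cast
      ring
    rwa [h2] at h1
  refine ⟨fun i => if i < k then M i else ∅, ?_, fun i => ?_, ?_, ?_, fun i hi => ?_,
    fun v => ?_, fun v => ?_⟩
  · simp only [if_pos (show 0 < k by omega), hM0]
  · by_cases hi : i + 1 < k
    · simp only [if_pos hi, if_pos (show i < k by omega)]
      exact hManti i
    · simp only [if_neg hi]
      exact Finset.empty_subset _
  · simp only [if_pos (show k - 1 < k by omega)]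
    have := hMne (k - 2)
    rwa [show k - 2 + 1 = k - 1 by omega] at this
  · simp
  · simp only [if_pos hi]
    rw [softO, polylog]
    cases i with
    | zero =>
      rw [hM0, Finset.card_univ, Fintype.card_fin]
      have h1 : (1 : ℝ) ≤ c := by exact_mod_cast (by omega : 1 ≤ c)
      have h2 : 1 ≤ (c : ℝ) * Λ ^ c := one_le_mul_of_one_le_of_one_le h1 (one_le_pow₀ hΛ1)
      have h3 : (n : ℝ) ^ (1 - ((0 : ℕ) : ℝ) / k) = n := by simp
      rw [h3]
      exact le_mul_of_one_le_right hn0.le h2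
    | succ i =>
      refine (hMsize i hi).trans ?_
      have h1 : ((6 + i : ℕ) : ℝ) ≤ c := by exact_mod_cast (by omega : 6 + i ≤ c)
      have h2 : Λ ^ (i + 2) ≤ Λ ^ c := pow_le_pow_right₀ hΛ1 (by omega)
      have h3 := zero_le_one.trans (hpow1 (i + 1) hi.le)
      calc ((6 + i : ℕ) : ℝ) * (n : ℝ) ^ (1 - ((i + 1 : ℕ) : ℝ) / k) * Λ ^ (i + 2)
          ≤ c * (n : ℝ) ^ (1 - ((i + 1 : ℕ) : ℝ) / k) * Λ ^ c := by gcongr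
        _ = _ := by ring
  · -- Each level but the last one contributes at most `q` nodes to the bunch.
    have hsub : G.bunch k (fun i => if i < k then M i else ∅) v ⊆
        ((Finset.range (k - 1)).biUnion fun i =>
          (M i).filter fun w => (G.dist v w : ℕ∞) < G.distSet v (M (i + 1))) ∪ M (k - 1) := by
      intro u hu
      obtain ⟨i, hi, h1, -, h3⟩ := mem_bunch.1 hu
      simp only [if_pos hi] at h1
      rw [Finset.mem_union]
      by_cases hi' : i + 1 < k
      · simp only [if_pos hi'] at h3
        exact Or.inl (Finset.mem_biUnion.2
          ⟨i, Finset.mem_range.2 (by omega), Finset.mem_filter.2 ⟨h1, h3⟩⟩)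
      · rw [show i = k - 1 by omega] at h1
        exact Or.inr h1
    have hlevel : ∀ i, ((M i).filter fun w =>
        (G.dist v w : ℕ∞) < G.distSet v (M (i + 1))).card ≤ q := by
      intro i
      cases i with
      | zero =>
        rw [hM0, zero_add, hM1]
        refine le_trans (Finset.card_le_card fun w hw => ?_) (hA v)
        simp only [Finset.mem_filter, Finset.mem_univ, true_and] at hw ⊢
        exact hw.trans_le (distSet_anti Finset.subset_union_left)
      | succ i => exact hMsparse i v
    have h1 : (G.bunch k (fun i => if i < k then M i else ∅) v).card ≤
        (k - 1) * q + (M (k - 1)).card := by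
      refine (Finset.card_le_card hsub).trans ((Finset.card_union_le _ _).trans ?_)
      refine Nat.add_le_add_right ?_ _
      refine Finset.card_biUnion_le.trans ((Finset.sum_le_card_nsmul _ _ q
        fun i _ => hlevel i).trans ?_)
      simp
    have h2 : ((G.bunch k (fun i => if i < k then M i else ∅) v).card : ℝ) ≤
        k * (2 * z) + (4 + k : ℕ) * z * Λ ^ k := by
      calc ((G.bunch k (fun i => if i < k then M i else ∅) v).card : ℝ)
          ≤ ((k - 1 : ℕ) : ℝ) * q + (M (k - 1)).card := by exact_mod_cast h1
        _ ≤ k * (2 * z) + (4 + k : ℕ) * z * Λ ^ k := by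
          gcongr
          exact Nat.sub_le k 1
    have h3 : Λ ^ k ≤ Λ ^ c := pow_le_pow_right₀ hΛ1 (by omega)
    have h4 : 1 ≤ Λ ^ c := one_le_pow₀ hΛ1
    have h5 : ((3 * k + 4 : ℕ) : ℝ) ≤ c := by exact_mod_cast (by omega : 3 * k + 4 ≤ c)
    rw [softO, polylog]
    calc _ ≤ (k : ℝ) * (2 * z) + (4 + k : ℕ) * z * Λ ^ k := h2
      _ ≤ k * (2 * z) * Λ ^ c + (4 + k : ℕ) * z * Λ ^ c :=
        add_le_add (le_mul_of_one_le_right (by positivity) h4) (by gcongr)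
      _ = z * (((3 * k + 4 : ℕ) : ℝ) * Λ ^ c) := by push_cast; ring
      _ ≤ z * (c * Λ ^ c) := by gcongr
  · have h1 : (G.cluster (fun i => if i < k then M i else ∅) v).card ≤ 4 * q := by
      refine le_trans (Finset.card_le_card fun u hu => ?_) (hB v (Finset.mem_univ v))
      rw [mem_cluster] at hu
      simp only [if_pos (show 1 < k by omega), hM1] at hu
      exact Finset.mem_filter.2
        ⟨Finset.mem_univ u, hu.trans_le (distSet_anti Finset.subset_union_right)⟩
    have h2 : (8 : ℝ) ≤ c := by exact_mod_cast (by omega : 8 ≤ c)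
    calc ((G.cluster (fun i => if i < k then M i else ∅) v).card : ℝ)
        ≤ 4 * q := by exact_mod_cast h1
      _ ≤ 8 * z := by linarith
      _ ≤ c * z := by gcongr

theorem exists_isTable {n : ℕ} (G : Network n) (k : ℕ) (L : ℕ → Finset (Fin n))
    (l : ℕ → Fin n → Fin n) (v : Fin n) : ∃ T, G.IsTable k L l v T := by
  have henum : ∀ {α : Type} (A : Finset (Fin n)) (f : Fin n → α), Function.Injective f →
      Enumerates (A.toList.map f) A f := fun A f hf =>
    ⟨(List.nodup_map_iff hf).2 A.nodup_toList, fun e => by simp⟩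
  refine ⟨⟨_, _, _⟩, henum _ _ fun u u' h => ?_, henum _ _ fun u u' h => ?_, rfl⟩ <;>
    exact G.ident_injective (congrArg Prod.fst h)

theorem exists_isThorupZwick {n : ℕ} (G : Network n) {k c : ℕ} (hk : 2 ≤ k)
    (hc : 3 * k + 8 ≤ c) : ∃ T N, G.IsThorupZwick k c T N := by
  obtain ⟨L, hL⟩ := G.exists_isHierarchy hk hc
  obtain ⟨l, hl⟩ := hL.isLandmarks.exists_isNearest
  choose T hT using exists_isTable G k L l
  exact ⟨T, _, L, l, hL, hl, fun v => ⟨hT v, rfl⟩⟩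

/-! ### Prefix codes -/

/-- No code word is a proper prefix of another one, and different arguments have different
codes. -/
def IsPrefixCode {α : Type} (f : α → List Bool) : Prop :=
  ∀ a b s t, f a ++ s = f b ++ t → a = b ∧ s = t

theorem IsPrefixCode.injective {α : Type} {f : α → List Bool} (hf : IsPrefixCode f) :
    Function.Injective f := fun a b h => (hf a b [] [] (by rw [h])).1

theorem isPrefixCode_natCode : IsPrefixCode natCode := by
  have key : ∀ (l l' s t : List Bool),
      (l.flatMap fun d => [true, d]) ++ [false] ++ s =
        (l'.flatMap fun d => [true, d]) ++ [false] ++ t → l = l' ∧ s = t := by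
    intro l
    induction l with
    | nil =>
      intro l' s t h
      cases l' with
      | nil => simpa using h
      | cons d l' => simp at h
    | cons d l ih =>
      intro l' s t h
      cases l' with
      | nil => simp at h
      | cons d' l' =>
        simp only [List.flatMap_cons, List.cons_append, List.nil_append, List.cons.injEq,
          true_and] at h
        obtain ⟨h1, h2⟩ := ih l' s t h.2
        exact ⟨by rw [h.1, h1], h2⟩
  intro a b s t h
  obtain ⟨h1, h2⟩ := key _ _ _ _ h
  refine ⟨?_, h2⟩
  refine Nat.eq_of_testBit_eq fun i => ?_
  rw [Nat.testBit_eq_inth, Nat.testBit_eq_inth, h1]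

theorem IsPrefixCode.listCode {α : Type} {f : α → List Bool} (hf : IsPrefixCode f) :
    IsPrefixCode (listCode f) := by
  have key : ∀ (l l' s t : List _), l.length = l'.length → l.flatMap f ++ s = l'.flatMap f ++ t →
      l = l' ∧ s = t := by
    intro l
    induction l with
    | nil =>
      intro l' s t hlen h
      obtain rfl := List.length_eq_zero_iff.1 hlen.symm
      simpa using h
    | cons d l ih =>
      intro l' s t hlen h
      cases l' with
      | nil => simp at hlen
      | cons d' l' =>
        simp only [List.flatMap_cons, List.append_assoc] at h
        obtain ⟨h1, h2⟩ := hf _ _ _ _ h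
        obtain ⟨h3, h4⟩ := ih l' s t (by simpa using hlen) h2
        exact ⟨by rw [h1, h3], h4⟩
  intro a b s t h
  simp only [CompactRouting.listCode, List.append_assoc] at h
  obtain ⟨h1, h2⟩ := isPrefixCode_natCode _ _ _ _ h
  exact key _ _ _ _ h1 h2

theorem IsPrefixCode.append {α β : Type} {f : α → List Bool} {g : β → List Bool}
    (hf : IsPrefixCode f) (hg : IsPrefixCode g) :
    IsPrefixCode fun x : α × β => f x.1 ++ g x.2 := by
  intro a b s t h
  simp only [List.append_assoc] at h
  obtain ⟨h1, h2⟩ := hf _ _ _ _ h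
  obtain ⟨h3, h4⟩ := hg _ _ _ _ h2
  exact ⟨Prod.ext h1 h3, h4⟩

theorem IsPrefixCode.comp {α β : Type} {f : α → List Bool} (hf : IsPrefixCode f) {e : β → α}
    (he : Function.Injective e) : IsPrefixCode fun x => f (e x) := by
  intro a b s t h
  obtain ⟨h1, h2⟩ := hf _ _ _ _ h
  exact ⟨he h1, h2⟩

theorem isPrefixCode_treeTable : IsPrefixCode TreeTable.code := by
  have hentry := (isPrefixCode_natCode.append isPrefixCode_natCode).append isPrefixCode_natCode
  have hentry' := hentry.comp (e := fun e : ℕ × ℕ × ℕ => ((e.1, e.2.1), e.2.2))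
    (fun a b h => by simp only [Prod.ext_iff] at h ⊢; tauto)
  exact ((((isPrefixCode_natCode.append isPrefixCode_natCode).append
    isPrefixCode_natCode).append isPrefixCode_natCode).append hentry'.listCode).comp
    (e := fun T : TreeTable => ((((T.num, T.numMax), T.lightDepth), T.parentPort), T.heavy))
    (fun a b h => by cases a; cases b; simp only [Prod.mk.injEq, TreeTable.mk.injEq] at h ⊢; tauto)

theorem isPrefixCode_treeName : IsPrefixCode TreeName.code :=
  (isPrefixCode_natCode.append isPrefixCode_natCode.listCode).comp
    (e := fun N : TreeName => (N.num, N.light))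
    (fun a b h => by cases a; cases b; simpa only [Prod.mk.injEq, TreeName.mk.injEq] using h)

/-! ### Certificates -/

/-- The record of a node `v` in a tree rooted at `w`: its distance from `w`, its port to its parent,
the identity of its parent plus one, the port of its parent to it (all three are `0` at the root),
the size of its subtree, and its name. -/
structure NodeRec where
  dist : ℕ
  up : ℕ
  par : ℕ
  down : ℕ
  size : ℕ
  name : TreeName

/-- What the certificate of `v` contains for a node `u` of its bunch: the identity and the level of
`u`, the record and the table of `v` in the tree of `u`, and, for each level, the number of nodes
of at least this level in the subtree of `v`. -/
structure BunchEntry where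
  id : ℕ
  lev : ℕ
  node : NodeRec
  tab : TreeTable
  counts : List ℕ

/-- What the certificate of `v` contains for a node `u` of its cluster: the identity of `u`, the
distance of `u` from the landmarks of level `1`, and the record of `u` in the tree of `v`. -/
structure ClusterEntry where
  id : ℕ
  thr : ℕ
  node : NodeRec

/-- A certificate of `v`: the number of nodes, the identity and the level of `v`, the distances of
`v` from the landmarks of each level, and entries for the bunch and for the cluster of `v`. -/
structure Cert where
  n : ℕ
  id : ℕ
  lev : ℕ
  dists : List ℕ
  bunch : List BunchEntry
  cluster : List ClusterEntry

/-- The codes of the fields, one after the other; likewise for the other parts of a certificate. -/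
def NodeRec.code (R : NodeRec) : List Bool :=
  natCode R.dist ++ (natCode R.up ++ (natCode R.par ++ (natCode R.down ++
    (natCode R.size ++ R.name.code))))

def BunchEntry.code (e : BunchEntry) : List Bool :=
  natCode e.id ++ (natCode e.lev ++ (e.node.code ++ (e.tab.code ++ listCode natCode e.counts)))

def ClusterEntry.code (e : ClusterEntry) : List Bool :=
  natCode e.id ++ (natCode e.thr ++ e.node.code)

def Cert.code (K : Cert) : List Bool :=
  natCode K.n ++ (natCode K.id ++ (natCode K.lev ++ (listCode natCode K.dists ++
    (listCode BunchEntry.code K.bunch ++ listCode ClusterEntry.code K.cluster))))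

theorem isPrefixCode_nodeRec : IsPrefixCode NodeRec.code :=
  (isPrefixCode_natCode.append (isPrefixCode_natCode.append (isPrefixCode_natCode.append
    (isPrefixCode_natCode.append (isPrefixCode_natCode.append isPrefixCode_treeName))))).comp
    (e := fun R : NodeRec => (R.dist, R.up, R.par, R.down, R.size, R.name))
    (fun a b h => by cases a; cases b; simpa only [Prod.mk.injEq, NodeRec.mk.injEq] using h)

theorem isPrefixCode_bunchEntry : IsPrefixCode BunchEntry.code :=
  (isPrefixCode_natCode.append (isPrefixCode_natCode.append (isPrefixCode_nodeRec.append
    (isPrefixCode_treeTable.append isPrefixCode_natCode.listCode)))).comp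
    (e := fun e : BunchEntry => (e.id, e.lev, e.node, e.tab, e.counts))
    (fun a b h => by cases a; cases b; simpa only [Prod.mk.injEq, BunchEntry.mk.injEq] using h)

theorem isPrefixCode_clusterEntry : IsPrefixCode ClusterEntry.code :=
  (isPrefixCode_natCode.append (isPrefixCode_natCode.append isPrefixCode_nodeRec)).comp
    (e := fun e : ClusterEntry => (e.id, e.thr, e.node))
    (fun a b h => by cases a; cases b; simpa only [Prod.mk.injEq, ClusterEntry.mk.injEq] using h)

theorem isPrefixCode_cert : IsPrefixCode Cert.code :=
  (isPrefixCode_natCode.append (isPrefixCode_natCode.append (isPrefixCode_natCode.append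
    (isPrefixCode_natCode.listCode.append (isPrefixCode_bunchEntry.listCode.append
      isPrefixCode_clusterEntry.listCode))))).comp
    (e := fun K : Cert => (K.n, K.id, K.lev, K.dists, K.bunch, K.cluster))
    (fun a b h => by cases a; cases b; simpa only [Prod.mk.injEq, Cert.mk.injEq] using h)

/-! ### Lengths of codes -/

theorem length_natCode (m : ℕ) : (natCode m).length = 2 * m.size + 1 := by
  have h : ∀ l : List Bool, (l.flatMap fun d => [true, d]).length = 2 * l.length := by
    intro l
    induction l with
    | nil => rfl
    | cons d l ih =>
      rw [List.flatMap_cons, List.length_append, ih, List.length_cons]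
      simp only [List.length_cons, List.length_nil]
      ring
  rw [natCode, List.length_append, h, ← Nat.size_eq_bits_len]
  rfl

theorem length_natCode_mono {m M : ℕ} (h : m ≤ M) :
    (natCode m).length ≤ (natCode M).length := by
  rw [length_natCode, length_natCode]
  have := Nat.size_le_size h
  omega

theorem length_listCode_le {α : Type} {f : α → List Bool} {l : List α} {W B : ℕ}
    (hl : (natCode l.length).length ≤ W) (hf : ∀ e ∈ l, (f e).length ≤ B) :
    (listCode f l).length ≤ W + l.length * B := by
  rw [listCode, List.length_append, List.length_flatMap]
  refine Nat.add_le_add hl ?_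
  have := List.sum_le_card_nsmul (l.map fun e => (f e).length) B (by simpa using hf)
  simpa using this

theorem length_treeName_code_le {N : TreeName} {W m : ℕ} (h0 : (natCode N.num).length ≤ W)
    (h1 : (natCode N.light.length).length ≤ W) (h2 : ∀ p ∈ N.light, (natCode p).length ≤ W)
    (h3 : N.light.length ≤ m) : N.code.length ≤ W * (m + 2) := by
  have h4 := length_listCode_le h1 h2
  have h5 := Nat.mul_le_mul_right W h3
  rw [TreeName.code, List.length_append]
  linarith

theorem length_treeTable_code_le {T : TreeTable} {W m : ℕ} (h1 : (natCode T.num).length ≤ W)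
    (h2 : (natCode T.numMax).length ≤ W) (h3 : (natCode T.lightDepth).length ≤ W)
    (h4 : (natCode T.parentPort).length ≤ W) (h5 : (natCode T.heavy.length).length ≤ W)
    (h6 : ∀ e ∈ T.heavy, (natCode e.1).length ≤ W ∧ (natCode e.2.1).length ≤ W ∧
      (natCode e.2.2).length ≤ W) (h7 : T.heavy.length ≤ m) :
    T.code.length ≤ W * (3 * m + 5) := by
  have h8 := length_listCode_le (f := fun e : ℕ × ℕ × ℕ =>
    natCode e.1 ++ natCode e.2.1 ++ natCode e.2.2) (B := 3 * W) h5 fun e he => by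
      have := h6 e he
      simp only [List.length_append]
      omega
  have h9 := Nat.mul_le_mul_right (3 * W) h7
  rw [TreeTable.code]
  simp only [List.length_append] at h8 ⊢
  linarith

/-! ### Verification of distances -/

/-- Local rules for lists `E` of triples `(i, d, a)`, where `i` is the identity of a node, `d` the
distance to it, and `a` a label of that node. A node with a triple at distance `0` is the node
itself, any other triple comes from a neighbour, and the triples of the neighbours are passed on as
long as the distance is below the threshold `thr a`. In `nb`, each neighbour is given by the length
of the edge to it and its list. -/
structure SourceRules (id label : ℕ) (thr : ℕ → ℕ∞) (E : List (ℕ × ℕ × ℕ))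
    (nb : List (ℕ × List (ℕ × ℕ × ℕ))) : Prop where
  inj : ∀ e ∈ E, ∀ e' ∈ E, e.1 = e'.1 → e = e'
  lt_thr : ∀ e ∈ E, (e.2.1 : ℕ∞) < thr e.2.2
  origin : ∀ e ∈ E, e = (id, 0, label) ∨
    ∃ x ∈ nb, ∃ d, (e.1, d, e.2.2) ∈ x.2 ∧ e.2.1 = x.1 + d
  self : 0 < thr label → (id, 0, label) ∈ E
  relax : ∀ x ∈ nb, ∀ e ∈ x.2, ((x.1 + e.2.1 : ℕ) : ℕ∞) < thr e.2.2 →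
    ∃ d ≤ x.1 + e.2.1, (e.1, d, e.2.2) ∈ E

namespace Network

variable {n : ℕ} {G : Network n}

theorem mem_map_nbrs {α : Type} {v : Fin n} {f : Fin n → α} {e : α} :
    e ∈ (G.nbrs v).map f ↔ ∃ x, G.graph.Adj v x ∧ f x = e := by
  simp [G.mem_nbrs]

theorem forall_mem_map_nbrs {α : Type} {v : Fin n} {f : Fin n → α} {P : α → Prop} :
    (∀ e ∈ (G.nbrs v).map f, P e) ↔ ∀ x, G.graph.Adj v x → P (f x) := by
  simp [G.mem_nbrs]

theorem exists_mem_map_nbrs {α : Type} {v : Fin n} {f : Fin n → α} {P : α → Prop} :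
    (∃ e ∈ (G.nbrs v).map f, P e) ↔ ∃ x, G.graph.Adj v x ∧ P (f x) := by
  simp [G.mem_nbrs]

theorem getElem?_map_nbrs {α : Type} {v : Fin n} {f : Fin n → α} {i : ℕ} {e : α} :
    ((G.nbrs v).map f)[i]? = some e ↔ ∃ x, G.graph.Adj v x ∧ G.port v x = i + 1 ∧ f x = e := by
  rw [List.getElem?_map, Option.map_eq_some_iff]
  refine exists_congr fun x => ?_
  rw [← and_assoc]
  refine and_congr_left fun _ => ?_
  unfold port
  constructor
  · intro h
    obtain ⟨hi, hx⟩ := List.getElem?_eq_some_iff.1 h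
    refine ⟨(G.mem_nbrs v x).1 (hx ▸ List.getElem_mem hi), ?_⟩
    rw [← hx, (G.nbrs_nodup v).idxOf_getElem]
  · rintro ⟨h1, h2⟩
    have h3 : (G.nbrs v).idxOf x = i := by omega
    have h4 := List.idxOf_lt_length_iff.2 ((G.mem_nbrs v x).2 h1)
    rw [List.getElem?_eq_some_iff]
    subst h3
    exact ⟨h4, List.getElem_idxOf h4⟩

/-- The local rules determine the lists: they contain the nodes within the thresholds, with the true
distances. Indeed, by `origin` a distance in a list is the length of a walk, and by `self` and
`relax` the lists contain the ends of shortest paths. -/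
theorem mem_iff_of_sourceRules {label : Fin n → ℕ} {thr : Fin n → ℕ → ℕ∞}
    {E : Fin n → List (ℕ × ℕ × ℕ)}
    (hthr : ∀ v x a, G.graph.Adj v x → thr v a ≤ G.len s(v, x) + thr x a)
    (h : ∀ v, SourceRules (G.ident v) (label v) (thr v) (E v)
      ((G.nbrs v).map fun x => (G.len s(v, x), E x))) (v : Fin n) (e : ℕ × ℕ × ℕ) :
    e ∈ E v ↔ ∃ u, (G.dist v u : ℕ∞) < thr v (label u) ∧
      e = (G.ident u, G.dist v u, label u) := by
  have hlow : ∀ (d : ℕ) (v : Fin n) (i a : ℕ), (i, d, a) ∈ E v →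
      ∃ u, i = G.ident u ∧ a = label u ∧ G.dist v u ≤ d := by
    intro d
    induction d using Nat.strong_induction_on with
    | _ d ih =>
      intro v i a he
      rcases (h v).origin _ he with heq | ⟨y, hy, d', hd', hd⟩
      · simp only [Prod.mk.injEq] at heq
        exact ⟨v, heq.1, heq.2.2, by simp⟩
      · obtain ⟨x, hx, rfl⟩ := mem_map_nbrs.1 hy
        simp only at hd' hd
        have hpos := len_pos' hx
        obtain ⟨u, h1, h2, h3⟩ := ih d' (by omega) x i a hd'
        exact ⟨u, h1, h2, (dist_le_len_add hx u).trans (by omega)⟩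
  have hup : ∀ u v : Fin n, (G.dist v u : ℕ∞) < thr v (label u) →
      ∃ d ≤ G.dist v u, (G.ident u, d, label u) ∈ E v := by
    intro u v
    induction v using shortest_induction (G := G) (w := u) with
    | hw =>
      intro hlt
      rw [dist_self] at hlt ⊢
      exact ⟨0, le_rfl, (h u).self (by exact_mod_cast hlt)⟩
    | step v x hx ih =>
      intro hlt
      have hlt' : (G.dist x u : ℕ∞) < thr x (label u) := by
        by_contra hle
        refine absurd hlt (not_lt.2 ((hthr v x _ hx.1).trans ?_))
        calc (G.len s(v, x) : ℕ∞) + thr x (label u) ≤ G.len s(v, x) + G.dist x u :=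
              add_le_add le_rfl (not_lt.1 hle)
          _ = G.dist v u := by exact_mod_cast hx.2
      obtain ⟨d, hd, hmem⟩ := ih hlt'
      have hle : G.len s(v, x) + d ≤ G.dist v u := by
        have := hx.2
        omega
      obtain ⟨d', hd', hmem'⟩ := (h v).relax _ (mem_map_nbrs.2 ⟨x, hx.1, rfl⟩) _ hmem
        (lt_of_le_of_lt (by exact_mod_cast hle) hlt)
      exact ⟨d', hd'.trans hle, hmem'⟩
  have hkey : ∀ u v : Fin n, (G.dist v u : ℕ∞) < thr v (label u) →
      (G.ident u, G.dist v u, label u) ∈ E v := by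
    intro u v hlt
    obtain ⟨d, hd, hmem⟩ := hup u v hlt
    obtain ⟨u', h1, -, h3⟩ := hlow d v _ _ hmem
    obtain rfl := G.ident_injective h1
    rwa [le_antisymm h3 hd]
  constructor
  · obtain ⟨i, d, a⟩ := e
    intro he
    obtain ⟨u, rfl, rfl, h3⟩ := hlow d v i a he
    have hlt : (G.dist v u : ℕ∞) < thr v (label u) :=
      lt_of_le_of_lt (by exact_mod_cast h3) ((h v).lt_thr _ he)
    exact ⟨u, hlt, (h v).inj _ he _ (hkey u v hlt) rfl⟩
  · rintro ⟨u, hlt, rfl⟩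
    exact hkey u v hlt

/-- The lists of all nodes within the thresholds comply with the local rules: if `v` is within the
threshold, then so is the next node on a shortest path. -/
theorem sourceRules_of_mem_iff {label : Fin n → ℕ} {thr : Fin n → ℕ → ℕ∞}
    {E : Fin n → List (ℕ × ℕ × ℕ)}
    (hthr : ∀ v x a, G.graph.Adj v x → thr v a ≤ G.len s(v, x) + thr x a)
    (h : ∀ v e, e ∈ E v ↔ ∃ u, (G.dist v u : ℕ∞) < thr v (label u) ∧
      e = (G.ident u, G.dist v u, label u)) (v : Fin n) :
    SourceRules (G.ident v) (label v) (thr v) (E v)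
      ((G.nbrs v).map fun x => (G.len s(v, x), E x)) where
  inj e he e' he' heq := by
    obtain ⟨u, -, rfl⟩ := (h v e).1 he
    obtain ⟨u', -, rfl⟩ := (h v e').1 he'
    rw [G.ident_injective heq]
  lt_thr e he := by
    obtain ⟨u, hlt, rfl⟩ := (h v e).1 he
    exact hlt
  origin e he := by
    obtain ⟨u, hlt, rfl⟩ := (h v e).1 he
    by_cases hvu : v = u
    · subst hvu
      exact Or.inl (by rw [dist_self])
    · obtain ⟨x, hx⟩ := exists_onShortest (G := G) hvu
      refine Or.inr (exists_mem_map_nbrs.2 ⟨x, hx.1, G.dist x u, (h x _).2 ⟨u, ?_, rfl⟩,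
        hx.2.symm⟩)
      by_contra hle
      refine absurd hlt (not_lt.2 ((hthr v x _ hx.1).trans ?_))
      calc (G.len s(v, x) : ℕ∞) + thr x (label u) ≤ G.len s(v, x) + G.dist x u :=
            add_le_add le_rfl (not_lt.1 hle)
        _ = G.dist v u := by exact_mod_cast hx.2
  self hlt := (h v _).2 ⟨v, by simpa using hlt, by rw [dist_self]⟩
  relax := by
    refine forall_mem_map_nbrs.2 fun x hx e he hlt => ?_
    obtain ⟨u, -, rfl⟩ := (h x e).1 he
    have hle := dist_le_len_add hx u
    exact ⟨G.dist v u, hle, (h v _).2 ⟨u, lt_of_le_of_lt (by exact_mod_cast hle) hlt, rfl⟩⟩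

/-! ### Verification of tree labels -/

/-- The identity of the parent of `v` in the tree rooted at `w` plus one, and `0` at the root. -/
def parentCode (G : Network n) (w v : Fin n) : ℕ :=
  open Classical in if h : ∃ p, G.IsParent w v p then G.ident h.choose + 1 else 0

/-- The port of the parent of `v` to `v` in the tree rooted at `w`, and `0` at the root. -/
def downPort (G : Network n) (w v : Fin n) : ℕ :=
  open Classical in if h : ∃ p, G.IsParent w v p then G.port h.choose v else 0

theorem parentCode_root (w : Fin n) : G.parentCode w w = 0 := by
  rw [parentCode, dif_neg (not_exists_isParent_self w)]

theorem downPort_root (w : Fin n) : G.downPort w w = 0 := by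
  rw [downPort, dif_neg (not_exists_isParent_self w)]

theorem parentCode_eq {w v p : Fin n} (h : G.IsParent w v p) :
    G.parentCode w v = G.ident p + 1 := by
  have hc : (⟨p, h⟩ : ∃ p, G.IsParent w v p).choose = p := h.choose_eq _
  rw [parentCode, dif_pos ⟨p, h⟩, hc]

theorem downPort_eq {w v p : Fin n} (h : G.IsParent w v p) :
    G.downPort w v = G.port p v := by
  have hc : (⟨p, h⟩ : ∃ p, G.IsParent w v p).choose = p := h.choose_eq _
  rw [downPort, dif_pos ⟨p, h⟩, hc]

theorem parentCode_eq_iff {w v p : Fin n} :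
    G.parentCode w v = G.ident p + 1 ↔ G.IsParent w v p := by
  refine ⟨fun h => ?_, parentCode_eq⟩
  by_cases hv : v = w
  · subst hv
    rw [parentCode_root] at h
    omega
  · obtain ⟨q, hq⟩ := exists_isParent (G := G) hv
    rw [parentCode_eq hq] at h
    exact G.ident_injective (Nat.succ.inj h) ▸ hq

/-- The record of `v` in the tree on `U` rooted at `w`. -/
def nodeRec (G : Network n) (U : Finset (Fin n)) (w v : Fin n) : NodeRec where
  dist := G.dist v w
  up := G.parentPort w v
  par := G.parentCode w v
  down := G.downPort w v
  size := G.subtreeSize U w v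
  name := G.treeName U w v

end Network

/-- The child with record `R` of the node with record `P` is heavy. -/
def NodeRec.HeavyChild (b : ℕ) (P R : NodeRec) : Prop := P.size ≤ b * R.size

open Classical in
/-- The relation between the record `P` of a node and the list `ch` of the records of its children:
the sizes of the subtrees add up, and the names of the children are as they should be. -/
def TreeRule (b : ℕ) (P : NodeRec) (ch : List NodeRec) : Prop :=
  P.size = 1 + (ch.map NodeRec.size).sum ∧
    ∀ R ∈ ch,
      R.name.num = P.name.num + 1 +
        ((ch.filter fun R' => decide (R'.down < R.down)).map NodeRec.size).sum ∧
      R.name.light = P.name.light ++ if P.HeavyChild b R then [] else [R.down]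

namespace Network

variable {n : ℕ} {G : Network n} {U : Finset (Fin n)} {w : Fin n}

/-- The list `s` enumerates the children of `p`. -/
def IsChildList (G : Network n) (U : Finset (Fin n)) (w p : Fin n) (s : List (Fin n)) : Prop :=
  s.Nodup ∧ ∀ x, x ∈ s ↔ x ∈ G.children U w p

theorem IsChildList.sum_map {p : Fin n} {s : List (Fin n)} (hs : G.IsChildList U w p s)
    (f : Fin n → ℕ) : (s.map f).sum = ∑ x ∈ G.children U w p, f x := by
  classical
  rw [← List.sum_toFinset f hs.1]
  exact Finset.sum_congr (by ext x; simp [hs.2 x]) fun _ _ => rfl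

theorem IsChildList.sum_map_filter {p : Fin n} {s : List (Fin n)} (hs : G.IsChildList U w p s)
    (f g : Fin n → ℕ) (a : ℕ) :
    ((s.filter fun x => decide (g x < a)).map f).sum =
      ∑ x ∈ (G.children U w p).filter fun x => g x < a, f x := by
  classical
  rw [← List.sum_toFinset f (hs.1.filter _)]
  exact Finset.sum_congr (by ext x; simp [hs.2 x]) fun _ _ => rfl

theorem IsTree.subtreeSize_child_lt {p x : Fin n} (hU : G.IsTree U w) (hp : p ∈ U)
    (hx : x ∈ G.children U w p) : G.subtreeSize U w x < G.subtreeSize U w p := by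
  rw [hU.subtreeSize_eq hp]
  have := Finset.single_le_sum (f := G.subtreeSize U w) (fun _ _ => Nat.zero_le _) hx
  omega

/-- The recursion over the children determines the sums over subtrees. -/
theorem IsTree.eq_subtreeSum (hU : G.IsTree U w) {f g : Fin n → ℕ}
    (h : ∀ p ∈ U, f p = g p + ∑ x ∈ G.children U w p, f x) {p : Fin n} (hp : p ∈ U) :
    f p = G.subtreeSum U w g p := by
  induction hs : G.subtreeSize U w p using Nat.strong_induction_on generalizing p with
  | _ m ih =>
    rw [h p hp, hU.subtreeSum_eq g hp]
    refine congrArg _ (Finset.sum_congr rfl fun x hx => ?_)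
    exact ih _ (hs ▸ hU.subtreeSize_child_lt hp hx) (mem_children.1 hx).1 rfl

theorem IsTree.size_eq_of_treeRule (hU : G.IsTree U w) {b : ℕ} {R : Fin n → NodeRec}
    (hrule : ∀ p ∈ U, ∃ s, G.IsChildList U w p s ∧ TreeRule b (R p) (s.map R)) {p : Fin n}
    (hp : p ∈ U) : (R p).size = G.subtreeSize U w p := by
  rw [subtreeSize_eq_subtreeSum]
  refine hU.eq_subtreeSum (f := fun p => (R p).size) (fun p hp => ?_) hp
  obtain ⟨s, hs, hr⟩ := hrule p hp
  rw [hr.1, List.map_map, hs.sum_map]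
  rfl

/-- The tree rules determine the records of all nodes. -/
theorem IsTree.eq_nodeRec_of_treeRule (hU : G.IsTree U w) {R : Fin n → NodeRec}
    (hrule : ∀ p ∈ U, ∃ s, G.IsChildList U w p s ∧ TreeRule (branching n) (R p) (s.map R))
    (hroot : (R w).name = ⟨0, []⟩)
    (hlink : ∀ v ∈ U, (R v).dist = G.dist v w ∧ (R v).up = G.parentPort w v ∧
      (R v).par = G.parentCode w v ∧ (R v).down = G.downPort w v) {v : Fin n} (hv : v ∈ U) :
    R v = G.nodeRec U w v := by
  classical
  have hsize := fun {p : Fin n} (hp : p ∈ U) => hU.size_eq_of_treeRule hrule hp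
  have hname : (R v).name = G.treeName U w v := by
    induction v using parent_induction (G := G) (w := w) with
    | hw => rw [hroot, treeName, preorder_root, lightPorts_root]
    | step v p hp ih =>
      have hpU := hU.parent_mem v hv p hp
      obtain ⟨s, hs, hr⟩ := hrule p hpU
      have hvc : v ∈ G.children U w p := mem_children.2 ⟨hv, hp⟩
      obtain ⟨h1, h2⟩ := hr.2 (R v) (List.mem_map.2 ⟨v, (hs.2 v).2 hvc, rfl⟩)
      have hdown : ∀ x ∈ G.children U w p, (R x).down = G.port p x := fun x hx => by
        rw [(hlink x (mem_children.1 hx).1).2.2.2, downPort_eq (mem_children.1 hx).2]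
      have h3 : (R v).name.num = G.preorder U w v := by
        rw [h1, ih hpU, preorder_eq U hp, List.filter_map, List.map_map]
        refine congrArg _ ?_
        refine (hs.sum_map_filter _ (fun x => (R x).down) _).trans ?_
        refine Finset.sum_congr (Finset.filter_congr fun x hx => ?_) fun x hx => ?_
        · rw [hdown x hx, hdown v hvc]
        · exact hsize (mem_children.1 (Finset.mem_filter.1 hx).1).1
      have h4 : (R v).name.light = G.lightPorts U w v := by
        rw [h2, ih hpU, lightPorts_eq U hp, NodeRec.HeavyChild, hsize hv, hsize hpU, hdown v hvc]
        rfl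
      rw [treeName, ← h3, ← h4]
  obtain ⟨h1, h2, h3, h4⟩ := hlink v hv
  rw [nodeRec, ← h1, ← h2, ← h3, ← h4, ← hname, ← hsize hv]

theorem IsTree.treeRule_nodeRec (hU : G.IsTree U w) {p : Fin n} (hp : p ∈ U) {s : List (Fin n)}
    (hs : G.IsChildList U w p s) :
    TreeRule (branching n) (G.nodeRec U w p) (s.map (G.nodeRec U w)) := by
  classical
  refine ⟨?_, fun R hR => ?_⟩
  · rw [List.map_map, hs.sum_map]
    exact hU.subtreeSize_eq hp
  · obtain ⟨v, hv, rfl⟩ := List.mem_map.1 hR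
    have hvp := (mem_children.1 ((hs.2 v).1 hv)).2
    constructor
    · rw [List.filter_map, List.map_map]
      refine (preorder_eq U hvp).trans (congrArg _ ?_)
      refine Eq.trans ?_ (hs.sum_map_filter _ (fun x => G.downPort w x) _).symm
      refine Finset.sum_congr (Finset.filter_congr fun x hx => ?_) fun x _ => rfl
      simp only [nodeRec]
      rw [downPort_eq (mem_children.1 hx).2, downPort_eq hvp]
    · refine (lightPorts_eq U hvp).trans ?_
      rw [show (G.nodeRec U w v).down = G.port p v from downPort_eq hvp]
      rfl

/-! ### Parents in the trees of neighbours -/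

/-- If `x` precedes `v` on a shortest path from `y` to `v`, then the first edges of shortest paths
from `y` to `x` are first edges of shortest paths from `y` to `v`. -/
theorem OnShortest.of_neighbour {v x y z : Fin n} (hx : G.OnShortest y v x)
    (hz : G.OnShortest x y z) : G.OnShortest v y z := by
  refine ⟨hz.1, ?_⟩
  have h1 := hx.2
  have h2 := hz.2
  have h3 := dist_le_len_add hz.1 v
  have h4 := dist_triangle (G := G) z x v
  have h5 := dist_le_len hx.1.symm
  rw [dist_comm x y] at h1
  rw [dist_comm v y] at h1
  rw [Sym2.eq_swap] at h5
  omega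

/-- If the parent `z` of `y` in the tree of `v` is not `v`, then it is also the parent of `y` in the
tree of the neighbour of `v` which is the last node before `v` on a shortest path through `z`. -/
theorem IsParent.exists_neighbour {v y z : Fin n} (hz : G.IsParent v y z) (hzv : z ≠ v) :
    ∃ x, G.OnShortest y v x ∧ G.IsParent x y z := by
  obtain ⟨x, hx⟩ := exists_onShortest (G := G) (v := v) (w := z) (Ne.symm hzv)
  have h1 := hx.2
  have h2 := hz.1.2
  have h3 := dist_triangle (G := G) x z y
  have h4 := dist_le_len hz.1.1.symm
  have h5 := dist_le_len_add hx.1 y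
  rw [Sym2.eq_swap] at h4
  rw [dist_comm z v, dist_comm y v] at h2
  have hxy : G.OnShortest y v x := ⟨hx.1, by omega⟩
  have h6 := hxy.2
  refine ⟨x, hxy, ⟨hz.1.1, ?_⟩, fun y' hy' => hz.2 y' (hxy.of_neighbour hy')⟩
  rw [dist_comm z x, dist_comm y x]
  omega

end Network

/-! ### The verification algorithm -/

namespace Cert

/-- The distance to the landmarks of level `i`, for `i < k`. -/
def distAt (K : Cert) (i : ℕ) : ℕ := K.dists.getD i 0

/-- The threshold for nodes of level `i` in the bunch: the distance to the landmarks of level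
`i + 1`. -/
def thr (k : ℕ) (K : Cert) (i : ℕ) : ℕ∞ := if i + 1 < k then (K.distAt (i + 1) : ℕ∞) else ⊤

/-- The distance information in the entries for the bunch. -/
def bunchKeys (K : Cert) : List (ℕ × ℕ × ℕ) := K.bunch.map fun e => (e.id, e.node.dist, e.lev)

/-- The distance information in the entries for the cluster. -/
def clusterKeys (K : Cert) : List (ℕ × ℕ × ℕ) := K.cluster.map fun e => (e.id, e.node.dist, e.thr)

end Cert

/-- The number of nodes of level at least `i` in the subtree. -/
def BunchEntry.countAt (e : BunchEntry) (i : ℕ) : ℕ := e.counts.getD i 0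

namespace NodeRec

/-- The entries of the record that describe the edge to the parent, and the name, are those of a
root. -/
def IsRoot (R : NodeRec) : Prop := R.up = 0 ∧ R.par = 0 ∧ R.down = 0 ∧ R.name = ⟨0, []⟩

/-- The records describe the same edge to the parent. -/
def SameLink (R R' : NodeRec) : Prop := R.up = R'.up ∧ R.par = R'.par ∧ R.down = R'.down

open Classical in
/-- The tree table of the node with record `P`, when `ch` lists the records of its children in the
order of their ports. -/
def table (b : ℕ) (P : NodeRec) (ch : List NodeRec) : TreeTable where
  num := P.name.num
  numMax := P.name.num + P.size - 1
  lightDepth := P.name.light.length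
  parentPort := P.up
  heavy := (ch.filter fun R => decide (P.HeavyChild b R)).map fun R =>
    (R.down, R.name.num, R.name.num + R.size - 1)

end NodeRec

/-- The entries of the children of the node `id` in the tree of the node `root`, found at the
neighbours of `id`. -/
def childEntries (id root : ℕ) (nb : List (ℕ × Cert)) : List BunchEntry :=
  nb.flatMap fun x => x.2.bunch.filter fun e => decide (e.id = root ∧ e.node.par = id + 1)

/-- According to the entry of `x` for the same node as `e`, the neighbour `x` is on a shortest path
to that node. -/
def Closer (e : BunchEntry) (x : ℕ × Cert) : Prop :=
  ∃ e' ∈ x.2.bunch, e'.id = e.id ∧ e.node.dist = x.1 + e'.node.dist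

/-- The conditions that a node with the identity `id`, the table `T` and the certificate `K` checks,
where `nb` lists the lengths of its edges and the certificates of its neighbours in the order of the
ports. The rules `dist_*`, `bunch_dist` and `cluster_dist` fix the levels, the distances and the
sets of nodes in the bunch and in the cluster. The rules `bunch_root`, `bunch_link` and `bunch_down`
fix the edge to the parent in the tree of each node of the bunch, and `bunch_tree`, `bunch_table`
and `bunch_counts` compare the node with its children in that tree; the root of a spanning tree
checks the number of nodes and the sizes of the levels by `top_level`. In the cluster, the edge
between a neighbour `y` and its parent is known to `y` itself (`cluster_near`), and for other nodes
it is the one with the smallest port that is found in the clusters of the neighbours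
(`cluster_link`, `cluster_min`). -/
structure LocalRules (k c id : ℕ) (T : Table) (K : Cert) (nb : List (ℕ × Cert)) : Prop where
  id_eq : K.id = id
  n_eq : ∀ x ∈ nb, x.2.n = K.n
  lev_lt : K.lev < k
  dist_zero : ∀ i < k, K.distAt i = 0 ↔ i ≤ K.lev
  dist_le : ∀ i < k, ∀ x ∈ nb, K.distAt i ≤ x.1 + x.2.distAt i
  dist_step : ∀ i < k, K.distAt i ≠ 0 → ∃ x ∈ nb, K.distAt i = x.1 + x.2.distAt i
  bunch_ids : (K.bunch.map BunchEntry.id).Nodup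
  bunch_dist : SourceRules id K.lev (K.thr k) K.bunchKeys (nb.map fun x => (x.1, x.2.bunchKeys))
  bunch_root : ∀ e ∈ K.bunch, e.node.dist = 0 → e.node.IsRoot
  bunch_link : ∀ e ∈ K.bunch, e.node.dist ≠ 0 → ∃ i x, nb[i]? = some x ∧ Closer e x ∧
    e.node.up = i + 1 ∧ e.node.par = x.2.id + 1 ∧ ∀ j y, nb[j]? = some y → Closer e y → i ≤ j
  bunch_down : ∀ i x, nb[i]? = some x → ∀ e ∈ x.2.bunch, e.node.par = id + 1 →
    e.node.down = i + 1
  bunch_tree : ∀ e ∈ K.bunch,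
    TreeRule (Network.branching K.n) e.node ((childEntries id e.id nb).map BunchEntry.node)
  bunch_table : ∀ e ∈ K.bunch,
    e.tab = e.node.table (Network.branching K.n) ((childEntries id e.id nb).map BunchEntry.node)
  bunch_counts : ∀ e ∈ K.bunch, ∀ i < k, e.countAt i = (if i ≤ K.lev then 1 else 0) +
    ((childEntries id e.id nb).map fun e' => e'.countAt i).sum
  bunch_card : (K.bunch.length : ℝ) ≤ softO (1 / (k : ℝ)) c K.n
  top_level : K.lev + 1 = k → ∀ e ∈ K.bunch, e.id = id → e.node.size = K.n ∧
    ∀ i < k, (e.countAt i : ℝ) ≤ softO (1 - (i : ℝ) / k) c K.n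
  cluster_ids : (K.cluster.map ClusterEntry.id).Nodup
  cluster_dist : SourceRules id (K.distAt 1) (fun a => (a : ℕ∞)) K.clusterKeys
    (nb.map fun x => (x.1, x.2.clusterKeys))
  cluster_root : ∀ e ∈ K.cluster, e.node.dist = 0 → e.node.IsRoot
  cluster_near : ∀ e ∈ K.cluster, e.node.dist ≠ 0 → ∀ x ∈ nb, x.2.id = e.id →
    ∃ e' ∈ x.2.bunch, e'.id = id ∧ e.node.SameLink e'.node
  cluster_link : ∀ e ∈ K.cluster, e.node.dist ≠ 0 → (∀ x ∈ nb, x.2.id ≠ e.id) →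
    ∃ x ∈ nb, ∃ e' ∈ x.2.cluster, e'.id = e.id ∧ e.node.dist = x.1 + e'.node.dist ∧
      e.node.SameLink e'.node
  cluster_min : ∀ e ∈ K.cluster, e.node.dist ≠ 0 → (∀ x ∈ nb, x.2.id ≠ e.id) →
    ∀ x ∈ nb, ∀ e' ∈ x.2.cluster, e'.id = e.id → e.node.dist = x.1 + e'.node.dist →
      e.node.up ≤ e'.node.up
  cluster_tree : ∀ e ∈ K.cluster, TreeRule (Network.branching K.n) e.node
    ((K.cluster.filter fun e' => decide (e'.node.par = e.id + 1)).map ClusterEntry.node)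
  cluster_card : (K.cluster.length : ℝ) ≤ c * (K.n : ℝ) ^ (1 / (k : ℝ))
  table_bunch : T.bunch = K.bunch.map fun e => (e.id, e.tab, e.node.name)
  table_cluster : T.cluster = K.cluster.map fun e => (e.id, e.node.name)
  landmarks_length : T.landmarks.length = k
  landmarks_mem : ∀ i < k, ∃ e ∈ K.bunch, T.landmarks[i]? = some (e.id, e.tab) ∧ i ≤ e.lev ∧
    e.node.dist = K.distAt i
  landmarks_eq : ∀ i, i + 1 < k → K.distAt i = K.distAt (i + 1) →
    T.landmarks[i]? = T.landmarks[i + 1]?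

open Classical in
/-- The verification algorithm: a node accepts if its table and the certificates are codes for which
the local rules hold. -/
def verifier (k c : ℕ) (view : LocalView) : Bool :=
  decide (∃ (T : Table) (K : Cert) (nb : List (ℕ × Cert)), view.table = T.code ∧
    view.cert = K.code ∧ view.nbrs.map (fun x => (x.1, x.2.2)) = nb.map (fun x => (x.1, x.2.code)) ∧
    LocalRules k c view.ident T K nb)

/-! ### Lists of entries -/

theorem Enumerates.exists_list {n : ℕ} {α : Type} {s : List α} {A : Finset (Fin n)}
    {f : Fin n → α} (h : Enumerates s A f) (hf : ∀ u ∈ A, ∀ u' ∈ A, f u = f u' → u = u') :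
    ∃ t : List (Fin n), t.Nodup ∧ (∀ u, u ∈ t ↔ u ∈ A) ∧ s = t.map f := by
  have key : ∀ s : List α, (∀ e ∈ s, ∃ u ∈ A, f u = e) →
      ∃ t : List (Fin n), (∀ u ∈ t, u ∈ A) ∧ s = t.map f := by
    intro s
    induction s with
    | nil => exact fun _ => ⟨[], by simp, rfl⟩
    | cons e s ih =>
      intro hs
      obtain ⟨u, hu, rfl⟩ := hs e (by simp)
      obtain ⟨t, ht, rfl⟩ := ih fun e' he' => hs e' (by simp [he'])
      exact ⟨u :: t, by simpa using ⟨hu, ht⟩, rfl⟩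
  obtain ⟨t, ht, rfl⟩ := key s fun e he => (h.2 e).1 he
  refine ⟨t, h.1.of_map, fun u => ⟨ht u, fun hu => ?_⟩, rfl⟩
  obtain ⟨u', hu', he⟩ := List.mem_map.1 ((h.2 (f u)).2 ⟨u, hu, rfl⟩)
  exact hf u' (ht u' hu') u hu he ▸ hu'

theorem Enumerates.length_eq {n : ℕ} {α : Type} {s : List α} {A : Finset (Fin n)}
    {f : Fin n → α} (h : Enumerates s A f) (hf : ∀ u ∈ A, ∀ u' ∈ A, f u = f u' → u = u') :
    s.length = A.card := by
  obtain ⟨t, ht, htA, rfl⟩ := h.exists_list hf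
  rw [List.length_map, ← List.toFinset_card_of_nodup ht]
  exact congrArg _ (by ext u; simp [htA u])

theorem enumerates_map {n : ℕ} {α : Type} {t : List (Fin n)} {A : Finset (Fin n)}
    {f : Fin n → α} (ht : t.Nodup) (hA : ∀ u, u ∈ t ↔ u ∈ A)
    (hf : ∀ u ∈ A, ∀ u' ∈ A, f u = f u' → u = u') : Enumerates (t.map f) A f :=
  ⟨ht.map_on fun u hu u' hu' => hf u ((hA u).1 hu) u' ((hA u').1 hu'), fun e => by
    simp only [List.mem_map, hA]⟩

theorem filter_eq_singleton {α : Type} {s : List α} (hs : s.Nodup) {a : α} (ha : a ∈ s)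
    {p : α → Bool} (h : ∀ x ∈ s, p x = true ↔ x = a) : s.filter p = [a] := by
  classical
  rw [List.filter_congr (q := fun x => decide (x = a)) fun x hx => by
    rw [Bool.eq_iff_iff, h x hx, decide_eq_true_iff]]
  rw [List.filter_eq, List.count_eq_one_of_mem hs ha]
  rfl

theorem flatMap_eq_map_filter {α β : Type} {s : List α} {f : α → List β} {g : α → β}
    {p : α → Bool} (h : ∀ x ∈ s, f x = if p x = true then [g x] else []) :
    s.flatMap f = (s.filter p).map g := by
  induction s with
  | nil => rfl
  | cons a s ih =>
    rw [List.flatMap_cons, h a (by simp), ih fun x hx => h x (by simp [hx]), List.filter_cons]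
    by_cases hp : p a = true
    · simp [hp]
    · simp [hp]

namespace Network

variable {n : ℕ} {G : Network n} {k : ℕ} {L : ℕ → Finset (Fin n)}

/-- The certificates `K` list, for each node `v`, entries `be v u` for the nodes `u` of its bunch,
with the right identities and parents. -/
structure BunchListed (G : Network n) (k : ℕ) (L : ℕ → Finset (Fin n)) (K : Fin n → Cert)
    (be : Fin n → Fin n → BunchEntry) : Prop where
  enum : ∀ v, Enumerates (K v).bunch (G.bunch k L v) (be v)
  id_eq : ∀ v, ∀ u ∈ G.bunch k L v, (be v u).id = G.ident u
  par_eq : ∀ v, ∀ u ∈ G.bunch k L v, (be v u).node.par = G.parentCode u v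

open Classical in
/-- The children of `p` in the tree of `u`, in the order of their ports. -/
def childList (G : Network n) (k : ℕ) (L : ℕ → Finset (Fin n)) (u p : Fin n) : List (Fin n) :=
  (G.nbrs p).filter fun x => decide (x ∈ G.children (G.treeNodes k L u) u p)

theorem isChildList_childList (u p : Fin n) :
    G.IsChildList (G.treeNodes k L u) u p (G.childList k L u p) := by
  refine ⟨(G.nbrs_nodup p).filter _, fun x => ?_⟩
  simp only [childList, List.mem_filter, decide_eq_true_eq, G.mem_nbrs]
  exact and_iff_right_of_imp fun h => (mem_children.1 h).2.adj.symm

/-- The entries that `p` finds at its neighbours by the identity of their parent are those of its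
children, in the order of the ports. -/
theorem BunchListed.childEntries_eq {K : Fin n → Cert} {be : Fin n → Fin n → BunchEntry}
    (h : G.BunchListed k L K be) (p u : Fin n) :
    childEntries (G.ident p) (G.ident u) ((G.nbrs p).map fun x => (G.len s(p, x), K x)) =
      (G.childList k L u p).map fun x => be x u := by
  classical
  rw [childEntries, List.flatMap_map]
  refine flatMap_eq_map_filter fun x _ => ?_
  obtain ⟨t, ht, htA, hmap⟩ := (h.enum x).exists_list fun u hu u' hu' he =>
    G.ident_injective (by rw [← h.id_eq x u hu, ← h.id_eq x u' hu', he])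
  simp only [hmap, decide_eq_true_eq]
  by_cases hx : x ∈ G.children (G.treeNodes k L u) u p
  · obtain ⟨hxU, hxp⟩ := mem_children.1 hx
    have hux := mem_treeNodes.1 hxU
    have hpe := (h.par_eq x u hux).trans (parentCode_eq hxp)
    rw [if_pos hx, List.filter_map, filter_eq_singleton ht ((htA u).2 hux)]
    · rfl
    · intro y hy
      simp only [Function.comp_apply, decide_eq_true_eq]
      refine ⟨fun hy' => ?_, ?_⟩
      · rw [h.id_eq x y ((htA y).1 hy)] at hy'
        exact G.ident_injective hy'.1
      · rintro rfl
        exact ⟨h.id_eq x _ hux, hpe⟩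
  · rw [if_neg hx, List.filter_eq_nil_iff]
    intro e he hp
    obtain ⟨y, hy, rfl⟩ := List.mem_map.1 he
    have hyx := (htA y).1 hy
    rw [decide_eq_true_eq, h.id_eq x y hyx, h.par_eq x y hyx] at hp
    obtain rfl := G.ident_injective hp.1
    exact hx (mem_children.2 ⟨mem_treeNodes.2 hyx, parentCode_eq_iff.1 hp.2⟩)

/-- The certificate `K` of `v` lists entries `ce u` for the nodes `u` of its cluster, with the right
identities and parents. -/
structure ClusterListed (G : Network n) (L : ℕ → Finset (Fin n)) (v : Fin n) (K : Cert)
    (ce : Fin n → ClusterEntry) : Prop where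
  enum : Enumerates K.cluster (G.cluster L v) ce
  id_eq : ∀ u ∈ G.cluster L v, (ce u).id = G.ident u
  par_eq : ∀ u ∈ G.cluster L v, (ce u).node.par = G.parentCode v u

/-- A nonempty cluster belongs to a node of level `0`, and it is the whole tree of this node. -/
theorem IsLandmarks.cluster_eq_treeNodes (hL : IsLandmarks k L) (hk : 0 < k) {v u : Fin n}
    (hu : u ∈ G.cluster L v) : G.cluster L v = G.treeNodes k L v := by
  have hv : v ∉ L 1 := fun hv => by
    rw [mem_cluster, dist_comm] at hu
    exact absurd hu (not_lt.2 (distSet_le hv))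
  ext x
  refine ⟨fun hx => mem_treeNodes.2 (hL.mem_bunch_of_mem_cluster hk hx), fun hx => ?_⟩
  obtain ⟨i, hi, h1, -, h3⟩ := mem_bunch.1 (mem_treeNodes.1 hx)
  have hi0 : i = 0 := by
    by_contra h0
    exact hv (hL.antitone (by omega : 1 ≤ i) h1)
  subst hi0
  rwa [mem_cluster, dist_comm]

theorem ClusterListed.exists_isChildList {K : Cert} {ce : Fin n → ClusterEntry} {v : Fin n}
    (h : G.ClusterListed L v K ce) (hL : IsLandmarks k L) (hk : 0 < k) {u : Fin n}
    (hu : u ∈ G.cluster L v) (p : Fin n) :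
    ∃ s, G.IsChildList (G.treeNodes k L v) v p s ∧
      (K.cluster.filter fun e => decide (e.node.par = G.ident p + 1)) = s.map ce := by
  classical
  obtain ⟨t, ht, htA, hmap⟩ := h.enum.exists_list fun u hu u' hu' he =>
    G.ident_injective (by rw [← h.id_eq u hu, ← h.id_eq u' hu', he])
  refine ⟨t.filter fun x => decide ((ce x).node.par = G.ident p + 1), ⟨ht.filter _, fun x => ?_⟩,
    ?_⟩
  · rw [List.mem_filter, htA, decide_eq_true_eq, mem_children, ← hL.cluster_eq_treeNodes hk hu]
    refine and_congr_right fun hx => ?_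
    rw [h.par_eq x hx, parentCode_eq_iff]
  · rw [hmap, List.filter_map]
    rfl

/-- The table of a node in a tree is determined by its record and those of its children. -/
theorem table_nodeRec (u p : Fin n) :
    (G.nodeRec (G.treeNodes k L u) u p).table (branching n)
      ((G.childList k L u p).map (G.nodeRec (G.treeNodes k L u) u)) =
      G.treeTable (G.treeNodes k L u) u p := by
  classical
  have hheavy : ((((G.childList k L u p).map (G.nodeRec (G.treeNodes k L u) u)).filter fun R =>
      decide ((G.nodeRec (G.treeNodes k L u) u p).HeavyChild (branching n) R)).map fun R =>
        (R.down, R.name.num, R.name.num + R.size - 1)) =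
      (G.treeTable (G.treeNodes k L u) u p).heavy := by
    rw [List.filter_map, List.map_map, childList, List.filter_filter, treeTable]
    have hfilter : ((G.nbrs p).filter fun x =>
        ((fun R => decide ((G.nodeRec (G.treeNodes k L u) u p).HeavyChild (branching n) R)) ∘
          G.nodeRec (G.treeNodes k L u) u) x &&
        decide (x ∈ G.children (G.treeNodes k L u) u p)) = (G.nbrs p).filter fun x =>
          decide (x ∈ G.children (G.treeNodes k L u) u p ∧
            G.IsHeavy (G.treeNodes k L u) u p x) := by
      refine List.filter_congr fun x _ => ?_
      rw [Bool.eq_iff_iff, Bool.and_eq_true, decide_eq_true_iff, decide_eq_true_iff,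
        Function.comp_apply, decide_eq_true_iff, and_comm]
      rfl
    rw [hfilter]
    refine List.map_congr_left fun x hx => ?_
    have hxp := (mem_children.1 (of_decide_eq_true (List.mem_filter.1 hx).2).1).2
    rw [← downPort_eq hxp]
    rfl
  rw [NodeRec.table]
  rw [show G.treeTable (G.treeNodes k L u) u p = ⟨_, _, _, _,
    (G.treeTable (G.treeNodes k L u) u p).heavy⟩ from rfl, ← hheavy]
  rfl

end Network

/-! ### Soundness of the verification -/

namespace Network

variable {n : ℕ} {G : Network n} {k c : ℕ}

/-- The sets of nodes of level at least `i`. -/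
def levels (lev : Fin n → ℕ) (i : ℕ) : Finset (Fin n) := Finset.univ.filter fun v => i ≤ lev v

@[simp] theorem mem_levels {lev : Fin n → ℕ} {i : ℕ} {v : Fin n} :
    v ∈ levels lev i ↔ i ≤ lev v := by
  simp [levels]

theorem levels_eq_empty {lev : Fin n → ℕ} (hlev : ∀ v, lev v < k) {i : ℕ} (hi : k ≤ i) :
    levels lev i = ∅ := by
  ext v
  have := hlev v
  simp only [mem_levels, Finset.notMem_empty, iff_false]
  omega

theorem isLandmarks_levels {lev : Fin n → ℕ} (hlev : ∀ v, lev v < k)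
    (hne : (levels lev (k - 1)).Nonempty) : IsLandmarks k (levels lev) where
  zero := by ext; simp
  anti i v hv := by
    rw [mem_levels] at hv ⊢
    omega
  nonempty := hne
  top := levels_eq_empty hlev le_rfl

theorem mem_bunch_levels {lev : Fin n → ℕ} (hlev : ∀ v, lev v < k) {u v : Fin n} :
    u ∈ G.bunch k (levels lev) v ↔
      (G.dist v u : ℕ∞) < G.distSet v (levels lev (lev u + 1)) := by
  rw [mem_bunch]
  constructor
  · rintro ⟨i, -, h1, h2, h3⟩
    rw [mem_levels] at h1 h2
    rwa [show i = lev u by omega] at h3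
  · exact fun h => ⟨lev u, hlev u, by simp, by simp, h⟩

/-- A hierarchy is given by the highest level of each node. -/
theorem IsLandmarks.exists_levels {L : ℕ → Finset (Fin n)} (hL : IsLandmarks k L) :
    ∃ lev : Fin n → ℕ, (∀ v, lev v < k) ∧ L = levels lev := by
  choose lev _ h2 h3 h4 using fun v => hL.exists_level (i := 0) (u := v) (by simp [hL.zero])
  refine ⟨lev, h2, funext fun i => Finset.ext fun v => ?_⟩
  rw [mem_levels]
  constructor
  · intro h
    by_contra hlt
    exact h4 v (hL.antitone (by omega) h)
  · exact fun h => hL.antitone h (h3 v)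

/-- All nodes of the network find the local rules satisfied. -/
def LocallyCorrect (G : Network n) (k c : ℕ) (T : Fin n → Table) (K : Fin n → Cert) : Prop :=
  ∀ v, LocalRules k c (G.ident v) (T v) (K v) ((G.nbrs v).map fun x => (G.len s(v, x), K x))

/-- The level of a node according to its certificate. -/
def certLevel (K : Fin n → Cert) (v : Fin n) : ℕ := (K v).lev

/-- For each node `v`, the certificates list entries `be v u` for the nodes `u` of the bunch of `v`,
with the right identities, distances and levels. -/
structure BunchEntries (G : Network n) (k : ℕ) (K : Fin n → Cert)
    (be : Fin n → Fin n → BunchEntry) : Prop where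
  enum : ∀ v, Enumerates (K v).bunch (G.bunch k (levels (certLevel K)) v) (be v)
  id_eq : ∀ v, ∀ u ∈ G.bunch k (levels (certLevel K)) v, (be v u).id = G.ident u
  dist_eq : ∀ v, ∀ u ∈ G.bunch k (levels (certLevel K)) v, (be v u).node.dist = G.dist v u
  lev_eq : ∀ v, ∀ u ∈ G.bunch k (levels (certLevel K)) v, (be v u).lev = certLevel K u

/-- For each node `v`, the certificates list entries `ce v u` for the nodes `u` of the cluster of
`v`, with the right identities and distances. -/
structure ClusterEntries (G : Network n) (K : Fin n → Cert)
    (ce : Fin n → Fin n → ClusterEntry) : Prop where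
  enum : ∀ v, Enumerates (K v).cluster (G.cluster (levels (certLevel K)) v) (ce v)
  id_eq : ∀ v, ∀ u ∈ G.cluster (levels (certLevel K)) v, (ce v u).id = G.ident u
  dist_eq : ∀ v, ∀ u ∈ G.cluster (levels (certLevel K)) v, (ce v u).node.dist = G.dist v u

theorem BunchEntries.mem {K : Fin n → Cert} {be : Fin n → Fin n → BunchEntry}
    (hb : G.BunchEntries k K be) {v u : Fin n} (hu : u ∈ G.bunch k (levels (certLevel K)) v) :
    be v u ∈ (K v).bunch :=
  ((hb.enum v).2 _).2 ⟨u, hu, rfl⟩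

theorem BunchEntries.eq_of_id_eq {K : Fin n → Cert} {be : Fin n → Fin n → BunchEntry}
    (hb : G.BunchEntries k K be) {v u : Fin n} {e : BunchEntry} (he : e ∈ (K v).bunch)
    (hid : e.id = G.ident u) : u ∈ G.bunch k (levels (certLevel K)) v ∧ e = be v u := by
  obtain ⟨u', hu', rfl⟩ := ((hb.enum v).2 e).1 he
  rw [hb.id_eq v u' hu'] at hid
  obtain rfl := G.ident_injective hid
  exact ⟨hu', rfl⟩

theorem BunchEntries.closer_iff {K : Fin n → Cert} {be : Fin n → Fin n → BunchEntry}
    (hb : G.BunchEntries k K be) {v x u : Fin n} (hu : u ∈ G.bunch k (levels (certLevel K)) v)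
    (hx : G.graph.Adj v x) : Closer (be v u) (G.len s(v, x), K x) ↔ G.OnShortest u v x := by
  constructor
  · rintro ⟨e, he, hid, hd⟩
    obtain ⟨hux, rfl⟩ := hb.eq_of_id_eq he (hid.trans (hb.id_eq v u hu))
    rw [hb.dist_eq v u hu, hb.dist_eq x u hux] at hd
    exact ⟨hx, hd.symm⟩
  · intro hs
    have hux := mem_bunch_of_onShortest hs hu
    refine ⟨be x u, hb.mem hux, ?_, ?_⟩
    · rw [hb.id_eq v u hu, hb.id_eq x u hux]
    · rw [hb.dist_eq v u hu, hb.dist_eq x u hux]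
      exact hs.2.symm

theorem ClusterEntries.mem {K : Fin n → Cert} {ce : Fin n → Fin n → ClusterEntry}
    (hc : G.ClusterEntries K ce) {v u : Fin n} (hu : u ∈ G.cluster (levels (certLevel K)) v) :
    ce v u ∈ (K v).cluster :=
  ((hc.enum v).2 _).2 ⟨u, hu, rfl⟩

theorem ClusterEntries.eq_of_id_eq {K : Fin n → Cert} {ce : Fin n → Fin n → ClusterEntry}
    (hc : G.ClusterEntries K ce) {v u : Fin n} {e : ClusterEntry} (he : e ∈ (K v).cluster)
    (hid : e.id = G.ident u) : u ∈ G.cluster (levels (certLevel K)) v ∧ e = ce v u := by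
  obtain ⟨u', hu', rfl⟩ := ((hc.enum v).2 e).1 he
  rw [hc.id_eq v u' hu'] at hid
  obtain rfl := G.ident_injective hid
  exact ⟨hu', rfl⟩

namespace LocallyCorrect

variable {T : Fin n → Table} {K : Fin n → Cert}

theorem distAt_le (h : G.LocallyCorrect k c T K) {i : ℕ} (hi : i < k) {v x : Fin n}
    (hx : G.graph.Adj v x) : (K v).distAt i ≤ G.len s(v, x) + (K x).distAt i :=
  forall_mem_map_nbrs.1 ((h v).dist_le i hi) x hx

/-- The claimed distance to a level is at least the true one: it drops along some edge by the length
of this edge, until it is `0` at a node of the level. -/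
theorem exists_level (h : G.LocallyCorrect k c T K) {i : ℕ} (hi : i < k) (v : Fin n) :
    ∃ u ∈ levels (certLevel K) i, G.dist v u ≤ (K v).distAt i := by
  induction hd : (K v).distAt i using Nat.strong_induction_on generalizing v with
  | _ d ih =>
    by_cases h0 : (K v).distAt i = 0
    · exact ⟨v, mem_levels.2 (((h v).dist_zero i hi).1 h0), by simp⟩
    · obtain ⟨x, hx, hx'⟩ := exists_mem_map_nbrs.1 ((h v).dist_step i hi h0)
      have hpos := len_pos' hx
      simp only at hx'
      obtain ⟨u, hu, hle⟩ := ih _ (by omega) x rfl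
      exact ⟨u, hu, (dist_le_len_add hx u).trans (by omega)⟩

theorem distAt_eq (h : G.LocallyCorrect k c T K) {i : ℕ} (hi : i < k) (v : Fin n) :
    ((K v).distAt i : ℕ∞) = G.distSet v (levels (certLevel K) i) := by
  refine le_antisymm (le_distSet fun u hu => ?_) ?_
  · have key : (K v).distAt i ≤ G.dist v u := by
      induction v using shortest_induction (G := G) (w := u) with
      | hw =>
        rw [((h u).dist_zero i hi).2 (mem_levels.1 hu)]
        exact Nat.zero_le _
      | step v x hx ih =>
        have h1 := h.distAt_le hi hx.1
        have h2 := hx.2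
        omega
    exact_mod_cast key
  · obtain ⟨u, hu, hle⟩ := h.exists_level hi v
    exact (distSet_le hu).trans (by exact_mod_cast hle)

theorem certLevel_lt (h : G.LocallyCorrect k c T K) (v : Fin n) : certLevel K v < k :=
  (h v).lev_lt

theorem isLandmarks (h : G.LocallyCorrect k c T K) (hk : 0 < k) :
    IsLandmarks k (levels (certLevel K)) := by
  refine isLandmarks_levels h.certLevel_lt ?_
  have := G.connected.nonempty
  obtain ⟨u, hu, -⟩ := h.exists_level (show k - 1 < k by omega) this.some
  exact ⟨u, hu⟩

theorem thr_eq (h : G.LocallyCorrect k c T K) (i : ℕ) (v : Fin n) :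
    (K v).thr k i = G.distSet v (levels (certLevel K) (i + 1)) := by
  rw [Cert.thr]
  split
  · next hi => exact h.distAt_eq hi v
  · next hi => rw [levels_eq_empty h.certLevel_lt (not_lt.1 hi), distSet_empty]

theorem mem_bunchKeys (h : G.LocallyCorrect k c T K) (v : Fin n) (e : ℕ × ℕ × ℕ) :
    e ∈ (K v).bunchKeys ↔ ∃ u ∈ G.bunch k (levels (certLevel K)) v,
      e = (G.ident u, G.dist v u, certLevel K u) := by
  rw [mem_iff_of_sourceRules (G := G) (label := certLevel K) (thr := fun v => (K v).thr k)
    (E := fun v => (K v).bunchKeys)]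
  · simp only [mem_bunch_levels h.certLevel_lt, h.thr_eq]
  · intro v x a hx
    rw [h.thr_eq, h.thr_eq]
    exact (distSet_le_dist_add v x _).trans
      (add_le_add (by exact_mod_cast dist_le_len hx) le_rfl)
  · intro v
    have := (h v).bunch_dist
    rwa [List.map_map] at this

theorem mem_clusterKeys (h : G.LocallyCorrect k c T K) (hk : 2 ≤ k) (v : Fin n)
    (e : ℕ × ℕ × ℕ) :
    e ∈ (K v).clusterKeys ↔ ∃ u ∈ G.cluster (levels (certLevel K)) v,
      e = (G.ident u, G.dist v u, (K u).distAt 1) := by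
  rw [mem_iff_of_sourceRules (G := G) (label := fun v => (K v).distAt 1)
    (thr := fun _ a => (a : ℕ∞)) (E := fun v => (K v).clusterKeys)]
  · simp only [mem_cluster, h.distAt_eq (show 1 < k by omega)]
  · exact fun v x a _ => le_add_self
  · intro v
    have := (h v).cluster_dist
    rwa [List.map_map] at this

theorem exists_bunchEntries (h : G.LocallyCorrect k c T K) : ∃ be, G.BunchEntries k K be := by
  have hex : ∀ v u, u ∈ G.bunch k (levels (certLevel K)) v → ∃ e ∈ (K v).bunch,
      (e.id, e.node.dist, e.lev) = (G.ident u, G.dist v u, certLevel K u) := by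
    intro v u hu
    exact List.mem_map.1 ((h.mem_bunchKeys v _).2 ⟨u, hu, rfl⟩)
  have : Nonempty BunchEntry := ⟨⟨0, 0, ⟨0, 0, 0, 0, 0, ⟨0, []⟩⟩, ⟨0, 0, 0, 0, []⟩, []⟩⟩
  choose! be hbe hkey using hex
  simp only [Prod.mk.injEq] at hkey
  refine ⟨be, fun v => ⟨(h v).bunch_ids.of_map, fun e => ⟨fun he => ?_, ?_⟩⟩,
    fun v u hu => (hkey v u hu).1, fun v u hu => (hkey v u hu).2.1,
    fun v u hu => (hkey v u hu).2.2⟩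
  · obtain ⟨u, hu, heq⟩ := (h.mem_bunchKeys v _).1 (List.mem_map.2 ⟨e, he, rfl⟩)
    refine ⟨u, hu, ?_⟩
    refine List.inj_on_of_nodup_map (h v).bunch_ids (hbe v u hu) he ?_
    rw [(hkey v u hu).1]
    exact (congrArg Prod.fst heq).symm
  · rintro ⟨u, hu, rfl⟩
    exact hbe v u hu

theorem exists_clusterEntries (h : G.LocallyCorrect k c T K) (hk : 2 ≤ k) :
    ∃ ce, G.ClusterEntries K ce := by
  have hex : ∀ v u, u ∈ G.cluster (levels (certLevel K)) v → ∃ e ∈ (K v).cluster,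
      (e.id, e.node.dist, e.thr) = (G.ident u, G.dist v u, (K u).distAt 1) := by
    intro v u hu
    exact List.mem_map.1 ((h.mem_clusterKeys hk v _).2 ⟨u, hu, rfl⟩)
  have : Nonempty ClusterEntry := ⟨⟨0, 0, ⟨0, 0, 0, 0, 0, ⟨0, []⟩⟩⟩⟩
  choose! ce hce hkey using hex
  simp only [Prod.mk.injEq] at hkey
  refine ⟨ce, fun v => ⟨(h v).cluster_ids.of_map, fun e => ⟨fun he => ?_, ?_⟩⟩,
    fun v u hu => (hkey v u hu).1, fun v u hu => (hkey v u hu).2.1⟩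
  · obtain ⟨u, hu, heq⟩ := (h.mem_clusterKeys hk v _).1 (List.mem_map.2 ⟨e, he, rfl⟩)
    refine ⟨u, hu, ?_⟩
    refine List.inj_on_of_nodup_map (h v).cluster_ids (hce v u hu) he ?_
    rw [(hkey v u hu).1]
    exact (congrArg Prod.fst heq).symm
  · rintro ⟨u, hu, rfl⟩
    exact hce v u hu

theorem n_const (h : G.LocallyCorrect k c T K) (v w : Fin n) : (K v).n = (K w).n := by
  induction v using shortest_induction (G := G) (w := w) with
  | hw => rfl
  | step v x hx ih => exact (forall_mem_map_nbrs.1 (h v).n_eq x hx.1).symm.trans ih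

/-- The entries for the bunch describe the edges to the parents. -/
theorem bunch_link (h : G.LocallyCorrect k c T K) {be : Fin n → Fin n → BunchEntry}
    (hb : G.BunchEntries k K be) {v u : Fin n} (hu : u ∈ G.bunch k (levels (certLevel K)) v) :
    (be v u).node.up = G.parentPort u v ∧ (be v u).node.par = G.parentCode u v ∧
      (be v u).node.down = G.downPort u v := by
  by_cases hvu : v = u
  · subst hvu
    obtain ⟨h1, h2, h3, -⟩ := (h v).bunch_root _ (hb.mem hu) (by rw [hb.dist_eq v v hu, dist_self])
    rw [parentPort_root, parentCode_root, downPort_root]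
    exact ⟨h1, h2, h3⟩
  · obtain ⟨i, y, hy, hcl, hup, hpar, hmin⟩ := (h v).bunch_link _ (hb.mem hu) (by
      rw [hb.dist_eq v u hu, Ne, dist_eq_zero]
      exact hvu)
    obtain ⟨p, hp, hport, rfl⟩ := getElem?_map_nbrs.1 hy
    have hparent : G.IsParent u v p := by
      refine ⟨(hb.closer_iff hu hp).1 hcl, fun z hz => ?_⟩
      have hzport := G.port_pos v z
      have := hmin (G.port v z - 1) _ (getElem?_map_nbrs.2 ⟨z, hz.1, by omega, rfl⟩)
        ((hb.closer_iff hu hz.1).2 hz)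
      omega
    simp only [(h p).id_eq] at hpar
    refine ⟨?_, ?_, ?_⟩
    · rw [parentPort_eq hparent, hup, hport]
    · rw [parentCode_eq hparent, hpar]
    · have hzport := G.port_pos p v
      rw [downPort_eq hparent, (h p).bunch_down (G.port p v - 1) (G.len s(p, v), K v)
        (getElem?_map_nbrs.2 ⟨v, hp.symm, by omega, rfl⟩) _ (hb.mem hu) hpar]
      omega

theorem bunchListed (h : G.LocallyCorrect k c T K) {be : Fin n → Fin n → BunchEntry}
    (hb : G.BunchEntries k K be) : G.BunchListed k (levels (certLevel K)) K be where
  enum := hb.enum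
  id_eq := hb.id_eq
  par_eq _ _ hu := (h.bunch_link hb hu).2.1

theorem childEntries_eq (h : G.LocallyCorrect k c T K) {be : Fin n → Fin n → BunchEntry}
    (hb : G.BunchEntries k K be) {p u : Fin n} (hu : u ∈ G.bunch k (levels (certLevel K)) p) :
    childEntries (G.ident p) (be p u).id ((G.nbrs p).map fun x => (G.len s(p, x), K x)) =
      (G.childList k (levels (certLevel K)) u p).map fun x => be x u := by
  rw [hb.id_eq p u hu, (h.bunchListed hb).childEntries_eq]

theorem bunch_treeRule (h : G.LocallyCorrect k c T K) {be : Fin n → Fin n → BunchEntry}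
    (hb : G.BunchEntries k K be) (u : Fin n) :
    ∀ p ∈ G.treeNodes k (levels (certLevel K)) u, ∃ s,
      G.IsChildList (G.treeNodes k (levels (certLevel K)) u) u p s ∧
      TreeRule (branching (K u).n) (be p u).node (s.map fun x => (be x u).node) := by
  intro p hp
  have hup := mem_treeNodes.1 hp
  refine ⟨_, isChildList_childList u p, ?_⟩
  have := (h p).bunch_tree _ (hb.mem hup)
  rw [h.childEntries_eq hb hup, List.map_map, h.n_const p u] at this
  exact this

/-- The certificates contain the true number of nodes, because the tree of a landmark of the last
level spans the network. -/
theorem n_eq (h : G.LocallyCorrect k c T K) (hk : 0 < k) (v : Fin n) : (K v).n = n := by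
  classical
  obtain ⟨be, hb⟩ := h.exists_bunchEntries
  have hL := h.isLandmarks hk
  obtain ⟨w, hw⟩ := hL.nonempty
  have hlt := h.certLevel_lt w
  have hself := hL.self_mem_bunch (G := G) w
  have h1 := ((h w).top_level (by
    have := mem_levels.1 hw
    unfold certLevel at this hlt
    omega) _ (hb.mem hself) (hb.id_eq w w hself)).1
  have h2 := (hL.isTree w).size_eq_of_treeRule (h.bunch_treeRule hb w)
    (mem_treeNodes.2 hself)
  have h3 : G.treeNodes k (levels (certLevel K)) w = Finset.univ := by
    ext x
    simpa using mem_treeNodes.2 (hL.mem_bunch_of_mem_last hk hw x)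
  rw [h.n_const v w, ← h1, h2, h3, subtreeSize_eq_subtreeSum, subtreeSum_root]
  simp

theorem bunch_node (h : G.LocallyCorrect k c T K) (hk : 0 < k) {be : Fin n → Fin n → BunchEntry}
    (hb : G.BunchEntries k K be) {v u : Fin n} (hu : u ∈ G.bunch k (levels (certLevel K)) v) :
    (be v u).node = G.nodeRec (G.treeNodes k (levels (certLevel K)) u) u v := by
  have hL := h.isLandmarks hk
  have hrule := h.bunch_treeRule hb u
  rw [h.n_eq hk] at hrule
  refine (hL.isTree u).eq_nodeRec_of_treeRule (R := fun v => (be v u).node) hrule ?_ ?_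
    (mem_treeNodes.2 hu)
  · have hself := hL.self_mem_bunch (G := G) u
    exact ((h u).bunch_root _ (hb.mem hself) (by rw [hb.dist_eq u u hself, dist_self])).2.2.2
  · intro x hx
    have hux := mem_treeNodes.1 hx
    exact ⟨hb.dist_eq x u hux, h.bunch_link hb hux⟩

theorem bunch_tab (h : G.LocallyCorrect k c T K) (hk : 0 < k) {be : Fin n → Fin n → BunchEntry}
    (hb : G.BunchEntries k K be) {v u : Fin n} (hu : u ∈ G.bunch k (levels (certLevel K)) v) :
    (be v u).tab = G.treeTable (G.treeNodes k (levels (certLevel K)) u) u v := by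
  rw [(h v).bunch_table _ (hb.mem hu), h.childEntries_eq hb hu, h.n_eq hk, h.bunch_node hk hb hu,
    ← table_nodeRec, List.map_map]
  congr 1
  refine List.map_congr_left fun x hx => ?_
  exact h.bunch_node hk hb (mem_treeNodes.1
    (mem_children.1 (((isChildList_childList u v).2 x).1 hx)).1)

/-- The sizes of the levels, counted along the spanning tree of a landmark of the last level. -/
theorem card_levels_le (h : G.LocallyCorrect k c T K) (hk : 0 < k) {i : ℕ} (hi : i < k) :
    ((levels (certLevel K) i).card : ℝ) ≤ softO (1 - (i : ℝ) / k) c n := by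
  classical
  obtain ⟨be, hb⟩ := h.exists_bunchEntries
  have hL := h.isLandmarks hk
  obtain ⟨w, hw⟩ := hL.nonempty
  have hlt := h.certLevel_lt w
  have hself := hL.self_mem_bunch (G := G) w
  have h1 := ((h w).top_level (by
    have := mem_levels.1 hw
    unfold certLevel at this hlt
    omega) _ (hb.mem hself) (hb.id_eq w w hself)).2 i hi
  have h3 : G.treeNodes k (levels (certLevel K)) w = Finset.univ := by
    ext x
    simpa using mem_treeNodes.2 (hL.mem_bunch_of_mem_last hk hw x)
  have h2 : (be w w).countAt i = G.subtreeSum (G.treeNodes k (levels (certLevel K)) w) w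
      (fun x => if i ≤ certLevel K x then 1 else 0) w := by
    refine (hL.isTree w).eq_subtreeSum (f := fun p => (be p w).countAt i) (fun p hp => ?_)
      (mem_treeNodes.2 hself)
    have hwp := mem_treeNodes.1 hp
    rw [(h p).bunch_counts _ (hb.mem hwp) i hi, h.childEntries_eq hb hwp, List.map_map]
    exact congrArg _ ((isChildList_childList w p).sum_map fun x => (be x w).countAt i)
  rw [h2, h3, subtreeSum_root, Finset.sum_boole, h.n_eq hk] at h1
  exact h1

/-- The entries for the cluster describe the edges to the parents: a neighbour knows its edge
itself, and the parent of any other node is the one with the smallest port among its parents in the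
trees of the neighbours on shortest paths. -/
theorem cluster_link (h : G.LocallyCorrect k c T K) (hk : 0 < k)
    {ce : Fin n → Fin n → ClusterEntry} (hc : G.ClusterEntries K ce) {v y : Fin n}
    (hy : y ∈ G.cluster (levels (certLevel K)) v) :
    (ce v y).node.up = G.parentPort v y ∧ (ce v y).node.par = G.parentCode v y ∧
      (ce v y).node.down = G.downPort v y := by
  obtain ⟨be, hb⟩ := h.exists_bunchEntries
  have hL := h.isLandmarks hk
  induction hd : G.dist v y using Nat.strong_induction_on generalizing v with
  | _ d ih =>
    have he := hc.mem hy
    by_cases hvy : v = y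
    · subst hvy
      obtain ⟨h1, h2, h3, -⟩ := (h v).cluster_root _ he (by rw [hc.dist_eq v v hy, dist_self])
      rw [parentPort_root, parentCode_root, downPort_root]
      exact ⟨h1, h2, h3⟩
    have hd0 : (ce v y).node.dist ≠ 0 := by
      rw [hc.dist_eq v y hy, Ne, dist_eq_zero]
      exact hvy
    by_cases hadj : G.graph.Adj v y
    · obtain ⟨e', he', hid, h1, h2, h3⟩ := (h v).cluster_near _ he hd0 (G.len s(v, y), K y)
        (mem_map_nbrs.2 ⟨y, hadj, rfl⟩) (by rw [hc.id_eq v y hy]; exact (h y).id_eq)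
      obtain ⟨hvb, rfl⟩ := hb.eq_of_id_eq he' hid
      rw [h1, h2, h3]
      exact h.bunch_link hb hvb
    · have hfar : ∀ x ∈ (G.nbrs v).map (fun x => (G.len s(v, x), K x)),
          x.2.id ≠ (ce v y).id := by
        refine forall_mem_map_nbrs.2 fun x hx heq => hadj ?_
        rw [hc.id_eq v y hy] at heq
        rwa [← G.ident_injective ((h x).id_eq.symm.trans heq)]
      obtain ⟨x, hx, e', he', hid, hdist, h1, h2, h3⟩ :=
        exists_mem_map_nbrs.1 ((h v).cluster_link _ he hd0 hfar)
      obtain ⟨hyx, rfl⟩ := hc.eq_of_id_eq he' (hid.trans (hc.id_eq v y hy))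
      rw [hc.dist_eq v y hy, hc.dist_eq x y hyx] at hdist
      have hs : G.OnShortest y v x := ⟨hx, hdist.symm⟩
      obtain ⟨i1, i2, i3⟩ := ih _ (hd ▸ hs.dist_lt) hyx rfl
      have hyx' : y ≠ x := by
        rintro rfl
        exact hadj hx
      obtain ⟨z', hz'⟩ := exists_isParent (G := G) hyx'
      obtain ⟨z, hz⟩ := exists_isParent (G := G) (Ne.symm hvy)
      obtain ⟨x', hs', hzx'⟩ := hz.exists_neighbour fun hzv => hadj (hzv ▸ hz.adj).symm
      have hyx'' : y ∈ G.cluster (levels (certLevel K)) x' := by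
        rw [mem_cluster] at hy ⊢
        exact lt_trans (by exact_mod_cast hs'.dist_lt) hy
      have hmin := (h v).cluster_min _ he hd0 hfar (G.len s(v, x'), K x')
        (mem_map_nbrs.2 ⟨x', hs'.1, rfl⟩) _ (hc.mem hyx'')
        (by rw [hc.id_eq v y hy, hc.id_eq x' y hyx''])
        (by rw [hc.dist_eq v y hy, hc.dist_eq x' y hyx'']; exact hs'.2.symm)
      rw [(ih _ (hd ▸ hs'.dist_lt) hyx'' rfl).1, parentPort_eq hzx', h1, i1,
        parentPort_eq hz'] at hmin
      have hzz : z = z' :=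
        port_inj hz.adj (le_antisymm (hz.2 z' (hs.of_neighbour hz'.1)) hmin)
      subst hzz
      rw [h1, h2, h3, i1, i2, i3, parentPort_eq hz, parentPort_eq hz', parentCode_eq hz,
        parentCode_eq hz', downPort_eq hz, downPort_eq hz']
      exact ⟨rfl, rfl, rfl⟩

/-- The entries for the cluster are the true records: as the cluster is the whole tree, the node
itself can check the tree rules. -/
theorem cluster_node (h : G.LocallyCorrect k c T K) (hk : 0 < k)
    {ce : Fin n → Fin n → ClusterEntry} (hc : G.ClusterEntries K ce) {v y : Fin n}
    (hy : y ∈ G.cluster (levels (certLevel K)) v) :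
    (ce v y).node = G.nodeRec (G.treeNodes k (levels (certLevel K)) v) v y := by
  have hL := h.isLandmarks hk
  have hU := hL.cluster_eq_treeNodes hk hy
  have hlisted : G.ClusterListed (levels (certLevel K)) v (K v) (ce v) :=
    ⟨hc.enum v, hc.id_eq v, fun u hu => (h.cluster_link hk hc hu).2.1⟩
  refine (hL.isTree v).eq_nodeRec_of_treeRule (R := fun y => (ce v y).node) ?_ ?_ ?_ (hU ▸ hy)
  · intro p hp
    rw [← hU] at hp
    obtain ⟨s, hs, hfilter⟩ := hlisted.exists_isChildList hL hk hy p
    refine ⟨s, hs, ?_⟩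
    have := (h v).cluster_tree _ (hc.mem hp)
    rw [hc.id_eq v p hp, hfilter, List.map_map, h.n_eq hk] at this
    exact this
  · have hv := (hL.isTree v (G := G)).root_mem
    rw [← hU] at hv
    exact ((h v).cluster_root _ (hc.mem hv) (by rw [hc.dist_eq v v hv, dist_self])).2.2.2
  · intro x hx
    rw [← hU] at hx
    refine ⟨?_, h.cluster_link hk hc hx⟩
    rw [hc.dist_eq v x hx, dist_comm]

theorem isHierarchy (h : G.LocallyCorrect k c T K) (hk : 2 ≤ k) :
    G.IsHierarchy k c (levels (certLevel K)) := by
  have hL := h.isLandmarks (by omega : 0 < k)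
  obtain ⟨be, hb⟩ := h.exists_bunchEntries
  obtain ⟨ce, hc⟩ := h.exists_clusterEntries hk
  refine ⟨hL.zero, hL.anti, hL.nonempty, hL.top, fun i hi => h.card_levels_le (by omega) hi,
    fun v => ?_, fun v => ?_⟩
  · rw [← (hb.enum v).length_eq fun u hu u' hu' he =>
      G.ident_injective (by rw [← hb.id_eq v u hu, ← hb.id_eq v u' hu', he])]
    have := (h v).bunch_card
    rwa [h.n_eq (by omega)] at this
  · rw [← (hc.enum v).length_eq fun u hu u' hu' he =>
      G.ident_injective (by rw [← hc.id_eq v u hu, ← hc.id_eq v u' hu', he])]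
    have := (h v).cluster_card
    rwa [h.n_eq (by omega)] at this

/-- The landmarks stored in the tables are nearest landmarks. -/
theorem exists_isNearest (h : G.LocallyCorrect k c T K) {be : Fin n → Fin n → BunchEntry}
    (hb : G.BunchEntries k K be) :
    ∃ l, G.IsNearest k (levels (certLevel K)) l ∧ ∀ v, ∀ i < k,
      l i v ∈ G.bunch k (levels (certLevel K)) v ∧
      (T v).landmarks[i]? = some (G.ident (l i v), (be v (l i v)).tab) := by
  have hex : ∀ (i : ℕ) (v : Fin n), ∃ u, i < k → u ∈ G.bunch k (levels (certLevel K)) v ∧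
      (T v).landmarks[i]? = some (G.ident u, (be v u).tab) ∧ i ≤ certLevel K u ∧
      G.dist v u = (K v).distAt i := by
    intro i v
    by_cases hi : i < k
    · obtain ⟨e, he, h1, h2, h3⟩ := (h v).landmarks_mem i hi
      obtain ⟨u, hu, rfl⟩ := ((hb.enum v).2 e).1 he
      rw [hb.id_eq v u hu] at h1
      rw [hb.lev_eq v u hu] at h2
      rw [hb.dist_eq v u hu] at h3
      exact ⟨u, fun _ => ⟨hu, h1, h2, h3⟩⟩
    · exact ⟨v, fun h => absurd h hi⟩
  choose l hl using hex
  refine ⟨l, fun v i hi => ?_, fun v i hi => ⟨(hl i v hi).1, (hl i v hi).2.1⟩⟩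
  obtain ⟨-, h2, h3, h4⟩ := hl i v hi
  refine ⟨mem_levels.2 h3, ?_, fun heq => ?_⟩
  · rw [h4, h.distAt_eq hi]
  · have hi' : i + 1 < k := by
      by_contra hle
      rw [levels_eq_empty h.certLevel_lt (not_lt.1 hle), distSet_empty, ← h.distAt_eq hi] at heq
      exact ENat.natCast_ne_top _ heq
    rw [← h.distAt_eq hi, ← h.distAt_eq hi'] at heq
    have h5 := (h v).landmarks_eq i hi' (by exact_mod_cast heq)
    rw [h2, (hl (i + 1) v hi').2.1, Option.some_inj, Prod.mk.injEq] at h5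
    exact G.ident_injective h5.1

/-- Tables that are accepted by all nodes are correct. -/
theorem isThorupZwick (h : G.LocallyCorrect k c T K) (hk : 2 ≤ k) :
    ∃ N, G.IsThorupZwick k c T N := by
  have hk0 : 0 < k := by omega
  obtain ⟨be, hb⟩ := h.exists_bunchEntries
  obtain ⟨ce, hc⟩ := h.exists_clusterEntries hk
  obtain ⟨l, hl, hland⟩ := h.exists_isNearest hb
  refine ⟨_, levels (certLevel K), l, h.isHierarchy hk, hl, fun v => ⟨⟨?_, ?_, ?_⟩, rfl⟩⟩
  · obtain ⟨t, ht, htA, hmap⟩ := (hb.enum v).exists_list fun u hu u' hu' he =>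
      G.ident_injective (by rw [← hb.id_eq v u hu, ← hb.id_eq v u' hu', he])
    rw [(h v).table_bunch, hmap, List.map_map]
    have heq : t.map ((fun e : BunchEntry => (e.id, e.tab, e.node.name)) ∘ be v) =
        t.map fun u => (G.ident u,
          G.treeTable (G.treeNodes k (levels (certLevel K)) u) u v,
          G.treeName (G.treeNodes k (levels (certLevel K)) u) u v) := by
      refine List.map_congr_left fun u hu => ?_
      have hu' := (htA u).1 hu
      simp only [Function.comp_apply]
      rw [hb.id_eq v u hu', h.bunch_tab hk0 hb hu', h.bunch_node hk0 hb hu']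
      rfl
    rw [heq]
    exact enumerates_map ht htA fun u _ u' _ he => G.ident_injective (congrArg Prod.fst he)
  · obtain ⟨t, ht, htA, hmap⟩ := (hc.enum v).exists_list fun u hu u' hu' he =>
      G.ident_injective (by rw [← hc.id_eq v u hu, ← hc.id_eq v u' hu', he])
    rw [(h v).table_cluster, hmap, List.map_map]
    have heq : t.map ((fun e : ClusterEntry => (e.id, e.node.name)) ∘ ce v) =
        t.map fun u => (G.ident u,
          G.treeName (G.treeNodes k (levels (certLevel K)) v) v u) := by
      refine List.map_congr_left fun u hu => ?_
      have hu' := (htA u).1 hu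
      simp only [Function.comp_apply]
      rw [hc.id_eq v u hu', h.cluster_node hk0 hc hu']
      rfl
    rw [heq]
    exact enumerates_map ht htA fun u _ u' _ he => G.ident_injective (congrArg Prod.fst he)
  · refine List.ext_getElem? fun i => ?_
    by_cases hi : i < k
    · rw [(hland v i hi).2, h.bunch_tab hk0 hb (hland v i hi).1]
      simp [hi]
    · rw [List.getElem?_eq_none (by rw [(h v).landmarks_length]; omega),
        List.getElem?_eq_none (by simpa using hi)]

end LocallyCorrect

end Network

/-! ### Completeness of the verification -/

namespace Network

variable {n : ℕ} {G : Network n} {k c : ℕ} {lev : Fin n → ℕ}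

/-- The entry for `u` in the certificate of `v`, for correct tables. -/
def bunchEntry (G : Network n) (k : ℕ) (lev : Fin n → ℕ) (v u : Fin n) : BunchEntry where
  id := G.ident u
  lev := lev u
  node := G.nodeRec (G.treeNodes k (levels lev) u) u v
  tab := G.treeTable (G.treeNodes k (levels lev) u) u v
  counts := (List.range k).map fun i =>
    G.subtreeSum (G.treeNodes k (levels lev) u) u (fun x => if i ≤ lev x then 1 else 0) v

/-- The entry for `u` in the cluster of `v`, for correct tables. -/
def clusterEntry (G : Network n) (k : ℕ) (lev : Fin n → ℕ) (v u : Fin n) : ClusterEntry where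
  id := G.ident u
  thr := (G.distSet u (levels lev 1)).toNat
  node := G.nodeRec (G.treeNodes k (levels lev) v) v u

/-- The certificate of `v` for correct tables; `s` and `t` list the nodes of its bunch and of its
cluster in the order of the table. -/
def trueCert (G : Network n) (k : ℕ) (lev : Fin n → ℕ) (v : Fin n) (s t : List (Fin n)) :
    Cert where
  n := n
  id := G.ident v
  lev := lev v
  dists := (List.range k).map fun i => (G.distSet v (levels lev i)).toNat
  bunch := s.map (G.bunchEntry k lev v)
  cluster := t.map (G.clusterEntry k lev v)

theorem natCast_toNat_distSet {S : Finset (Fin n)} (hS : S.Nonempty) (v : Fin n) :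
    ((G.distSet v S).toNat : ℕ∞) = G.distSet v S := by
  obtain ⟨u, -, hu⟩ := exists_distSet_eq (G := G) (v := v) hS
  rw [← hu, ENat.toNat_natCast]

theorem countAt_bunchEntry {i : ℕ} (hi : i < k) (v u : Fin n) :
    (G.bunchEntry k lev v u).countAt i = G.subtreeSum (G.treeNodes k (levels lev) u) u
      (fun x => if i ≤ lev x then 1 else 0) v := by
  simp [BunchEntry.countAt, bunchEntry, hi]

theorem distAt_trueCert {i : ℕ} (hi : i < k) (v : Fin n) (s t : List (Fin n)) :
    (G.trueCert k lev v s t).distAt i = (G.distSet v (levels lev i)).toNat := by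
  simp [Cert.distAt, trueCert, hi]

/-- Correct tables, together with the true values in the certificates, comply with the local rules.
-/
theorem locallyCorrect_trueCert (hk : 2 ≤ k) (hlev : ∀ v, lev v < k)
    (hH : G.IsHierarchy k c (levels lev)) {l : ℕ → Fin n → Fin n}
    (hl : G.IsNearest k (levels lev) l) {T : Fin n → Table}
    (hT : ∀ v, G.IsTable k (levels lev) l v (T v)) {s t : Fin n → List (Fin n)}
    (hs : ∀ v, (s v).Nodup) (hsA : ∀ v u, u ∈ s v ↔ u ∈ G.bunch k (levels lev) v)
    (ht : ∀ v, (t v).Nodup) (htA : ∀ v u, u ∈ t v ↔ u ∈ G.cluster (levels lev) v)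
    (hTs : ∀ v, (T v).bunch = (s v).map fun u => (G.ident u,
      G.treeTable (G.treeNodes k (levels lev) u) u v,
      G.treeName (G.treeNodes k (levels lev) u) u v))
    (hTt : ∀ v, (T v).cluster = (t v).map fun u => (G.ident u,
      G.treeName (G.treeNodes k (levels lev) v) v u)) :
    G.LocallyCorrect k c T fun v => G.trueCert k lev v (s v) (t v) := by
  classical
  have hL := hH.isLandmarks
  set K : Fin n → Cert := fun v => G.trueCert k lev v (s v) (t v) with hK
  have hb : G.BunchEntries k K (G.bunchEntry k lev) :=
    ⟨fun v => enumerates_map (hs v) (hsA v) fun u _ u' _ he =>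
      G.ident_injective (congrArg BunchEntry.id he), fun _ _ _ => rfl, fun _ _ _ => rfl,
      fun _ _ _ => rfl⟩
  have hc : G.ClusterEntries K (G.clusterEntry k lev) :=
    ⟨fun v => enumerates_map (ht v) (htA v) fun u _ u' _ he =>
      G.ident_injective (congrArg ClusterEntry.id he), fun _ _ _ => rfl,
      fun v u _ => dist_comm u v⟩
  have hlisted : G.BunchListed k (levels lev) K (G.bunchEntry k lev) :=
    ⟨hb.enum, fun _ _ _ => rfl, fun _ _ _ => rfl⟩
  have hdist : ∀ i < k, ∀ v, ((K v).distAt i : ℕ∞) = G.distSet v (levels lev i) := by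
    intro i hi v
    rw [hK, distAt_trueCert hi, natCast_toNat_distSet (hL.nonempty_of_lt hi)]
  have hthr : ∀ i v, (K v).thr k i = G.distSet v (levels lev (i + 1)) := by
    intro i v
    rw [Cert.thr]
    split
    · next hi => exact hdist _ hi v
    · next hi => rw [levels_eq_empty hlev (not_lt.1 hi), distSet_empty]
  have hnode : ∀ {v : Fin n} {e : BunchEntry}, e ∈ (K v).bunch →
      ∃ u ∈ G.bunch k (levels lev) v, e = G.bunchEntry k lev v u := by
    intro v e he
    obtain ⟨u, hu, rfl⟩ := ((hb.enum v).2 e).1 he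
    exact ⟨u, hu, rfl⟩
  have hcnode : ∀ {v : Fin n} {e : ClusterEntry}, e ∈ (K v).cluster →
      ∃ u ∈ G.cluster (levels lev) v, e = G.clusterEntry k lev v u := by
    intro v e he
    obtain ⟨u, hu, rfl⟩ := ((hc.enum v).2 e).1 he
    exact ⟨u, hu, rfl⟩
  have hroot : ∀ (U : Finset (Fin n)) (w v : Fin n), (G.nodeRec U w v).dist = 0 →
      (G.nodeRec U w v).IsRoot := by
    intro U w v h0
    obtain rfl := dist_eq_zero.1 h0
    refine ⟨parentPort_root v, parentCode_root v, downPort_root v, ?_⟩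
    simp only [nodeRec, treeName, preorder_root, lightPorts_root]
  have hchild : ∀ v u : Fin n, childEntries (G.ident v) (G.bunchEntry k lev v u).id
      ((G.nbrs v).map fun x => (G.len s(v, x), K x)) =
        (G.childList k (levels lev) u v).map fun x => G.bunchEntry k lev x u := fun v u =>
    hlisted.childEntries_eq v u
  intro v
  refine
    { id_eq := rfl
      n_eq := forall_mem_map_nbrs.2 fun _ _ => rfl
      lev_lt := hlev v
      dist_zero := fun i hi => ?_
      dist_le := fun i hi => forall_mem_map_nbrs.2 fun x hx => ?_
      dist_step := fun i hi h0 => ?_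
      bunch_ids := ?_
      bunch_dist := ?_
      bunch_root := fun e he h0 => ?_
      bunch_link := fun e he h0 => ?_
      bunch_down := fun i x hx e he hpar => ?_
      bunch_tree := fun e he => ?_
      bunch_table := fun e he => ?_
      bunch_counts := fun e he i hi => ?_
      bunch_card := ?_
      top_level := fun hv e he hid => ?_
      cluster_ids := ?_
      cluster_dist := ?_
      cluster_root := fun e he h0 => ?_
      cluster_near := fun e he h0 => forall_mem_map_nbrs.2 fun x hx hid => ?_
      cluster_link := fun e he h0 hfar => ?_
      cluster_min := fun e he h0 hfar => forall_mem_map_nbrs.2 fun x hx e' he' hid hd => ?_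
      cluster_tree := fun e he => ?_
      cluster_card := ?_
      table_bunch := ?_
      table_cluster := ?_
      landmarks_length := ?_
      landmarks_mem := fun i hi => ?_
      landmarks_eq := fun i hi heq => ?_ }
  · rw [← @Nat.cast_eq_zero ℕ∞, hdist i hi, distSet_eq_zero, mem_levels]
    rfl
  · have h1 := distSet_le_dist_add (G := G) v x (levels lev i)
    rw [← hdist i hi, ← hdist i hi] at h1
    have h2 : (K v).distAt i ≤ G.dist v x + (K x).distAt i := by exact_mod_cast h1
    have h3 := dist_le_len hx
    simp only
    omega
  · obtain ⟨u, hu, hd⟩ := exists_distSet_eq (G := G) (v := v) (hL.nonempty_of_lt hi)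
    rw [← hdist i hi, Nat.cast_inj] at hd
    obtain ⟨x, hx⟩ := exists_onShortest (G := G) (v := v) (w := u) (by
      rintro rfl
      rw [dist_self] at hd
      exact h0 hd.symm)
    refine exists_mem_map_nbrs.2 ⟨x, hx.1, ?_⟩
    have h1 := distSet_le_dist_add (G := G) v x (levels lev i)
    rw [← hdist i hi, ← hdist i hi] at h1
    have h2 : (K v).distAt i ≤ G.dist v x + (K x).distAt i := by exact_mod_cast h1
    have h3 := dist_le_len hx.1
    have h4 := distSet_le (G := G) (v := x) hu
    rw [← hdist i hi, Nat.cast_le] at h4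
    have h5 := hx.2
    simp only
    omega
  · simp only [hK, trueCert, List.map_map]
    exact (List.nodup_map_iff (f := G.ident) G.ident_injective).2 (hs v)
  · have h1 := sourceRules_of_mem_iff (G := G) (label := lev) (thr := fun v => (K v).thr k)
      (E := fun v => (K v).bunchKeys) (fun v x a hx => by
        rw [hthr, hthr]
        exact (distSet_le_dist_add v x _).trans
          (add_le_add (by exact_mod_cast dist_le_len hx) le_rfl)) (fun v e => by
        simp only [hthr, ← mem_bunch_levels hlev, Cert.bunchKeys, List.mem_map]
        constructor
        · rintro ⟨e, he, rfl⟩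
          obtain ⟨u, hu, rfl⟩ := hnode he
          exact ⟨u, hu, rfl⟩
        · rintro ⟨u, hu, rfl⟩
          exact ⟨_, hb.mem hu, rfl⟩) v
    rw [List.map_map]
    exact h1
  · obtain ⟨u, hu, rfl⟩ := hnode he
    exact hroot _ _ _ h0
  · obtain ⟨u, hu, rfl⟩ := hnode he
    obtain ⟨p, hp⟩ := exists_isParent (G := G) (v := v) (w := u) fun h => h0 (dist_eq_zero.2 h)
    have hport := G.port_pos v p
    refine ⟨G.port v p - 1, (G.len s(v, p), K p),
      getElem?_map_nbrs.2 ⟨p, hp.adj, by omega, rfl⟩, (hb.closer_iff hu hp.adj).2 hp.1, ?_,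
      parentCode_eq hp, fun j y hy hcl => ?_⟩
    · rw [show (G.bunchEntry k lev v u).node.up = G.port v p from parentPort_eq hp]
      omega
    · obtain ⟨z, hz, hj, rfl⟩ := getElem?_map_nbrs.1 hy
      have := hp.2 z ((hb.closer_iff hu hz).1 hcl)
      omega
  · obtain ⟨y, hy, hi, rfl⟩ := getElem?_map_nbrs.1 hx
    obtain ⟨u, hu, rfl⟩ := hnode he
    rw [← hi]
    exact downPort_eq (parentCode_eq_iff.1 hpar)
  · obtain ⟨u, hu, rfl⟩ := hnode he
    rw [hchild, List.map_map]
    exact (hL.isTree u).treeRule_nodeRec (mem_treeNodes.2 hu) (isChildList_childList u v)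
  · obtain ⟨u, hu, rfl⟩ := hnode he
    rw [hchild, List.map_map]
    exact (table_nodeRec u v).symm
  · obtain ⟨u, hu, rfl⟩ := hnode he
    rw [hchild, List.map_map, countAt_bunchEntry hi,
      (hL.isTree u).subtreeSum_eq _ (mem_treeNodes.2 hu)]
    refine congrArg _ (Eq.trans ?_ ((isChildList_childList u v).sum_map _).symm)
    exact Finset.sum_congr rfl fun x _ => (countAt_bunchEntry hi x u).symm
  · rw [(hb.enum v).length_eq fun u _ u' _ he => G.ident_injective (congrArg BunchEntry.id he)]
    exact hH.bunch_le v
  · obtain ⟨hvb, rfl⟩ := hb.eq_of_id_eq he hid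
    have hv' : v ∈ levels lev (k - 1) := mem_levels.2 (by
      have : lev v + 1 = k := hv
      omega)
    have hU : G.treeNodes k (levels lev) v = Finset.univ := by
      ext x
      simpa using mem_treeNodes.2 (hL.mem_bunch_of_mem_last (by omega) hv' x)
    constructor
    · have h1 : G.subtreeSize (G.treeNodes k (levels lev) v) v v = n := by
        rw [subtreeSize_eq_subtreeSum, subtreeSum_root, hU]
        simp
      exact h1
    · intro i hi
      rw [countAt_bunchEntry hi, subtreeSum_root, hU, Finset.sum_boole]
      exact hH.card_le i hi
  · simp only [hK, trueCert, List.map_map]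
    exact (List.nodup_map_iff (f := G.ident) G.ident_injective).2 (ht v)
  · have h1 := sourceRules_of_mem_iff (G := G) (label := fun v => (K v).distAt 1)
      (thr := fun _ a => (a : ℕ∞)) (E := fun v => (K v).clusterKeys)
      (fun v x a _ => le_add_self) (fun v e => by
        simp only [hdist 1 (by omega), ← mem_cluster (G := G), Cert.clusterKeys, List.mem_map]
        constructor
        · rintro ⟨e, he, rfl⟩
          obtain ⟨u, hu, rfl⟩ := hcnode he
          refine ⟨u, hu, ?_⟩
          rw [hK, distAt_trueCert (by omega)]
          exact congrArg (fun d => (G.ident u, d, _)) (dist_comm u v)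
        · rintro ⟨u, hu, rfl⟩
          refine ⟨_, hc.mem hu, ?_⟩
          rw [hK, distAt_trueCert (by omega)]
          exact congrArg (fun d => (G.ident u, d, _)) (dist_comm u v)) v
    rw [List.map_map]
    exact h1
  · obtain ⟨u, hu, rfl⟩ := hcnode he
    exact hroot _ _ _ h0
  · obtain ⟨u, hu, rfl⟩ := hcnode he
    obtain rfl := G.ident_injective hid
    exact ⟨_, hb.mem (hL.mem_bunch_of_mem_cluster (by omega) hu), rfl, rfl, rfl, rfl⟩
  · obtain ⟨y, hy, rfl⟩ := hcnode he
    have hadj : ¬ G.graph.Adj v y := fun h => forall_mem_map_nbrs.1 hfar y h rfl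
    obtain ⟨z, hz⟩ := exists_isParent (G := G) (v := y) (w := v) fun h => h0 (dist_eq_zero.2 h)
    obtain ⟨x, hx, hzx⟩ := hz.exists_neighbour fun hzv => hadj (hzv ▸ hz.adj).symm
    have hyx : y ∈ G.cluster (levels lev) x := by
      rw [mem_cluster] at hy ⊢
      exact lt_trans (by exact_mod_cast hx.dist_lt) hy
    refine exists_mem_map_nbrs.2 ⟨x, hx.1, _, hc.mem hyx, rfl, ?_, ?_, ?_, ?_⟩
    · refine (dist_comm y v).trans (hx.2.symm.trans ?_)
      exact congrArg _ (dist_comm x y)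
    · exact (parentPort_eq hz).trans (parentPort_eq hzx).symm
    · exact (parentCode_eq hz).trans (parentCode_eq hzx).symm
    · exact (downPort_eq hz).trans (downPort_eq hzx).symm
  · obtain ⟨y, hy, rfl⟩ := hcnode he
    obtain ⟨hyx, rfl⟩ := hc.eq_of_id_eq he' hid
    have hadj : ¬ G.graph.Adj v y := fun h => forall_mem_map_nbrs.1 hfar y h rfl
    have hd' : G.dist y v = G.len s(v, x) + G.dist y x := hd
    obtain ⟨z, hz⟩ := exists_isParent (G := G) (v := y) (w := v) fun h => h0 (dist_eq_zero.2 h)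
    obtain ⟨z', hz'⟩ := exists_isParent (G := G) (v := y) (w := x) fun h => hadj (h ▸ hx)
    have hx' : G.OnShortest y v x := ⟨hx, by rw [dist_comm x y, dist_comm v y, hd']⟩
    refine (parentPort_eq hz).trans_le (le_trans ?_ (parentPort_eq hz').ge)
    exact hz.2 z' (hx'.of_neighbour hz'.1)
  · obtain ⟨u, hu, rfl⟩ := hcnode he
    have hclisted : G.ClusterListed (levels lev) v (K v) (G.clusterEntry k lev v) :=
      ⟨hc.enum v, fun _ _ => rfl, fun _ _ => rfl⟩
    obtain ⟨r, hr, hfilter⟩ := hclisted.exists_isChildList hL (by omega) hu u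
    rw [show (G.clusterEntry k lev v u).id = G.ident u from rfl, hfilter, List.map_map]
    refine (hL.isTree v).treeRule_nodeRec ?_ hr
    rw [← hL.cluster_eq_treeNodes (by omega) hu]
    exact hu
  · rw [(hc.enum v).length_eq fun u _ u' _ he => G.ident_injective (congrArg ClusterEntry.id he)]
    exact hH.cluster_le v
  · rw [hTs]
    simp only [hK, trueCert, List.map_map]
    rfl
  · rw [hTt]
    simp only [hK, trueCert, List.map_map]
    rfl
  · simp [(hT v).2.2]
  · have hlv := hl.mem_bunch hL hi v
    refine ⟨_, hb.mem hlv, ?_, mem_levels.1 (hl v i hi).1, ?_⟩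
    · simp [(hT v).2.2, hi, bunchEntry]
    · have h1 := (hl v i hi).2.1
      rw [← hdist i hi, Nat.cast_inj] at h1
      exact h1
  · have h1 := (hl v i (by omega)).2.2 (by
      rw [← hdist i (by omega), ← hdist (i + 1) hi, heq])
    simp [(hT v).2.2, hi, show i < k by omega, h1]

end Network

/-! ### Sizes of names, tables and certificates -/

namespace Network

variable {n : ℕ} {G : Network n} {k c a : ℕ} {U : Finset (Fin n)} {w v : Fin n}

theorem dist_le_of_polyBounded (hG : G.PolyBounded a) (u v : Fin n) :
    G.dist u v ≤ (n + 1) ^ (a + 1) := by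
  obtain ⟨p, hp⟩ := (G.connected.preconnected u v).exists_isPath
  have h1 : (p.edges.map G.len).sum ≤ p.edges.length * (n + 1) ^ a := by
    have := List.sum_le_card_nsmul (p.edges.map G.len) ((n + 1) ^ a) fun x hx => by
      obtain ⟨e, he, rfl⟩ := List.mem_map.1 hx
      exact hG.2 e (p.edges_subset_edgeSet he)
    simpa using this
  have h2 := hp.length_lt
  rw [Fintype.card_fin] at h2
  refine (dist_le_walk p).trans (h1.trans ?_)
  rw [SimpleGraph.Walk.length_edges, pow_succ, Nat.mul_comm]
  exact Nat.mul_le_mul_left _ (by omega)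

theorem IsTree.preorder_add_le (hU : G.IsTree U w) (hv : v ∈ U) :
    G.preorder U w v + G.subtreeSize U w v ≤ n := by
  have h1 := (hU.preorder_of_desc hv (desc_root w v)).2
  have h2 := G.subtreeSize_le U w w
  rw [preorder_root] at h1
  omega

/-- Each light edge on the way to `v` at least halves the size of the subtree. -/
theorem IsTree.length_lightPorts_le (hU : G.IsTree U w) (hv : v ∈ U) :
    (G.lightPorts U w v).length ≤ Nat.log 2 n := by
  have key : G.subtreeSize U w v * 2 ^ (G.lightPorts U w v).length ≤ n := by
    induction v using parent_induction (G := G) (w := w) with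
    | hw =>
      rw [lightPorts_root]
      simpa using G.subtreeSize_le U w w
    | step v p hp ih =>
      have hpU := hU.parent_mem v hv p hp
      refine le_trans ?_ (ih hpU)
      rw [lightPorts_eq U hp]
      have hlt := hU.subtreeSize_child_lt hpU (mem_children.2 ⟨hv, hp⟩)
      split
      · rw [List.append_nil]
        exact Nat.mul_le_mul_right _ hlt.le
      · next hlight =>
        rw [IsHeavy, not_le] at hlight
        have h2 : 2 * G.subtreeSize U w v ≤ branching n * G.subtreeSize U w v :=
          Nat.mul_le_mul_right _ (Nat.le_add_left 2 _)
        rw [List.length_append, List.length_singleton, pow_succ]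
        calc G.subtreeSize U w v * (2 ^ (G.lightPorts U w p).length * 2)
            = 2 * G.subtreeSize U w v * 2 ^ (G.lightPorts U w p).length := by ring
          _ ≤ _ := Nat.mul_le_mul_right _ (h2.trans hlight.le)
  have hn : n ≠ 0 := by
    have := v.pos
    omega
  refine Nat.le_log_of_pow_le one_lt_two (le_trans ?_ key)
  exact Nat.le_mul_of_pos_left _ (hU.subtreeSize_pos hv)

theorem length_heavy_le_card (U : Finset (Fin n)) (w v : Fin n) :
    (G.treeTable U w v).heavy.length ≤ n := by
  simp only [treeTable]
  rw [List.length_map]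
  refine (List.length_filter_le _ _).trans ?_
  simpa using (G.nbrs_nodup v).length_le_card

/-- A node has at most `branching n` heavy children. -/
theorem IsTree.length_heavy_le (hU : G.IsTree U w) (hv : v ∈ U) :
    (G.treeTable U w v).heavy.length ≤ branching n := by
  classical
  simp only [treeTable]
  rw [List.length_map]
  set s := (G.nbrs v).filter fun x => decide (x ∈ G.children U w v ∧ G.IsHeavy U w v x) with hs
  have hnd : s.Nodup := (G.nbrs_nodup v).filter _
  have hmem : ∀ x ∈ s.toFinset, x ∈ G.children U w v ∧ G.IsHeavy U w v x := fun x hx =>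
    of_decide_eq_true (List.mem_filter.1 (List.mem_toFinset.1 hx)).2
  have h1 : s.length * G.subtreeSize U w v ≤ branching n * G.subtreeSize U w v := by
    calc s.length * G.subtreeSize U w v
        ≤ ∑ x ∈ s.toFinset, branching n * G.subtreeSize U w x := by
          rw [← List.toFinset_card_of_nodup hnd]
          simpa using Finset.card_nsmul_le_sum s.toFinset
            (fun x => branching n * G.subtreeSize U w x) _ fun x hx => (hmem x hx).2
      _ = branching n * ∑ x ∈ s.toFinset, G.subtreeSize U w x := by rw [Finset.mul_sum]
      _ ≤ branching n * ∑ x ∈ G.children U w v, G.subtreeSize U w x :=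
          Nat.mul_le_mul_left _ (Finset.sum_le_sum_of_subset fun x hx => (hmem x hx).1)
      _ ≤ _ := by
          rw [hU.subtreeSize_eq hv]
          exact Nat.mul_le_mul_left _ (Nat.le_add_left _ _)
  exact le_of_mul_le_mul_right h1 (hU.subtreeSize_pos hv)

theorem mem_lightPorts_le {q : ℕ} (hq : q ∈ G.lightPorts U w v) : q ≤ n := by
  induction v using parent_induction (G := G) (w := w) with
  | hw => simp [lightPorts_root] at hq
  | step v p hp ih =>
    rw [lightPorts_eq U hp, List.mem_append] at hq
    rcases hq with hq | hq
    · exact ih hq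
    · split at hq
      · simp at hq
      · rw [List.mem_singleton] at hq
        rw [hq]
        exact port_le hp.adj.symm

theorem parentPort_le (w v : Fin n) : G.parentPort w v ≤ n := by
  by_cases hv : v = w
  · rw [hv, parentPort_root]
    exact Nat.zero_le n
  · obtain ⟨p, hp⟩ := exists_isParent (G := G) hv
    rw [parentPort_eq hp]
    exact port_le hp.adj

theorem downPort_le (w v : Fin n) : G.downPort w v ≤ n := by
  by_cases hv : v = w
  · rw [hv, downPort_root]
    exact Nat.zero_le n
  · obtain ⟨p, hp⟩ := exists_isParent (G := G) hv
    rw [downPort_eq hp]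
    exact port_le hp.adj.symm

theorem parentCode_le (hG : G.PolyBounded a) (w v : Fin n) :
    G.parentCode w v ≤ (n + 1) ^ a := by
  by_cases hv : v = w
  · rw [hv, parentCode_root]
    exact Nat.zero_le _
  · obtain ⟨p, hp⟩ := exists_isParent (G := G) hv
    rw [parentCode_eq hp]
    exact hG.1 p

end Network

/-- The number of bits for a number that is at most `(n + 1) ^ (a + 2) + k`; this covers all numbers
in names, tables and certificates. -/
def numberBits (k a n : ℕ) : ℕ := (natCode ((n + 1) ^ (a + 2) + k)).length

/-- A bound for the number of numbers in an entry of a name, a table or a certificate. -/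
def entryBound (k n : ℕ) : ℕ := 15 + Nat.log 2 n + 3 * Network.branching n + k

namespace Network

variable {n : ℕ} {G : Network n} {k c a : ℕ} {U : Finset (Fin n)} {w v : Fin n}

theorem length_natCode_le {m : ℕ} (h : m ≤ (n + 1) ^ (a + 2) + k) :
    (natCode m).length ≤ numberBits k a n := length_natCode_mono h

theorem length_natCode_le_of_le {m : ℕ} (h : m ≤ n) :
    (natCode m).length ≤ numberBits k a n :=
  length_natCode_le (by
    have := Nat.le_self_pow (show a + 2 ≠ 0 by omega) (n + 1)
    omega)

theorem length_natCode_le_of_le_pow {m : ℕ} (h : m ≤ (n + 1) ^ (a + 1)) :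
    (natCode m).length ≤ numberBits k a n :=
  length_natCode_le (h.trans ((Nat.pow_le_pow_right (by omega) (by omega)).trans
    (Nat.le_add_right _ k)))

theorem length_natCode_le_of_le_right {m : ℕ} (h : m ≤ k) :
    (natCode m).length ≤ numberBits k a n :=
  length_natCode_le (h.trans (Nat.le_add_left _ _))

theorem length_natCode_ident_le (hG : G.PolyBounded a) (v : Fin n) :
    (natCode (G.ident v)).length ≤ numberBits k a n :=
  length_natCode_le_of_le_pow ((hG.1 v).le.trans (Nat.pow_le_pow_right (by omega) (by omega)))

theorem IsTree.length_treeName_code_le (hU : G.IsTree U w) (hv : v ∈ U) (k a : ℕ) :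
    (G.treeName U w v).code.length ≤ numberBits k a n * (Nat.log 2 n + 2) := by
  have h1 := hU.preorder_add_le hv
  have h2 := hU.length_lightPorts_le hv
  refine CompactRouting.length_treeName_code_le (length_natCode_le_of_le ?_)
    (length_natCode_le_of_le ?_) (fun q hq => length_natCode_le_of_le (mem_lightPorts_le hq)) h2
  · simp only [treeName]
    omega
  · exact h2.trans (Nat.log_le_self 2 n)

theorem IsTree.length_treeTable_code_le (hU : G.IsTree U w) (hv : v ∈ U) (k a : ℕ) :
    (G.treeTable U w v).code.length ≤ numberBits k a n * (3 * branching n + 5) := by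
  classical
  have hnum : ∀ {x : Fin n}, x ∈ U → G.preorder U w x ≤ n ∧ G.preorderMax U w x ≤ n := by
    intro x hx
    have := hU.preorder_add_le hx
    unfold preorderMax
    omega
  refine CompactRouting.length_treeTable_code_le (length_natCode_le_of_le (hnum hv).1)
    (length_natCode_le_of_le (hnum hv).2) (length_natCode_le_of_le ?_)
    (length_natCode_le_of_le (parentPort_le w v))
    (length_natCode_le_of_le (length_heavy_le_card U w v)) (fun e he => ?_)
    (hU.length_heavy_le hv)
  · exact (hU.length_lightPorts_le hv).trans (Nat.log_le_self 2 n)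
  · simp only [treeTable] at he
    obtain ⟨x, hx, rfl⟩ := List.mem_map.1 he
    have hx' := List.mem_filter.1 hx
    have hxU := (mem_children.1 (of_decide_eq_true hx'.2).1).1
    exact ⟨length_natCode_le_of_le (port_le ((G.mem_nbrs v x).1 hx'.1)),
      length_natCode_le_of_le (hnum hxU).1, length_natCode_le_of_le (hnum hxU).2⟩

theorem IsTree.length_nodeRec_code_le (hU : G.IsTree U w) (hv : v ∈ U) (hG : G.PolyBounded a)
    (k : ℕ) : (G.nodeRec U w v).code.length ≤ numberBits k a n * (Nat.log 2 n + 7) := by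
  have h1 := length_natCode_le_of_le_pow (k := k) (dist_le_of_polyBounded hG v w)
  have h2 := length_natCode_le_of_le (k := k) (a := a) (G.parentPort_le w v)
  have h3 := length_natCode_le_of_le_pow (k := k) (a := a)
    ((parentCode_le hG w v).trans (Nat.pow_le_pow_right (by omega) (by omega)))
  have h4 := length_natCode_le_of_le (k := k) (a := a) (G.downPort_le w v)
  have h5 := length_natCode_le_of_le (k := k) (a := a) (G.subtreeSize_le U w v)
  have h6 := hU.length_treeName_code_le hv k a
  simp only [NodeRec.code, nodeRec, List.length_append]
  linarith

theorem _root_.CompactRouting.Enumerates.length_le {α : Type} {s : List α} {A : Finset (Fin n)}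
    {f : Fin n → α} (h : Enumerates s A f) (hf : ∀ u ∈ A, ∀ u' ∈ A, f u = f u' → u = u') :
    s.length ≤ n := by
  rw [h.length_eq hf]
  exact (Finset.card_le_univ A).trans (by simp)

section Certificates

variable {lev : Fin n → ℕ}

theorem length_bunchEntry_code_le (hL : IsLandmarks k (levels lev)) (hG : G.PolyBounded a)
    (hlev : ∀ v, lev v < k) {v u : Fin n} (hu : u ∈ G.bunch k (levels lev) v) :
    (G.bunchEntry k lev v u).code.length ≤ numberBits k a n * entryBound k n := by
  classical
  have hv := mem_treeNodes.2 hu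
  have h1 := length_natCode_ident_le (k := k) hG u
  have h2 := length_natCode_le_of_le_right (n := n) (a := a) (hlev u).le
  have h3 := (hL.isTree u).length_nodeRec_code_le hv hG k
  have h4 := (hL.isTree u).length_treeTable_code_le hv k a
  have h5 := length_listCode_le (f := natCode) (l := (G.bunchEntry k lev v u).counts)
    (W := numberBits k a n) (B := numberBits k a n)
    (length_natCode_le_of_le_right (by simp [bunchEntry])) fun e he => by
      obtain ⟨i, -, rfl⟩ := List.mem_map.1 he
      refine length_natCode_le_of_le (le_trans ?_
        (G.subtreeSize_le (G.treeNodes k (levels lev) u) u v))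
      rw [subtreeSize_eq_subtreeSum]
      exact Finset.sum_le_sum fun x _ => by split <;> omega
  have h6 : (G.bunchEntry k lev v u).counts.length = k := by simp [bunchEntry]
  rw [h6] at h5
  simp only [BunchEntry.code, List.length_append, entryBound]
  simp only [bunchEntry] at h5 ⊢
  linarith

theorem length_clusterEntry_code_le (hk : 2 ≤ k) (hL : IsLandmarks k (levels lev))
    (hG : G.PolyBounded a) {v u : Fin n} (hu : u ∈ G.cluster (levels lev) v) :
    (G.clusterEntry k lev v u).code.length ≤ numberBits k a n * entryBound k n := by
  have hut := mem_treeNodes.2 (hL.mem_bunch_of_mem_cluster (by omega) hu)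
  have h1 := length_natCode_ident_le (k := k) hG u
  have h2 : (natCode (G.distSet u (levels lev 1)).toNat).length ≤ numberBits k a n := by
    obtain ⟨x, -, hx⟩ := exists_distSet_eq (G := G) (v := u) (hL.nonempty_of_lt (i := 1) hk)
    rw [← hx, ENat.toNat_natCast]
    exact length_natCode_le_of_le_pow (dist_le_of_polyBounded hG u x)
  have h3 := (hL.isTree v).length_nodeRec_code_le hut hG k
  have h4 := Nat.zero_le (numberBits k a n * (6 + 3 * branching n + k))
  simp only [ClusterEntry.code, List.length_append, entryBound]
  simp only [clusterEntry]
  linarith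

theorem length_trueCert_code_le (hk : 2 ≤ k) (hL : IsLandmarks k (levels lev))
    (hG : G.PolyBounded a) (hlev : ∀ v, lev v < k) {v : Fin n} {s t : List (Fin n)}
    (hs : s.Nodup) (hsA : ∀ u, u ∈ s ↔ u ∈ G.bunch k (levels lev) v)
    (ht : t.Nodup) (htA : ∀ u, u ∈ t ↔ u ∈ G.cluster (levels lev) v) :
    (G.trueCert k lev v s t).code.length ≤ numberBits k a n * entryBound k n *
      ((G.bunch k (levels lev) v).card + (G.cluster (levels lev) v).card + 1) := by
  classical
  have hs' : s.length = (G.bunch k (levels lev) v).card := by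
    rw [← List.toFinset_card_of_nodup hs]
    exact congrArg _ (Finset.ext fun u => by rw [List.mem_toFinset, hsA])
  have ht' : t.length = (G.cluster (levels lev) v).card := by
    rw [← List.toFinset_card_of_nodup ht]
    exact congrArg _ (Finset.ext fun u => by rw [List.mem_toFinset, htA])
  have h1 := length_natCode_le_of_le (n := n) (k := k) (a := a) le_rfl
  have h2 := length_natCode_ident_le (k := k) hG v
  have h3 := length_natCode_le_of_le_right (n := n) (a := a) (hlev v).le
  have h4 := length_listCode_le (f := natCode) (l := (G.trueCert k lev v s t).dists)
    (W := numberBits k a n) (B := numberBits k a n)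
    (length_natCode_le_of_le_right (by simp [trueCert])) fun e he => by
      obtain ⟨i, hi, rfl⟩ := List.mem_map.1 he
      obtain ⟨x, -, hx⟩ := exists_distSet_eq (G := G) (v := v)
        (hL.nonempty_of_lt (List.mem_range.1 hi))
      rw [← hx, ENat.toNat_natCast]
      exact length_natCode_le_of_le_pow (dist_le_of_polyBounded hG v x)
  have h5 : (G.trueCert k lev v s t).dists.length = k := by simp [trueCert]
  have h6 := length_listCode_le (f := BunchEntry.code) (l := s.map (G.bunchEntry k lev v))
    (W := numberBits k a n) (B := numberBits k a n * entryBound k n)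
    (length_natCode_le_of_le (by
      rw [List.length_map, hs']
      exact (Finset.card_le_univ _).trans (by simp))) fun e he => by
      obtain ⟨u, hu, rfl⟩ := List.mem_map.1 he
      exact length_bunchEntry_code_le hL hG hlev ((hsA u).1 hu)
  have h7 := length_listCode_le (f := ClusterEntry.code) (l := t.map (G.clusterEntry k lev v))
    (W := numberBits k a n) (B := numberBits k a n * entryBound k n)
    (length_natCode_le_of_le (by
      rw [List.length_map, ht']
      exact (Finset.card_le_univ _).trans (by simp))) fun e he => by
      obtain ⟨u, hu, rfl⟩ := List.mem_map.1 he
      exact length_clusterEntry_code_le hk hL hG ((htA u).1 hu)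
  rw [List.length_map, hs'] at h6
  rw [List.length_map, ht'] at h7
  rw [h5] at h4
  have h8 : numberBits k a n * (6 + k) ≤ numberBits k a n * entryBound k n :=
    Nat.mul_le_mul_left _ (by unfold entryBound; omega)
  simp only [Cert.code, List.length_append]
  simp only [trueCert] at h4 ⊢
  linarith

end Certificates

section Tables

variable {L : ℕ → Finset (Fin n)} {l : ℕ → Fin n → Fin n}

theorem IsTable.length_code_le {T : Table} (hk : 2 ≤ k) (hL : IsLandmarks k L)
    (hl : G.IsNearest k L l) (hG : G.PolyBounded a) (hT : G.IsTable k L l v T) :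
    T.code.length ≤ numberBits k a n * entryBound k n *
      ((G.bunch k L v).card + (G.cluster L v).card + k + 1) := by
  have hA : ∀ x : ℕ, x ≤ entryBound k n →
      numberBits k a n * x ≤ numberBits k a n * entryBound k n := fun x hx =>
    Nat.mul_le_mul_left _ hx
  have hbf : ∀ u ∈ G.bunch k L v, ∀ u' ∈ G.bunch k L v, (G.ident u,
      G.treeTable (G.treeNodes k L u) u v, G.treeName (G.treeNodes k L u) u v) = (G.ident u',
      G.treeTable (G.treeNodes k L u') u' v, G.treeName (G.treeNodes k L u') u' v) → u = u' :=
    fun u _ u' _ h => G.ident_injective (congrArg Prod.fst h)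
  have hcf : ∀ u ∈ G.cluster L v, ∀ u' ∈ G.cluster L v, (G.ident u,
      G.treeName (G.treeNodes k L v) v u) = (G.ident u', G.treeName (G.treeNodes k L v) v u') →
      u = u' := fun u _ u' _ h => G.ident_injective (congrArg Prod.fst h)
  have h1 := length_listCode_le (f := fun e : ℕ × TreeTable × TreeName =>
      natCode e.1 ++ e.2.1.code ++ e.2.2.code)
    (W := numberBits k a n) (B := numberBits k a n * entryBound k n)
    (length_natCode_le_of_le (hT.1.length_le hbf)) fun e he => by
      obtain ⟨u, hu, rfl⟩ := (hT.1.2 e).1 he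
      have hv := mem_treeNodes.2 hu
      have h1 := length_natCode_ident_le (k := k) hG u
      have h2 := (hL.isTree u).length_treeTable_code_le hv k a
      have h3 := (hL.isTree u).length_treeName_code_le hv k a
      have h4 := hA (8 + Nat.log 2 n + 3 * branching n) (by unfold entryBound; omega)
      simp only [List.length_append]
      linarith
  have h2 := length_listCode_le (f := fun e : ℕ × TreeName => natCode e.1 ++ e.2.code)
    (W := numberBits k a n) (B := numberBits k a n * entryBound k n)
    (length_natCode_le_of_le (hT.2.1.length_le hcf)) fun e he => by
      obtain ⟨u, hu, rfl⟩ := (hT.2.1.2 e).1 he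
      have hv := mem_treeNodes.2 (hL.mem_bunch_of_mem_cluster (by omega) hu)
      have h1 := length_natCode_ident_le (k := k) hG u
      have h3 := (hL.isTree v).length_treeName_code_le hv k a
      have h4 := hA (3 + Nat.log 2 n) (by unfold entryBound; omega)
      simp only [List.length_append]
      linarith
  have hlen : T.landmarks.length = k := by rw [hT.2.2, List.length_map, List.length_range]
  have h3 := length_listCode_le (f := fun e : ℕ × TreeTable => natCode e.1 ++ e.2.code)
    (l := T.landmarks) (W := numberBits k a n) (B := numberBits k a n * entryBound k n)
    (length_natCode_le_of_le_right hlen.le) fun e he => by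
      rw [hT.2.2] at he
      obtain ⟨i, hi, rfl⟩ := List.mem_map.1 he
      have hv := mem_treeNodes.2 (hl.mem_bunch hL (List.mem_range.1 hi) v)
      have h1 := length_natCode_ident_le (k := k) hG (l i v)
      have h2 := (hL.isTree (l i v)).length_treeTable_code_le hv k a
      have h4 := hA (6 + 3 * branching n) (by unfold entryBound; omega)
      simp only [List.length_append]
      linarith
  rw [hT.1.length_eq hbf] at h1
  rw [hT.2.1.length_eq hcf] at h2
  rw [hlen] at h3
  have h4 := hA 3 (by unfold entryBound; omega)
  simp only [Table.code, List.length_append]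
  linarith

theorem length_nameOf_code_le (hL : IsLandmarks k L) (hl : G.IsNearest k L l)
    (hG : G.PolyBounded a) (v : Fin n) :
    (Name.code (G.nameOf k L l v)).length ≤
      numberBits k a n * entryBound k n * (k + 1) := by
  have hA : ∀ x : ℕ, x ≤ entryBound k n →
      numberBits k a n * x ≤ numberBits k a n * entryBound k n := fun x hx =>
    Nat.mul_le_mul_left _ hx
  have hlen : (G.nameOf k L l v).length = k := by
    rw [nameOf, List.length_map, List.length_range]
  have h3 := length_listCode_le (f := fun e : ℕ × TreeName => natCode e.1 ++ e.2.code)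
    (l := G.nameOf k L l v) (W := numberBits k a n) (B := numberBits k a n * entryBound k n)
    (length_natCode_le_of_le_right hlen.le) fun e he => by
      rw [nameOf] at he
      obtain ⟨i, hi, rfl⟩ := List.mem_map.1 he
      have hv := mem_treeNodes.2 (hl.mem_bunch hL (List.mem_range.1 hi) v)
      have h1 := length_natCode_ident_le (k := k) hG (l i v)
      have h2 := (hL.isTree (l i v)).length_treeName_code_le hv k a
      have h4 := hA (3 + Nat.log 2 n) (by unfold entryBound; omega)
      simp only [List.length_append]
      linarith
  rw [hlen] at h3
  have h4 := hA 1 (by unfold entryBound; omega)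
  rw [Name.code]
  linarith

end Tables

end Network

/-! ### Polylogarithmic bounds -/

theorem numberBits_le (k a n : ℕ) :
    (numberBits k a n : ℝ) ≤ (4 * a + 2 * k + 11 : ℕ) * (1 + Real.log n) := by
  have h1 : n + 1 ≤ 2 ^ (Nat.log 2 n + 1) := Nat.lt_pow_succ_log_self one_lt_two n
  have h2 : (n + 1) ^ (a + 2) ≤ 2 ^ ((Nat.log 2 n + 1) * (a + 2)) := by
    rw [pow_mul]
    exact Nat.pow_le_pow_left h1 _
  have h3 : (n + 1) ^ (a + 2) + k < 2 ^ ((Nat.log 2 n + 1) * (a + 2) + k) + 1 := by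
    have hx : 1 ≤ 2 ^ ((Nat.log 2 n + 1) * (a + 2)) := Nat.one_le_two_pow
    have hy : k < 2 ^ k := Nat.lt_two_pow_self
    generalize (n + 1) ^ (a + 2) = y at h2 ⊢
    rw [pow_add]
    nlinarith
  have h4 : ((n + 1) ^ (a + 2) + k).size ≤ (Nat.log 2 n + 1) * (a + 2) + k + 1 := by
    refine Nat.size_le.2 (h3.trans_le ?_)
    rw [pow_succ 2 (_ + k)]
    have := Nat.one_le_two_pow (n := (Nat.log 2 n + 1) * (a + 2) + k)
    omega
  have h5 : numberBits k a n ≤ 2 * ((Nat.log 2 n + 1) * (a + 2) + k + 1) + 1 := by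
    rw [numberBits, length_natCode]
    omega
  have h6 : (numberBits k a n : ℝ) ≤ 2 * ((Nat.log 2 n + 1) * (a + 2) + k + 1) + 1 := by
    exact_mod_cast h5
  have h7 := natLog_two_le n
  have h8 := one_le_one_add_log n
  have ha : (0 : ℝ) ≤ a := Nat.cast_nonneg a
  have hk : (0 : ℝ) ≤ k := Nat.cast_nonneg k
  have h9 : ((Nat.log 2 n : ℝ) + 1) * (a + 2) ≤ 2 * (1 + Real.log n) * (a + 2) :=
    mul_le_mul_of_nonneg_right (by linarith) (by linarith)
  have h10 : (2 * k + 3 : ℝ) * 1 ≤ (2 * k + 3) * (1 + Real.log n) :=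
    mul_le_mul_of_nonneg_left h8 (by linarith)
  push_cast
  linarith

theorem entryBound_le (k n : ℕ) :
    (entryBound k n : ℝ) ≤ (k + 29 : ℕ) * (1 + Real.log n) := by
  have h1 : entryBound k n ≤ 21 + 4 * Nat.log 2 n + k := by
    have := Nat.sqrt_le_self (Nat.log 2 n)
    unfold entryBound Network.branching
    omega
  have h2 : (entryBound k n : ℝ) ≤ 21 + 4 * Nat.log 2 n + k := by exact_mod_cast h1
  have h3 := natLog_two_le n
  have h4 := one_le_one_add_log n
  have hk : (0 : ℝ) ≤ k := Nat.cast_nonneg k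
  have h5 : (k : ℝ) * 1 ≤ k * (1 + Real.log n) := mul_le_mul_of_nonneg_left h4 hk
  push_cast
  linarith

/-- A constant for the sizes of tables, names and certificates. -/
def sizeConst (k c a : ℕ) : ℕ :=
  (4 * a + 2 * k + 11) * (k + 29) * (2 * c + k + 1) + (c + 2)

theorem numberBits_mul_entryBound_le (k a n : ℕ) : (numberBits k a n * entryBound k n : ℝ) ≤
    ((4 * a + 2 * k + 11) * (k + 29) : ℕ) * (1 + Real.log n) ^ 2 := by
  have h := mul_le_mul (numberBits_le k a n) (entryBound_le k n) (Nat.cast_nonneg _)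
    ((Nat.cast_nonneg _).trans (numberBits_le k a n))
  refine h.trans_eq ?_
  push_cast
  ring

theorem le_polylog {k c a n x : ℕ} (hx : x ≤ numberBits k a n * entryBound k n * (k + 1)) :
    (x : ℝ) ≤ polylog (sizeConst k c a) n := by
  have hΛ := one_le_one_add_log n
  have h1 : (x : ℝ) ≤ numberBits k a n * entryBound k n * (k + 1) := by exact_mod_cast hx
  refine h1.trans ((mul_le_mul_of_nonneg_right (numberBits_mul_entryBound_le k a n)
    (by positivity)).trans ?_)
  have h2 : (1 + Real.log n) ^ 2 ≤ (1 + Real.log n) ^ sizeConst k c a :=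
    pow_le_pow_right₀ hΛ (by unfold sizeConst; omega)
  have h3 : (4 * a + 2 * k + 11) * (k + 29) * (k + 1) ≤ sizeConst k c a := by
    unfold sizeConst
    have := Nat.mul_le_mul_left ((4 * a + 2 * k + 11) * (k + 29))
      (show k + 1 ≤ 2 * c + k + 1 by omega)
    omega
  have h4 : (((4 * a + 2 * k + 11) * (k + 29) * (k + 1) : ℕ) : ℝ) ≤ sizeConst k c a := by
    exact_mod_cast h3
  rw [polylog]
  refine le_trans (le_of_eq ?_) (mul_le_mul h4 h2 (by positivity) (Nat.cast_nonneg _))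
  push_cast
  ring

/-- A bound for data that have polylogarithmically many bits for each node of the bunch and of the
cluster. -/
theorem le_softO {k c a n x b d : ℕ} (hn : 0 < n)
    (hx : x ≤ numberBits k a n * entryBound k n * (b + d + k + 1))
    (hb : (b : ℝ) ≤ softO (1 / (k : ℝ)) c n) (hd : (d : ℝ) ≤ c * (n : ℝ) ^ (1 / (k : ℝ))) :
    (x : ℝ) ≤ softO (1 / (k : ℝ)) (sizeConst k c a) n := by
  have hΛ := one_le_one_add_log n
  have hz : 1 ≤ (n : ℝ) ^ (1 / (k : ℝ)) :=
    Real.one_le_rpow (by exact_mod_cast hn) (by positivity)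
  have hΛc : 1 ≤ (1 + Real.log n) ^ c := one_le_pow₀ hΛ
  have hc : (0 : ℝ) ≤ c := Nat.cast_nonneg c
  have hk : (0 : ℝ) ≤ k := Nat.cast_nonneg k
  rw [softO, polylog] at hb ⊢
  set z := (n : ℝ) ^ (1 / (k : ℝ))
  set Λ := 1 + Real.log n
  have h1 : (b + d + k + 1 : ℝ) ≤ (2 * c + k + 1) * (z * Λ ^ c) := by
    have h2 : c * z ≤ c * (z * Λ ^ c) :=
      mul_le_mul_of_nonneg_left (le_mul_of_one_le_right (by linarith) hΛc) hc
    have h3 : 1 ≤ z * Λ ^ c := one_le_mul_of_one_le_of_one_le hz hΛc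
    have h4 := le_mul_of_one_le_right (show (0 : ℝ) ≤ k + 1 by linarith) h3
    linarith
  have h2 : (x : ℝ) ≤ numberBits k a n * entryBound k n * (b + d + k + 1) := by exact_mod_cast hx
  have h3 := mul_le_mul (numberBits_mul_entryBound_le k a n) h1 (by positivity) (by positivity)
  have h4 : Λ ^ (c + 2) ≤ Λ ^ sizeConst k c a :=
    pow_le_pow_right₀ hΛ (by unfold sizeConst; omega)
  have h5 : (((4 * a + 2 * k + 11) * (k + 29) * (2 * c + k + 1) : ℕ) : ℝ) ≤ sizeConst k c a := by
    exact_mod_cast Nat.le_add_right _ _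
  refine h2.trans (h3.trans (le_trans (le_of_eq ?_) (mul_le_mul_of_nonneg_left
    (mul_le_mul h5 h4 (by positivity) (Nat.cast_nonneg _)) (show 0 ≤ z by linarith))))
  push_cast
  ring

/-! ### Verifiability -/

namespace Network

variable {n : ℕ} {G : Network n} {k c a : ℕ}

/-- If all nodes accept, then the tables and the certificates are codes that comply with the local
rules: a certificate which a node decodes for itself is the one which its neighbours decode. -/
theorem exists_locallyCorrect {τ κ : Fin n → List Bool}
    (h : ∀ v, verifier k c (G.view τ κ v) = true) :
    ∃ (T : Fin n → Table) (K : Fin n → Cert),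
      (∀ v, τ v = (T v).code) ∧ G.LocallyCorrect k c T K := by
  classical
  have h' := fun v => of_decide_eq_true (h v)
  choose T K nb hT hK hnb hrules using h'
  refine ⟨T, K, hT, fun v => ?_⟩
  have hinj : Function.Injective fun x : ℕ × Cert => (x.1, x.2.code) := fun x y hxy =>
    Prod.ext (Prod.ext_iff.1 hxy).1 (isPrefixCode_cert.injective (Prod.ext_iff.1 hxy).2)
  have hmap : nb v = (G.nbrs v).map fun x => (G.len s(v, x), K x) := by
    refine List.map_injective_iff.2 hinj ((hnb v).symm.trans ?_)
    simp only [view, List.map_map]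
    refine List.map_congr_left fun x _ => ?_
    exact Prod.ext rfl (hK x)
  rw [← hmap]
  exact hrules v

theorem LocallyCorrect.verifier_eq_true {T : Fin n → Table} {K : Fin n → Cert}
    (h : G.LocallyCorrect k c T K) {τ : Fin n → List Bool} (hτ : ∀ v, τ v = (T v).code)
    (v : Fin n) : verifier k c (G.view τ (fun v => (K v).code) v) = true := by
  classical
  refine decide_eq_true ⟨T v, K v, _, hτ v, rfl, ?_, h v⟩
  simp only [view, List.map_map]
  rfl

theorem IsThorupZwick.exists_cert (hk : 2 ≤ k) {T : Fin n → Table} {N : Fin n → Name}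
    (h : G.IsThorupZwick k c T N) (hG : G.PolyBounded a) :
    ∃ K : Fin n → Cert, G.LocallyCorrect k c T K ∧
      ∀ v, ((K v).code.length : ℝ) ≤ softO (1 / (k : ℝ)) (sizeConst k c a) n := by
  obtain ⟨L, l, hH, hl, hT⟩ := h
  obtain ⟨lev, hlev, rfl⟩ := hH.isLandmarks.exists_levels
  choose s hs hsA hTs using fun v => (hT v).1.1.exists_list fun u _ u' _ h =>
    G.ident_injective (congrArg Prod.fst h)
  choose t ht htA hTt using fun v => (hT v).1.2.1.exists_list fun u _ u' _ h =>
    G.ident_injective (congrArg Prod.fst h)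
  refine ⟨_, locallyCorrect_trueCert hk hlev hH hl (fun v => (hT v).1) hs hsA ht htA hTs hTt,
    fun v => le_softO v.pos ?_ (hH.bunch_le v) (hH.cluster_le v)⟩
  refine (length_trueCert_code_le hk hH.isLandmarks hG hlev (hs v) (hsA v) (ht v) (htA v)).trans
    (Nat.mul_le_mul_left _ (by omega))

theorem IsThorupZwick.length_code_le (hk : 2 ≤ k) {T : Fin n → Table} {N : Fin n → Name}
    (h : G.IsThorupZwick k c T N) (hG : G.PolyBounded a) (v : Fin n) :
    ((T v).code.length : ℝ) ≤ softO (1 / (k : ℝ)) (sizeConst k c a) n ∧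
      ((N v).code.length : ℝ) ≤ polylog (sizeConst k c a) n := by
  obtain ⟨L, l, hH, hl, hT⟩ := h
  refine ⟨le_softO v.pos ((hT v).1.length_code_le hk hH.isLandmarks hl hG) (hH.bunch_le v)
    (hH.cluster_le v), ?_⟩
  rw [(hT v).2]
  exact le_polylog (length_nameOf_code_le hH.isLandmarks hl hG v)

end Network

theorem thorupZwick_verifiable {k : ℕ} (hk : 2 ≤ k) (c a : ℕ) :
    (thorupZwick k c).Verifiable (fun _ G => G.PolyBounded a)
      (softO (1 / (k : ℝ)) (sizeConst k c a)) := by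
  refine ⟨verifier k c, fun n G hG τ => ⟨?_, fun hτ κ => ?_⟩⟩
  · rintro ⟨T, N, h, hτ⟩
    obtain ⟨K, hK, hsize⟩ := Network.IsThorupZwick.exists_cert hk h hG
    exact ⟨_, hsize, hK.verifier_eq_true hτ⟩
  · by_contra! hacc
    obtain ⟨T, K, hT, hK⟩ := Network.exists_locallyCorrect
      fun v => Bool.eq_true_of_not_eq_false (hacc v)
    obtain ⟨N, hN⟩ := hK.isThorupZwick hk
    exact hτ ⟨T, N, hN, hT⟩

/-- Correct tables are the same with and without handshaking, so the same verification works. -/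
theorem thorupZwickHandshake_verifiable {k : ℕ} (hk : 2 ≤ k) (c a : ℕ) :
    (thorupZwickHandshake k c).Verifiable (fun _ G => G.PolyBounded a)
      (softO (1 / (k : ℝ)) (sizeConst k c a)) :=
  thorupZwick_verifiable hk c a

end
end CompactRouting

theorem theorem3 (k : ℕ) (hk : 2 ≤ k) :
    ∃ c₀ : ℕ, ∀ c : ℕ, c₀ ≤ c →
      ((CompactRouting.thorupZwick k c).Total ∧
        (CompactRouting.thorupZwick k c).HasStretch (4 * k - 5) ∧
        ∀ a : ℕ, ∃ C : ℕ,
          (CompactRouting.thorupZwick k c).HasSize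
            (fun _ G => G.PolyBounded a)
            (CompactRouting.softO (1 / (k : ℝ)) C) (CompactRouting.polylog C) ∧
          (CompactRouting.thorupZwick k c).Verifiable
            (fun _ G => G.PolyBounded a)
            (CompactRouting.softO (1 / (k : ℝ)) C)) ∧
      ((CompactRouting.thorupZwickHandshake k c).Total ∧
        (CompactRouting.thorupZwickHandshake k c).HasStretch (2 * k - 1) ∧
        ∀ a : ℕ, ∃ C : ℕ,
          (CompactRouting.thorupZwickHandshake k c).HasSize
            (fun _ G => G.PolyBounded a)
            (CompactRouting.softO (1 / (k : ℝ)) C) (CompactRouting.polylog C) ∧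
          (CompactRouting.thorupZwickHandshake k c).Verifiable
            (fun _ G => G.PolyBounded a)
            (CompactRouting.softO (1 / (k : ℝ)) C)) := by
  refine ⟨3 * k + 8, fun c hc => ⟨⟨?_, ?_, fun a => ⟨CompactRouting.sizeConst k c a, ?_, ?_⟩⟩,
    ?_, ?_, fun a => ⟨CompactRouting.sizeConst k c a, ?_, ?_⟩⟩⟩
  · exact fun n G => CompactRouting.exists_isThorupZwick G hk hc
  · exact CompactRouting.thorupZwick_hasStretch hk c
  · exact fun n G hG T N h v => CompactRouting.Network.IsThorupZwick.length_code_le hk h hG v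
  · exact CompactRouting.thorupZwick_verifiable hk c a
  · exact fun n G => CompactRouting.exists_isThorupZwick G hk hc
  · exact CompactRouting.thorupZwickHandshake_hasStretch hk c
  · exact fun n G hG T N h v => CompactRouting.Network.IsThorupZwick.length_code_le hk h hG v
  · exact CompactRouting.thorupZwickHandshake_verifiable hk c a
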